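/- Let $\Sigma$ be a finite alphabet and $\Xi$ a countably infinite set of variables disjoint from $\Sigma$. **FC-Datalog.** A pattern is a word over $\Sigma\cup\Xi$. An atom is either a pattern equation $x\doteq\alpha$ with $x\in\Xi$ and $\alpha$ a pattern, or a relation atom $R(y_1,\dots,y_{\mathrm{ar}(R)})$ with a relation symbol $R$ of arity $\mathrm{ar}(R)\ge 0$ and $y_1,\dots,y_{\mathrm{ar}(R)}\in\Xi$. An FC-Datalog program $P=(\mathfrak u,\mathcal R,\Phi)$ consists of a universe variable $\mathfrak u\in\Xi$, a finite set $\mathcal R$ of relation symbols containing an output symbol $\mathrm{Ans}$, and a finite set $\Phi$ of rules $R(x_1,\dots,x_{\mathrm{ar}(R)})\leftarrow\varphi_1,\dots,\varphi_m$ with $m\ge 1$, where $R\in\mathcal R$, every $\varphi_i$ is an atom with relation symbol (if any) in $\mathcal R$, and every $x_j$ occurs in some $\varphi_i$. On input $w\in\Sigma^*$, all relations are initially empty. For every rule as above and every substitution $\theta$ of words for variables (the identity on $\Sigma$) such that $\theta(\mathfrak u)=w$, $\theta(x)$ is a factor (contiguous subword) of $w$ for every variable $x$ of the body, and every body atom holds,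 the tuple $(\theta(x_1),\dots,\theta(x_{\mathrm{ar}(R)}))$ is added to $R$; this is repeated until all relations have stabilized. Here $x\doteq\alpha$ holds if $\theta(x)=\theta(\alpha)$ and this word is a factor of $w$, and $R(\vec y)$ holds if $\theta(\vec y)$ is currently in $R$ and its components are factors of $w$. If $\mathrm{ar}(\mathrm{Ans})=0$, then $P$ is called Boolean and $\mathcal L(P)$ is the set of all $w\in\Sigma^*$ for which the final content of $\mathrm{Ans}$ is $\{()\}$. **Linearity.** Write $R\leftarrow R'$ if some rule of $P$ has head symbol $R$ and a body atom with symbol $R'$. The symbols $R,R'$ are mutually recursive if each is related to the other by the transitive closure of $\leftarrow$. The program $P$ is linear if, in every rule, at most one body atom has a relation symbol that is mutually recursive with the head symbol. **NLOGSPACE.** A language over $\Sigma$ is in $\mathsf{NLOGSPACE}$ if it is the language accepted by some nondeterministic Turing machine with a read-only two-way input tape with endmarkers and finitely many read-write work tapes, such that on inputs of length $n$ every computation scans $O(\log n)$ cells (more precisely, at most $C(\lfloor\log_2 \max(n,1)\rfloor+1)$ cells for a constant $C$) of each work tape. **Theorem.** Linear FC-Datalog captures $\mathsf{NLOGSPACE}$: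 for every finite alphabet $\Sigma$, $$\mathsf{NLOGSPACE}=\{\mathcal L(P)\mid P \text{ is a Boolean linear FC-Datalog program over } \Sigma\},$$ where the left-hand side denotes the class of $\mathsf{NLOGSPACE}$ languages over $\Sigma$. -/

import Mathlib

/-! ## FC-Datalog -/

namespace FCDatalog

/-- The countably infinite set of variables. -/
abbrev Var : Type := ℕ

/-- Patterns: words over the disjoint union of the terminals and the variables. -/
abbrev Pattern (α : Type*) := List (α ⊕ Var)

/-- The image of a pattern under a substitution, i.e. the homomorphic extension of `θ` that is the
identity on terminals. Only values that are terminal words matter, since all values in use are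
required to be factors of the input word. -/
def subst {α : Type*} (θ : Var → List α) (p : Pattern α) : List α :=
  p.flatMap (Sum.elim (fun a => [a]) θ)

/-- Atoms: pattern equations `x ≐ p` and relation atoms `R(y₁, …, y_ar(R))`. -/
inductive Atom (α : Type*) (Rel : Type) (ar : Rel → ℕ)
  | eqn (x : Var) (p : Pattern α)
  | rel (R : Rel) (y : Fin (ar R) → Var)

namespace Atom

variable {α : Type*} {Rel : Type} {ar : Rel → ℕ}

/-- The variables that occur in an atom. -/
def vars : Atom α Rel ar → Set Var
  | eqn x p => {z | z = x ∨ Sum.inr z ∈ p}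
  | rel _ y => Set.range y

/-- The relation symbol `S` is the symbol of the atom. -/
def HasSymbol (S : Rel) : Atom α Rel ar → Prop
  | eqn _ _ => False
  | rel R _ => R = S

/-- `(w, θ) ⊨ φ`, where `I` is the current content of the relations; `t <:+: w` says that
`t` is a factor of `w`. -/
def Holds (I : (R : Rel) → Set (Fin (ar R) → List α)) (w : List α) (θ : Var → List α) :
    Atom α Rel ar → Prop
  | eqn x p => θ x = subst θ p ∧ θ x <:+: w ∧ subst θ p <:+: w
  | rel R y => (fun j => θ (y j)) ∈ I R ∧ ∀ j, θ (y j) <:+: w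

end Atom

/-- Rules `R(x₁, …, x_ar(R)) ← φ₁, …, φ_m` with `m ≥ 1`, in which every head variable occurs
in the body. -/
structure Rule (α : Type*) (Rel : Type) (ar : Rel → ℕ) where
  head : Rel
  headVars : Fin (ar head) → Var
  body : List (Atom α Rel ar)
  body_ne_nil : body ≠ []
  safe : ∀ j, ∃ φ ∈ body, headVars j ∈ φ.vars

/-- FC-Datalog programs over the terminal alphabet `α`. -/
structure Program (α : Type*) where
  /-- the universe variable -/
  univVar : Var
  /-- the finite set of relation symbols -/
  Rel : Type
  finite_rel : Finite Rel
  /-- the arities -/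
  ar : Rel → ℕ
  /-- the output relation symbol -/
  ans : Rel
  /-- the finite set of rules -/
  rules : Set (Rule α Rel ar)
  finite_rules : rules.Finite

namespace Program

variable {α : Type*} (P : Program α)

/-- Interpretations of the relation symbols as relations over words. -/
abbrev Interp := (R : P.Rel) → Set (Fin (P.ar R) → List α)

/-- `θ` is a `w`-substitution for the rule `ρ`. -/
def IsWSubst (w : List α) (ρ : Rule α P.Rel P.ar) (θ : Var → List α) : Prop :=
  θ P.univVar = w ∧ ∀ φ ∈ ρ.body, ∀ x ∈ φ.vars, θ x <:+: w

/-- One round of filling up the relations: every tuple that some rule yields from the current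
content `I` of the relations is added. -/
def step (w : List α) (I : P.Interp) : P.Interp := fun R =>
  I R ∪ {t | ∃ ρ ∈ P.rules, ∃ θ : Var → List α,
    P.IsWSubst w ρ θ ∧ (∀ φ ∈ ρ.body, φ.Holds I w θ) ∧
    ∃ h : ρ.head = R, t = fun j => θ (ρ.headVars (Fin.cast (by rw [h]) j))}

/-- The content of the relations after `n` rounds, starting from empty relations. -/
def stage (w : List α) : ℕ → P.Interp
  | 0 => fun _ => ∅
  | n + 1 => P.step w (stage w n)

/-- The output of `P` on `w`: the content of the output relation when all relations have
stabilized. The stages increase, so this is the union over all stages. -/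
def output (w : List α) : Set (Fin (P.ar P.ans) → List α) :=
  ⋃ n, P.stage w n P.ans

/-- Boolean programs. -/
def IsBoolean : Prop := P.ar P.ans = 0

/-- The language of a Boolean program: the words on which the output is `{()}` and not `∅`. -/
def language : Language α := {w | (P.output w).Nonempty}

/-- `R ← S`: some rule has head symbol `R` and a body atom with symbol `S`. -/
def DependsOn (R S : P.Rel) : Prop :=
  ∃ ρ ∈ P.rules, ρ.head = R ∧ ∃ φ ∈ ρ.body, φ.HasSymbol S

/-- Mutual recursion, through the transitive closure of `←`. -/
def MutuallyRecursive (R S : P.Rel) : Prop :=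
  Relation.TransGen P.DependsOn R S ∧ Relation.TransGen P.DependsOn S R

/-- Linear rules: at most one position of the body carries an atom whose relation symbol is
mutually recursive with the head symbol. -/
def IsLinearRule (ρ : Rule α P.Rel P.ar) : Prop :=
  ∀ i j : Fin ρ.body.length,
    (∃ S, (ρ.body.get i).HasSymbol S ∧ P.MutuallyRecursive ρ.head S) →
    (∃ S, (ρ.body.get j).HasSymbol S ∧ P.MutuallyRecursive ρ.head S) → i = j

/-- Linear programs. -/
def IsLinear : Prop := ∀ ρ ∈ P.rules, P.IsLinearRule ρ

end Program

/-- A fragment `F` captures a class `C` of languages if `C` consists exactly of the languages of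
the (Boolean) programs in `F`. -/
def Captures {α : Type*} (F : Set (Program α)) (C : Set (Language α)) : Prop :=
  C = {L | ∃ P ∈ F, P.IsBoolean ∧ P.language = L}

/-- Linear FC-Datalog. -/
def linearFCDatalog (α : Type*) : Set (Program α) := {P | P.IsLinear}

end FCDatalog

/-! ## Nondeterministic logarithmic space -/

namespace NSpace

/-- Symbols on the input tape: the two endmarkers and the letters. -/
inductive InputSymbol (α : Type*)
  | leftEnd
  | letter (a : α)
  | rightEnd

/-- Head movements. -/
inductive Move
  | left
  | stay
  | right

/-- Nondeterministic Turing machines with a read-only two-way input tape with endmarkers and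
`k` one-sided infinite read-write work tapes. -/
structure NTM (α : Type*) where
  /-- the number of work tapes -/
  k : ℕ
  State : Type
  finite_state : Finite State
  /-- the work tape alphabet -/
  Γ : Type
  finite_Γ : Finite Γ
  blank : Γ
  start : State
  accepting : Set State
  /-- The possible actions in a state, for the scanned input symbol and the scanned symbols of the
  work tapes: next state, symbols to write, movement of the input head, movements of the work
  heads. -/
  trans : State → InputSymbol α → (Fin k → Γ) → Set (State × (Fin k → Γ) × Move × (Fin k → Move))

namespace NTM

variable {α : Type*} (M : NTM α)

/-- Configurations (for a given input word). -/
structure Cfg where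
  state : M.State
  /-- position of the input head -/
  inPos : ℕ
  /-- contents of the work tapes -/
  tape : Fin M.k → ℕ → M.Γ
  /-- positions of the work heads -/
  pos : Fin M.k → ℕ

end NTM

/-- The input tape for `w`: the left endmarker in cell `0`, the letters of `w` in the cells
`1, …, |w|`, and the right endmarker in cell `|w| + 1`. -/
def inputAt {α : Type*} (w : List α) : ℕ → InputSymbol α
  | 0 => .leftEnd
  | i + 1 => (w[i]?).elim .rightEnd .letter

/-- Head movement on a one-sided infinite tape; at the left end a move to the left has no
effect. -/
def Move.apply : Move → ℕ → ℕ
  | .left, p => p - 1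
  | .stay, p => p
  | .right, p => p + 1

namespace NTM

variable {α : Type*} (M : NTM α)

/-- The initial configuration. -/
def init : M.Cfg where
  state := M.start
  inPos := 0
  tape := fun _ _ => M.blank
  pos := fun _ => 0

/-- One computation step on the input `w`. The input head never leaves the cells
`0, …, |w| + 1`. -/
def Step (w : List α) (c d : M.Cfg) : Prop :=
  ∃ q s m v, (q, s, m, v) ∈ M.trans c.state (inputAt w c.inPos) (fun i => c.tape i (c.pos i)) ∧
    d = { state := q
          inPos := min (m.apply c.inPos) (w.length + 1)
          tape := fun i => Function.update (c.tape i) (c.pos i) (s i)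
          pos := fun i => (v i).apply (c.pos i) }

/-- `c` occurs in some computation on the input `w`. -/
def Reachable (w : List α) (c : M.Cfg) : Prop :=
  Relation.ReflTransGen (M.Step w) M.init c

/-- The language accepted by `M`: some computation reaches an accepting state. -/
def language : Language α := {w | ∃ c, M.Reachable w c ∧ c.state ∈ M.accepting}

/-- On inputs of length `n`, no computation scans more than the first `s n` cells of any
work tape. -/
def IsSpaceBounded (s : ℕ → ℕ) : Prop :=
  ∀ w c, M.Reachable w c → ∀ i, c.pos i < s w.length

end NTM

/-- The languages over `α` accepted by nondeterministic Turing machines in logarithmic space. -/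
def NLOGSPACE (α : Type*) : Set (Language α) :=
  {L | ∃ M : NTM α, (∃ C : ℕ, M.IsSpaceBounded fun n => C * (Nat.log 2 n + 1)) ∧ M.language = L}

end NSpace

-- Both classes coincide with the languages of nondeterministic finite automata with several two-way
-- heads on the input (`HeadNFA`). A head stands between letters and so has |w| + 1 positions.
-- Finitely many heads therefore hold finitely many numbers of logarithmic bit length, and each
-- number is also a word, namely the prefix of the input to the left of the head.
--
-- Automata are easily simulated in both models. In FC-Datalog every state becomes a relation whose
-- arguments are the prefixes at the heads. A transition becomes a rule with a single relation atom,
-- so the program is linear (`isLinear_program`, `language_program`). A Turing machine keeps the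
-- head positions as binary counters. To perform an operation it counts down one counter while its
-- input head walks right, tests one symbol, and counts up again while it walks back
-- (`MicroInv.step`, `language_mem_NLOGSPACE`).
--
-- For the converse directions, automata are replaced by structured regular programs `Prog` over
-- heads, which `exists_headNFA` compiles to automata.
--
-- A linear FC-Datalog program is evaluated top-down (`language_eval`). A factor of the input is a
-- pair of heads, position and length. To derive a goal atom, a rule and a substitution are guessed
-- and the body is checked. Atoms that are not mutually recursive with the head symbol have smaller
-- `rank` and are checked by a subroutine with its own level of heads, so finitely many levels
-- suffice. By linearity at most one atom remains. It replaces the goal in a loop, and no stack of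
-- pending goals is needed.
--
-- For a logarithmic space machine, each work tape is a pair of stacks around the work head. A stack
-- of height O(log n), read as a number in a fixed base, is polynomial in n but may exceed n. Its
-- symbols are therefore dealt cyclically to k + 1 registers, with k constant, so that each register
-- stays at most n once n is large (`rep_le`, `pow_le_of_log`). Push and pop rotate the registers
-- and multiply or divide one of them by the base, which heads can do in unary (`sem_push`,
-- `sem_pop`). This gives the step-by-step simulation of `exists_sim`; the finitely many short
-- inputs are listed in a table.

/-! ## Regular programs over input heads -/

namespace HeadProg

universe u

/-- Elementary operations of a head that stands between two letters of the input word. -/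
inductive Op (α : Type u)
  | zero
  | last
  | fwd (a : α)
  | bwd (a : α)

/-- The effect of an operation on the position of the head. -/
def Op.Rel {α : Type u} (w : List α) : Op α → ℕ → ℕ → Prop
  | zero, v, v' => v = 0 ∧ v' = v
  | last, v, v' => v = w.length ∧ v' = v
  | fwd a, v, v' => w[v]? = some a ∧ v' = v + 1
  | bwd a, v, v' => v = v' + 1 ∧ w[v']? = some a

theorem Op.Rel.le {α : Type u} {w : List α} {o : Op α} {v v' : ℕ} (h : o.Rel w v v')
    (hv : v ≤ w.length) : v' ≤ w.length := by
  cases o with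
  | zero => simp only [Op.Rel] at h; omega
  | last => simp only [Op.Rel] at h; omega
  | fwd a =>
    obtain ⟨h1, h2⟩ := h
    have := (List.getElem?_eq_some_iff.1 h1).1
    omega
  | bwd a =>
    obtain ⟨h1, h2⟩ := h
    omega

/-- Actions: tests and changes of the mode, and operations of a head. -/
inductive Act (α : Type u) (ι F : Type)
  | test (f : F)
  | set (f : F)
  | head (i : ι) (o : Op α)

/-- A store consists of a mode and the positions of the heads. -/
abbrev Store (ι F : Type) := F × (ι → ℕ)

/-- Nondeterministic regular programs. -/
inductive Prog (α : Type u) (ι F : Type)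
  | act (a : Act α ι F)
  | fail
  | seq (p q : Prog α ι F)
  | alt (p q : Prog α ι F)
  | star (p : Prog α ι F)

variable {α : Type u} {ι F : Type} [DecidableEq ι]

def Act.Sem (w : List α) : Act α ι F → Store ι F → Store ι F → Prop
  | test f, s, t => s.1 = f ∧ t = s
  | set f, s, t => t = (f, s.2)
  | head i o, s, t => ∃ v, o.Rel w (s.2 i) v ∧ t = (s.1, Function.update s.2 i v)

/-- The input-output relation of a program. -/
def Prog.Sem (w : List α) : Prog α ι F → Store ι F → Store ι F → Prop
  | act a, s, t => a.Sem w s t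
  | fail, _, _ => False
  | seq p q, s, t => ∃ m, p.Sem w s m ∧ q.Sem w m t
  | alt p q, s, t => p.Sem w s t ∨ q.Sem w s t
  | star p, s, t => Relation.ReflTransGen (p.Sem w) s t

/-- The words on which a program can terminate when started with all heads at the left end. -/
def Prog.language (p : Prog α ι F) (f : F) : Language α :=
  {w | ∃ t, p.Sem w (f, fun _ => 0) t}

/-- Nondeterministic finite automata with several two-way heads. -/
structure HeadNFA (α : Type u) where
  N : ℕ
  k : ℕ
  M : ℕ
  src : Fin M → Fin N
  dst : Fin M → Fin N
  lab : Fin M → Option (Fin k × Op α)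
  start : Fin N
  final : Set (Fin N)

/-- The effect of a transition label on the heads. -/
def LabelSem (w : List α) : Option (ι × Op α) → (ι → ℕ) → (ι → ℕ) → Prop
  | none, h, h' => h' = h
  | some (i, o), h, h' => ∃ v, o.Rel w (h i) v ∧ h' = Function.update h i v

theorem LabelSem.le {w : List α} {l : Option (ι × Op α)} {h h' : ι → ℕ} (hl : LabelSem w l h h')
    (hh : ∀ i, h i ≤ w.length) (i : ι) : h' i ≤ w.length := by
  match l with
  | none => rw [show h' = h from hl]; exact hh i
  | some (j, o) =>
    obtain ⟨v, hv, rfl⟩ := hl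
    by_cases hij : i = j
    · subst hij; simpa using hv.le (hh i)
    · simpa [hij] using hh i

namespace HeadNFA

variable (A : HeadNFA α)

def Step (w : List α) (c d : Fin A.N × (Fin A.k → ℕ)) : Prop :=
  ∃ e, A.src e = c.1 ∧ A.dst e = d.1 ∧ LabelSem w (A.lab e) c.2 d.2

def Reachable (w : List α) : Fin A.N × (Fin A.k → ℕ) → Prop :=
  Relation.ReflTransGen (A.Step w) (A.start, fun _ => 0)

def language : Language α := {w | ∃ c, A.Reachable w c ∧ c.1 ∈ A.final}

theorem Reachable.le {A : HeadNFA α} {w : List α} {c : Fin A.N × (Fin A.k → ℕ)}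
    (hc : A.Reachable w c) : ∀ i, c.2 i ≤ w.length := by
  induction hc with
  | refl => simp
  | tail _ hs ih =>
    obtain ⟨e, -, -, he⟩ := hs
    exact he.le ih

end HeadNFA

/-! ### From programs to automata -/

namespace Prog

/-- Single steps of the execution of a list of programs that are waiting to be run. -/
inductive CtrlStep : List (Prog α ι F) × F → Option (ι × Op α) → List (Prog α ι F) × F → Prop
  | test (f K) : CtrlStep (act (.test f) :: K, f) none (K, f)
  | set (f g K) : CtrlStep (act (.set f) :: K, g) none (K, f)
  | head (i o K f) : CtrlStep (act (.head i o) :: K, f) (some (i, o)) (K, f)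
  | seq (p q K f) : CtrlStep (seq p q :: K, f) none (p :: q :: K, f)
  | left (p q K f) : CtrlStep (alt p q :: K, f) none (p :: K, f)
  | right (p q K f) : CtrlStep (alt p q :: K, f) none (q :: K, f)
  | leave (p K f) : CtrlStep (star p :: K, f) none (K, f)
  | loop (p K f) : CtrlStep (star p :: K, f) none (p :: star p :: K, f)

omit [DecidableEq ι] in
theorem CtrlStep.finite (c : List (Prog α ι F) × F) : {x : _ × _ | CtrlStep c x.1 x.2}.Finite := by
  obtain ⟨K, f⟩ := c
  match K with
  | [] => exact Set.finite_empty.subset (by rintro ⟨l, d⟩ h; cases h)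
  | .act (.test g) :: K =>
    exact (Set.finite_singleton (none, (K, g))).subset (by rintro ⟨l, d⟩ h; cases h; simp)
  | .act (.set g) :: K =>
    exact (Set.finite_singleton (none, (K, g))).subset (by rintro ⟨l, d⟩ h; cases h; simp)
  | .act (.head i o) :: K =>
    exact (Set.finite_singleton (some (i, o), (K, f))).subset (by rintro ⟨l, d⟩ h; cases h; simp)
  | .fail :: K => exact Set.finite_empty.subset (by rintro ⟨l, d⟩ h; cases h)
  | .seq p q :: K =>
    exact (Set.finite_singleton (none, (p :: q :: K, f))).subset
      (by rintro ⟨l, d⟩ h; cases h; simp)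
  | .alt p q :: K =>
    exact (Set.toFinite {(none, (p :: K, f)), (none, (q :: K, f))}).subset
      (by rintro ⟨l, d⟩ h; cases h <;> simp)
  | .star p :: K =>
    exact (Set.toFinite {(none, (K, f)), (none, (p :: .star p :: K, f))}).subset
      (by rintro ⟨l, d⟩ h; cases h <;> simp)

/-- The lists that come up while a program is run in front of `K`. -/
def ctrl : Prog α ι F → List (Prog α ι F) → Set (List (Prog α ι F))
  | act a, K => {act a :: K}
  | fail, K => {fail :: K}
  | seq p q, K => {seq p q :: K} ∪ (ctrl p (q :: K) ∪ ctrl q K)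
  | alt p q, K => {alt p q :: K} ∪ (ctrl p K ∪ ctrl q K)
  | star p, K => {star p :: K} ∪ ctrl p (star p :: K)

omit [DecidableEq ι] in
theorem ctrl_finite (p : Prog α ι F) (K : List (Prog α ι F)) : (ctrl p K).Finite := by
  induction p generalizing K with
  | act a => exact Set.finite_singleton _
  | fail => exact Set.finite_singleton _
  | seq p q hp hq => exact (Set.finite_singleton _).union ((hp _).union (hq _))
  | alt p q hp hq => exact (Set.finite_singleton _).union ((hp _).union (hq _))
  | star p hp => exact (Set.finite_singleton _).union (hp _)

omit [DecidableEq ι] in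
theorem mem_ctrl_self (p : Prog α ι F) (K : List (Prog α ι F)) : p :: K ∈ ctrl p K := by
  cases p <;> simp [ctrl]

-- This closure keeps the control finite: unfolding `star p` in front of `K` runs `p` in front of
-- the same list `star p :: K`, so iteration does not let the pending lists grow.
omit [DecidableEq ι] in
theorem CtrlStep.mem_ctrl {p : Prog α ι F} {K L L' : List (Prog α ι F)} {f f' : F}
    {l : Option (ι × Op α)} (hL : L ∈ ctrl p K) (h : CtrlStep (L, f) l (L', f')) :
    L' ∈ ctrl p K ∨ L' = K := by
  induction p generalizing K with
  | act a => cases hL; cases h <;> simp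
  | fail => cases hL; cases h
  | seq p q hp hq =>
    rcases hL with rfl | hL | hL
    · cases h; exact .inl (.inr (.inl (mem_ctrl_self _ _)))
    · rcases hp hL with h | rfl
      · exact .inl (.inr (.inl h))
      · exact .inl (.inr (.inr (mem_ctrl_self _ _)))
    · rcases hq hL with h | rfl
      · exact .inl (.inr (.inr h))
      · exact .inr rfl
  | alt p q hp hq =>
    rcases hL with rfl | hL | hL
    · cases h
      · exact .inl (.inr (.inl (mem_ctrl_self _ _)))
      · exact .inl (.inr (.inr (mem_ctrl_self _ _)))
    · rcases hp hL with h | rfl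
      · exact .inl (.inr (.inl h))
      · exact .inr rfl
    · rcases hq hL with h | rfl
      · exact .inl (.inr (.inr h))
      · exact .inr rfl
  | star p hp =>
    rcases hL with rfl | hL
    · cases h
      · exact .inr rfl
      · exact .inl (.inr (mem_ctrl_self _ _))
    · rcases hp hL with h | rfl
      · exact .inl (.inr h)
      · exact .inl (.inl rfl)

/-- Steps of complete configurations. -/
def RunStep (w : List α) (c d : (List (Prog α ι F) × F) × (ι → ℕ)) : Prop :=
  ∃ l, CtrlStep c.1 l d.1 ∧ LabelSem w l c.2 d.2

theorem CtrlStep.run {w : List α} {c d : List (Prog α ι F) × F} (h : CtrlStep c none d)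
    (g : ι → ℕ) : RunStep w (c, g) (d, g) :=
  ⟨none, h, rfl⟩

/-- Running a list of programs one after the other. -/
def ListSem (w : List α) : List (Prog α ι F) → Store ι F → Store ι F → Prop
  | [], s, t => s = t
  | p :: K, s, t => ∃ m, p.Sem w s m ∧ ListSem w K m t

/-- The meaning of the pending list is pulled back through one step. Applied along a terminating run
from its end, where the list is empty, this recovers the meaning of the whole program. -/
theorem listSem_of_runStep {w : List α} {K K' : List (Prog α ι F)} {s s' t : Store ι F}
    (h : RunStep w ((K, s.1), s.2) ((K', s'.1), s'.2)) (ht : ListSem w K' s' t) :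
    ListSem w K s t := by
  obtain ⟨f, g⟩ := s
  obtain ⟨f', g'⟩ := s'
  obtain ⟨l, hc, hl⟩ := h
  cases hc with
  | test => cases hl; exact ⟨_, ⟨rfl, rfl⟩, ht⟩
  | set => cases hl; exact ⟨_, rfl, ht⟩
  | head => exact ⟨_, by obtain ⟨v, hv, rfl⟩ := hl; exact ⟨v, hv, rfl⟩, ht⟩
  | seq =>
    cases hl
    obtain ⟨m, hm, m', hm', ht⟩ := ht
    exact ⟨m', ⟨m, hm, hm'⟩, ht⟩
  | left =>
    cases hl
    obtain ⟨m, hm, ht⟩ := ht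
    exact ⟨m, .inl hm, ht⟩
  | right =>
    cases hl
    obtain ⟨m, hm, ht⟩ := ht
    exact ⟨m, .inr hm, ht⟩
  | leave => cases hl; exact ⟨_, .refl, ht⟩
  | loop =>
    cases hl
    obtain ⟨m, hm, m', hm', ht⟩ := ht
    exact ⟨m', .head hm hm', ht⟩

theorem run_of_sem {w : List α} {p : Prog α ι F} (K : List (Prog α ι F)) {s t : Store ι F}
    (h : p.Sem w s t) :
    Relation.ReflTransGen (RunStep w) ((p :: K, s.1), s.2) ((K, t.1), t.2) := by
  induction p generalizing K s t with
  | act a =>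
    apply Relation.ReflTransGen.single
    match a with
    | .test f => obtain ⟨rfl, rfl⟩ := h; exact ⟨_, .test _ _, rfl⟩
    | .set f => cases h; exact ⟨_, .set _ _ _, rfl⟩
    | .head i o => obtain ⟨v, hv, rfl⟩ := h; exact ⟨_, .head _ _ _ _, v, hv, rfl⟩
  | fail => cases h
  | seq p q hp hq =>
    obtain ⟨m, h1, h2⟩ := h
    exact .head (CtrlStep.run (.seq _ _ _ _) _) ((hp _ h1).trans (hq _ h2))
  | alt p q hp hq =>
    rcases h with h | h
    · exact .head (CtrlStep.run (.left _ _ _ _) _) (hp _ h)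
    · exact .head (CtrlStep.run (.right _ _ _ _) _) (hq _ h)
  | star p hp =>
    induction h using Relation.ReflTransGen.head_induction_on with
    | refl => exact .single (CtrlStep.run (.leave _ _ _) _)
    | head h _ ih => exact .head (CtrlStep.run (.loop _ _ _) _) ((hp _ h).trans ih)

theorem mem_language_iff_run {p : Prog α ι F} {f : F} {w : List α} :
    w ∈ p.language f ↔ ∃ t : Store ι F,
      Relation.ReflTransGen (RunStep w) (([p], f), fun _ => 0) (([], t.1), t.2) := by
  constructor
  · rintro ⟨t, ht⟩
    exact ⟨t, run_of_sem [] ht⟩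
  · rintro ⟨t, ht⟩
    have key : ∀ c d, Relation.ReflTransGen (RunStep w) c d → d = (([], t.1), t.2) →
        ListSem w c.1.1 (c.1.2, c.2) t := by
      intro c d h
      induction h using Relation.ReflTransGen.head_induction_on with
      | refl => rintro rfl; rfl
      | head h _ ih => intro hd; exact listSem_of_runStep h (ih hd)
    obtain ⟨m, hm, hm'⟩ := key _ _ ht rfl
    cases hm'
    exact ⟨_, hm⟩

-- The index `Fin.last k` is spare and absorbs everything outside `I`, which makes the map total.
omit [DecidableEq ι] in
theorem exists_injOn_fin {I : Set ι} (hI : I.Finite) :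
    ∃ (k : ℕ) (g : ι → Fin (k + 1)), Set.InjOn g I := by
  classical
  obtain ⟨k, ⟨e⟩⟩ := hI.exists_equiv_fin
  refine ⟨k, fun i => if h : i ∈ I then (e ⟨i, h⟩).castSucc else Fin.last k, ?_⟩
  intro i hi j hj hij
  simpa [hi, hj] using hij

/-- Every program is equivalent to an automaton. -/
theorem exists_headNFA [Finite F] (p : Prog α ι F) (f : F) :
    ∃ A : HeadNFA α, A.language = p.language f := by
  classical
  let C : Set (List (Prog α ι F) × F) := {c | c.1 ∈ ctrl p [] ∨ c.1 = []}
  have hC : C.Finite := by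
    have h1 := (((ctrl_finite p []).union (Set.finite_singleton [])).prod
      (Set.finite_univ (α := F)))
    refine h1.subset ?_
    rintro ⟨K, g⟩ (h | h)
    · exact ⟨.inl h, trivial⟩
    · exact ⟨.inr h, trivial⟩
  have hclosed : ∀ c ∈ C, ∀ l d, CtrlStep c l d → d ∈ C := by
    rintro ⟨K, g⟩ hc l ⟨K', g'⟩ h
    rcases hc with hc | hc
    · exact h.mem_ctrl hc
    · cases hc; cases h
  let T : Set ((List (Prog α ι F) × F) × Option (ι × Op α) × (List (Prog α ι F) × F)) :=
    {x | x.1 ∈ C ∧ CtrlStep x.1 x.2.1 x.2.2}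
  have hT : T.Finite := by
    refine (hC.biUnion fun c _ => (CtrlStep.finite c).image fun x => (c, x)).subset ?_
    rintro ⟨c, x⟩ ⟨h1, h2⟩
    exact Set.mem_biUnion h1 ⟨x, h2, rfl⟩
  have hI : {i | ∃ x ∈ T, ∃ o, x.2.1 = some (i, o)}.Finite := by
    have : (⋃ x ∈ T, {i | ∃ o, x.2.1 = some (i, o)}).Finite := by
      refine hT.biUnion fun x _ => ?_
      apply Set.Subsingleton.finite
      rintro i ⟨o, h⟩ j ⟨o', h'⟩
      rw [h] at h'
      cases h'; rfl
    refine this.subset ?_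
    rintro i ⟨x, hx, h⟩
    exact Set.mem_biUnion hx h
  obtain ⟨k, g, hg⟩ := exists_injOn_fin hI
  obtain ⟨N, ⟨eC⟩⟩ := hC.exists_equiv_fin
  obtain ⟨M, ⟨eT⟩⟩ := hT.exists_equiv_fin
  let A : HeadNFA α :=
    { N := N
      k := k + 1
      M := M
      src := fun e => eC ⟨(eT.symm e).1.1, (eT.symm e).2.1⟩
      dst := fun e => eC ⟨(eT.symm e).1.2.2, hclosed _ (eT.symm e).2.1 _ _ (eT.symm e).2.2⟩
      lab := fun e => (eT.symm e).1.2.1.map fun x => (g x.1, x.2)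
      start := eC ⟨([p], f), .inl (mem_ctrl_self _ _)⟩
      final := {q | (eC.symm q).1.1 = []} }
  -- The index type of the heads may be infinite, so stores are compared only on the finitely many
  -- heads that occur in `T`. There `g` is injective, hence an update of one head does not disturb
  -- another one.
  have hsim : ∀ (w : List α) (l : Option (ι × Op α)),
      (∀ i o, l = some (i, o) → i ∈ {i | ∃ x ∈ T, ∃ o, x.2.1 = some (i, o)}) →
      ∀ (h : ι → ℕ) (h' : Fin (k + 1) → ℕ),
      (∀ i ∈ {i | ∃ x ∈ T, ∃ o, x.2.1 = some (i, o)}, h i = h' (g i)) →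
      (∀ h₁, LabelSem w l h h₁ → ∃ h₁', LabelSem w (l.map fun x => (g x.1, x.2)) h' h₁' ∧
        ∀ i ∈ {i | ∃ x ∈ T, ∃ o, x.2.1 = some (i, o)}, h₁ i = h₁' (g i)) ∧
      (∀ h₁', LabelSem w (l.map fun x => (g x.1, x.2)) h' h₁' → ∃ h₁, LabelSem w l h h₁ ∧
        ∀ i ∈ {i | ∃ x ∈ T, ∃ o, x.2.1 = some (i, o)}, h₁ i = h₁' (g i)) := by
    intro w l hl h h' hh
    match l with
    | none =>
      exact ⟨fun h₁ e => ⟨h', rfl, by rw [show h₁ = h from e]; exact hh⟩,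
        fun h₁ e => ⟨h, rfl, by rw [show h₁ = h' from e]; exact hh⟩⟩
    | some (i, o) =>
      have hi := hl i o rfl
      have hup : ∀ v, ∀ j ∈ {i | ∃ x ∈ T, ∃ o, x.2.1 = some (i, o)},
          Function.update h i v j = Function.update h' (g i) v (g j) := by
        intro v j hj
        by_cases hij : j = i
        · subst hij; simp
        · have : g j ≠ g i := fun e => hij (hg hj hi e)
          simp [hij, this, hh j hj]
      constructor
      · rintro h₁ ⟨v, hv, rfl⟩
        exact ⟨_, ⟨v, by rw [← hh i hi]; exact hv, rfl⟩, hup v⟩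
      · rintro h₁ ⟨v, hv, rfl⟩
        exact ⟨_, ⟨v, by rw [hh i hi]; exact hv, rfl⟩, hup v⟩
  refine ⟨A, ?_⟩
  ext w
  rw [mem_language_iff_run]
  constructor
  · rintro ⟨c, hc, hfin⟩
    have key : ∃ h : ι → ℕ, Relation.ReflTransGen (RunStep w) (([p], f), fun _ => 0)
        ((eC.symm c.1).1, h) ∧
        ∀ i ∈ {i | ∃ x ∈ T, ∃ o, x.2.1 = some (i, o)}, h i = c.2 (g i) := by
      clear hfin
      induction hc with
      | refl => exact ⟨fun _ => 0, by simp only [A, Equiv.symm_apply_apply]; exact .refl, by simp⟩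
      | @tail c d _ hs ih =>
        obtain ⟨h, hr, hh⟩ := ih
        obtain ⟨e, he1, he2, hl⟩ := hs
        have hx := (eT.symm e).2
        obtain ⟨h₁, hl₁, hh₁⟩ := (hsim w (eT.symm e).1.2.1
          (fun i o hio => ⟨_, hx, o, hio⟩) h c.2 hh).2 d.2 hl
        refine ⟨h₁, hr.tail ⟨_, ?_, hl₁⟩, hh₁⟩
        rw [← he1, ← he2]
        simpa [A] using hx.2
    obtain ⟨h, hr, -⟩ := key
    refine ⟨((eC.symm c.1).1.2, h), ?_⟩
    have : (eC.symm c.1).1 = ([], (eC.symm c.1).1.2) := Prod.ext hfin rfl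
    rwa [this] at hr
  · rintro ⟨t, ht⟩
    have key : ∀ d : (List (Prog α ι F) × F) × (ι → ℕ),
        Relation.ReflTransGen (RunStep w) (([p], f), fun _ => 0) d →
        ∃ (hd : d.1 ∈ C) (h' : Fin (k + 1) → ℕ), A.Reachable w (eC ⟨d.1, hd⟩, h') ∧
          ∀ i ∈ {i | ∃ x ∈ T, ∃ o, x.2.1 = some (i, o)}, d.2 i = h' (g i) := by
      intro d hd
      induction hd with
      | refl => exact ⟨.inl (mem_ctrl_self _ _), fun _ => 0, .refl, by simp⟩
      | @tail c d _ hs ih =>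
        obtain ⟨hcC, h', hr, hh⟩ := ih
        obtain ⟨l, hcs, hl⟩ := hs
        have hx : (c.1, l, d.1) ∈ T := ⟨hcC, hcs⟩
        obtain ⟨h₁', hl₁, hh₁⟩ := (hsim w l
          (fun i o hio => ⟨_, hx, o, hio⟩) c.2 h' hh).1 d.2 hl
        refine ⟨hclosed _ hcC _ _ hcs, h₁', Relation.ReflTransGen.tail hr
          ⟨eT ⟨_, hx⟩, ?_, ?_, ?_⟩, hh₁⟩
        · simp [A]
        · simp [A]
        · simpa [A] using hl₁
    obtain ⟨hd, h', hr, -⟩ := key _ ht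
    exact ⟨_, hr, by simp [A]⟩

end Prog

end HeadProg

/-! ## From automata to linear FC-Datalog -/

namespace HeadProg

universe u

open FCDatalog

variable {α : Type u}

-- Head operations as word equations between prefixes.

section opEqns

variable {Rel : Type} {ar : Rel → ℕ}

/-- Equations that express an operation of a head, where positions are represented by prefixes
of the input word: `x` and `y` are the positions before and after the operation. -/
def Op.eqns (x u y z : Var) : Op α → List (Atom α Rel ar)
  | zero => [.eqn x [], .eqn y []]
  | last => [.eqn u [.inr x], .eqn y [.inr x]]
  | fwd a => [.eqn y [.inr x, .inl a], .eqn u [.inr y, .inr z]]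
  | bwd a => [.eqn x [.inr y, .inl a]]

/-- For `fwd`, the equation with the remaining suffix `z` forces `y` to be a prefix of the input and
not just any factor. For `bwd` no such equation is needed, because `y` is a prefix of the prefix
`x`. -/
theorem Op.rel_of_eqns {I : (R : Rel) → Set (Fin (ar R) → List α)} {w : List α}
    {θ : Var → List α} {x u y z : Var} {o : Op α} {v : ℕ} (hu : θ u = w) (hx : θ x = w.take v)
    (hv : v ≤ w.length) (h : ∀ φ ∈ (o.eqns x u y z : List (Atom α Rel ar)), φ.Holds I w θ) :
    ∃ v', o.Rel w v v' ∧ θ y = w.take v' := by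
  have hlen : (w.take v).length = v := by simp [hv]
  cases o with
  | zero =>
    simp only [Op.eqns, List.mem_cons, List.not_mem_nil, or_false, forall_eq_or_imp, forall_eq,
      Atom.Holds, subst, List.flatMap_nil] at h
    obtain ⟨⟨h1, -⟩, h2, -⟩ := h
    rw [← hx, h1] at hlen
    refine ⟨v, ⟨by simpa using hlen.symm, rfl⟩, by rw [h2, ← h1, hx]⟩
  | last =>
    simp only [Op.eqns, List.mem_cons, List.not_mem_nil, or_false, forall_eq_or_imp, forall_eq,
      Atom.Holds, subst, List.flatMap_cons, List.flatMap_nil, Sum.elim_inr,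
      List.append_nil] at h
    obtain ⟨⟨h1, -⟩, h2, -⟩ := h
    refine ⟨v, ⟨?_, rfl⟩, by rw [h2, hx]⟩
    rw [← hx, ← h1, hu] at hlen
    exact hlen.symm
  | fwd a =>
    simp only [Op.eqns, List.mem_cons, List.not_mem_nil, or_false, forall_eq_or_imp, forall_eq,
      Atom.Holds, subst, List.flatMap_cons, List.flatMap_nil, Sum.elim_inr, Sum.elim_inl,
      List.append_nil] at h
    obtain ⟨⟨h1, -⟩, h2, -⟩ := h
    rw [hu, h1, hx] at h2
    have h3 : w[v]? = some a := by
      rw [h2, List.append_assoc, List.getElem?_append_right (by simp [hv])]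
      simp [hv]
    refine ⟨v + 1, ⟨h3, rfl⟩, ?_⟩
    rw [h1, hx, List.take_add_one, h3]; rfl
  | bwd a =>
    simp only [Op.eqns, List.mem_cons, List.not_mem_nil, or_false, forall_eq,
      Atom.Holds, subst, List.flatMap_cons, List.flatMap_nil, Sum.elim_inr, Sum.elim_inl,
      List.append_nil] at h
    have h1 := h.1
    rw [hx] at h1
    have h2 : v = (θ y).length + 1 := by
      rw [← hlen, h1]; simp
    have h3 : w = θ y ++ a :: w.drop v := by
      conv_lhs => rw [← List.take_append_drop v w, h1]
      simp
    refine ⟨(θ y).length, ⟨h2, ?_⟩, ?_⟩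
    · rw [h3]; simp
    · conv_rhs => rw [h3]
      simp

theorem Op.Rel.eqns {I : (R : Rel) → Set (Fin (ar R) → List α)} {w : List α}
    {θ : Var → List α} {x u y z : Var} {o : Op α} {v v' : ℕ} (hu : θ u = w)
    (hx : θ x = w.take v) (hy : θ y = w.take v') (hz : θ z = w.drop v')
    (h : o.Rel w v v') :
    ∀ φ ∈ (o.eqns x u y z : List (Atom α Rel ar)), φ.Holds I w θ := by
  have hinf : ∀ n, w.take n <:+: w := fun n => (List.take_prefix n w).isInfix
  have hinf0 : [] <:+: w := List.nil_infix
  cases o with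
  | zero =>
    obtain ⟨rfl, rfl⟩ := h
    simp [Op.eqns, Atom.Holds, subst, hx, hy]
  | last =>
    obtain ⟨rfl, rfl⟩ := h
    simp [Op.eqns, Atom.Holds, subst, hx, hy, hu]
  | fwd a =>
    obtain ⟨h, rfl⟩ := h
    have : w.take v ++ [a] = w.take (v + 1) := by rw [List.take_add_one, h]; rfl
    simp [Op.eqns, Atom.Holds, subst, hx, hy, hu, hz, this, hinf]
  | bwd a =>
    obtain ⟨rfl, h⟩ := h
    have : w.take v' ++ [a] = w.take (v' + 1) := by rw [List.take_add_one, h]; rfl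
    simp [Op.eqns, Atom.Holds, subst, hx, hy, this, hinf]

end opEqns

-- The linear FC-Datalog program of an automaton.

namespace HeadNFA

variable (A : HeadNFA α)

/-- One relation for every state and the output relation. -/
def relArity : Option (Fin A.N) → ℕ
  | none => 0
  | some _ => A.k

/-- Variables: those below `A.k` carry the head positions, `A.k` is the universe variable, `A.k + 1`
the new position of the moved head, and `A.k + 2` the remaining suffix, or the empty word in
`initRule`. -/
def stateAtom (q : Fin A.N) : Atom α (Option (Fin A.N)) A.relArity :=
  .rel (some q) fun j : Fin A.k => (j : ℕ)

def initRule : Rule α (Option (Fin A.N)) A.relArity where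
  head := some A.start
  headVars _ := A.k + 2
  body := [.eqn (A.k + 2 : ℕ) []]
  body_ne_nil := by simp
  safe j := ⟨_, List.mem_singleton_self _, .inl rfl⟩

def ansRule (q : Fin A.N) : Rule α (Option (Fin A.N)) A.relArity where
  head := none
  headVars := Fin.elim0
  body := [A.stateAtom q]
  body_ne_nil := by simp
  safe j := j.elim0

/-- The variable that carries the new position of the head `j`. -/
def newVar (l : Option (Fin A.k × Op α)) (j : Fin A.k) : Var :=
  match l with
  | none => j
  | some (i, _) => if j = i then A.k + 1 else j

def labelEqns (l : Option (Fin A.k × Op α)) : List (Atom α (Option (Fin A.N)) A.relArity) :=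
  match l with
  | none => []
  | some (i, o) => o.eqns i A.k (A.k + 1) (A.k + 2)

def transRule (e : Fin A.M) : Rule α (Option (Fin A.N)) A.relArity where
  head := some (A.dst e)
  headVars := A.newVar (A.lab e)
  body := A.stateAtom (A.src e) :: A.labelEqns (A.lab e)
  body_ne_nil := by simp
  safe j := by
    have hj : ∀ (j : Fin A.k), ((j : ℕ) : Var) ∈ (A.stateAtom (A.src e)).vars :=
      fun j => ⟨j, rfl⟩
    match A.lab e with
    | none => exact ⟨_, List.mem_cons_self, hj j⟩
    | some (i, o) =>
      by_cases h : (show Fin A.k from j) = i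
      · have : A.newVar (some (i, o)) j = A.k + 1 := if_pos h
        rw [this]
        cases o <;> simp [labelEqns, Op.eqns, Atom.vars]
      · have : A.newVar (some (i, o)) j = (show Fin A.k from j) := if_neg h
        rw [this]
        exact ⟨_, List.mem_cons_self, hj j⟩

/-- The program that derives the reachable configurations of an automaton. -/
def program : Program α where
  univVar := A.k
  Rel := Option (Fin A.N)
  finite_rel := inferInstance
  ar := A.relArity
  ans := none
  rules := {A.initRule} ∪ Set.range A.transRule ∪ A.ansRule '' A.final
  finite_rules := ((Set.finite_singleton _).union (Set.finite_range _)).union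
    ((Set.toFinite _).image _)

theorem not_hasSymbol_labelEqns {l : Option (Fin A.k × Op α)}
    {φ : Atom α (Option (Fin A.N)) A.relArity} (h : φ ∈ A.labelEqns l)
    (S : Option (Fin A.N)) : ¬ φ.HasSymbol S := by
  match l with
  | none => simp [labelEqns] at h
  | some (i, o) =>
    cases o <;> simp only [labelEqns, Op.eqns, List.mem_cons, List.not_mem_nil, or_false] at h
    case bwd => subst h; exact id
    all_goals rcases h with rfl | rfl <;> exact id

/-- Only position `0` of a body can carry a relation atom, so linearity holds whichever symbols are
mutually recursive. -/
theorem isLinear_program : A.program.IsLinear := by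
  have key : ∀ ρ ∈ A.program.rules, ∀ i : Fin ρ.body.length,
      (∃ S, (ρ.body.get i).HasSymbol S) → (i : ℕ) = 0 := by
    rintro ρ ((rfl | ⟨e, rfl⟩) | ⟨q, -, rfl⟩) i ⟨S, hS⟩
    · exact Nat.lt_one_iff.1 i.2
    · obtain ⟨i, hi⟩ := i
      match i with
      | 0 => rfl
      | i + 1 =>
        exact absurd hS (A.not_hasSymbol_labelEqns (l := A.lab e) (List.getElem_mem _) S)
    · exact Nat.lt_one_iff.1 i.2
  rintro ρ hρ i j ⟨S, hS, -⟩ ⟨T, hT, -⟩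
  exact Fin.ext ((key ρ hρ i ⟨S, hS⟩).trans (key ρ hρ j ⟨T, hT⟩).symm)

theorem stage_sound (w : List α) (n : ℕ) :
    (∀ q, ∀ t ∈ A.program.stage w n (some q), ∃ h, A.Reachable w (q, h) ∧
      t = fun j => w.take (h j)) ∧
    (∀ t ∈ A.program.stage w n none, w ∈ A.language) := by
  induction n with
  | zero => exact ⟨fun q t h => h.elim, fun t h => h.elim⟩
  | succ n ih =>
    have hat : ∀ q θ, (A.stateAtom q).Holds (A.program.stage w n) w θ →
        ∃ h, A.Reachable w (q, h) ∧ (fun j : Fin A.k => θ j) = fun j => w.take (h j) :=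
      fun q θ h => ih.1 q _ h.1
    constructor
    · rintro q t (ht | ⟨ρ, ((rfl | ⟨e, rfl⟩) | ⟨q', -, rfl⟩), θ, ⟨hu, -⟩, hb, hq, rfl⟩)
      · exact ih.1 q t ht
      · cases hq
        refine ⟨fun _ => 0, .refl, ?_⟩
        have := (hb _ (List.mem_singleton_self _)).1
        funext j
        exact this
      · cases hq
        obtain ⟨h, hr, hθ⟩ := hat _ θ (hb _ List.mem_cons_self)
        have hle := hr.le
        have heq : ∀ φ ∈ A.labelEqns (A.lab e), φ.Holds (A.program.stage w n) w θ :=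
          fun φ hφ => hb _ (List.mem_cons_of_mem _ hφ)
        have key : ∃ h', LabelSem w (A.lab e) h h' ∧
            (fun j => θ (A.newVar (A.lab e) j)) = fun j => w.take (h' j) := by
          match A.lab e, heq with
          | none, _ => exact ⟨h, rfl, hθ⟩
          | some (i, o), heq =>
            obtain ⟨v, hv, hy⟩ := Op.rel_of_eqns hu (congrFun hθ i) (hle i) heq
            refine ⟨_, ⟨v, hv, rfl⟩, ?_⟩
            funext j
            by_cases hj : j = i
            · subst hj; simpa [newVar] using hy
            · simpa [newVar, hj] using congrFun hθ j
        obtain ⟨h', hl, hy⟩ := key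
        exact ⟨h', hr.tail ⟨e, rfl, rfl, hl⟩, hy⟩
      · cases hq
    · rintro t (ht | ⟨ρ, ((rfl | ⟨e, rfl⟩) | ⟨q', hq', rfl⟩), θ, -, hb, hq, rfl⟩)
      · exact ih.2 t ht
      · cases hq
      · cases hq
      · obtain ⟨h, hr, -⟩ := hat q' θ (hb _ (List.mem_singleton_self _))
        exact ⟨_, hr, hq'⟩

theorem stage_complete {w : List α} {c : Fin A.N × (Fin A.k → ℕ)} (hc : A.Reachable w c) :
    ∃ n, (fun j : Fin A.k => w.take (c.2 j)) ∈ A.program.stage w n (some c.1) := by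
  have hinf : ∀ n, w.take n <:+: w := fun n => (List.take_prefix n w).isInfix
  induction hc with
  | refl =>
    refine ⟨1, .inr ⟨A.initRule, .inl (.inl rfl), fun x => if x = A.k then w else [], ⟨?_, ?_⟩,
      ?_, rfl, ?_⟩⟩
    · simp [program]
    · intro φ _ x _
      by_cases h : x = A.k <;> simp [h]
    · intro φ hφ
      rw [List.mem_singleton.1 hφ]
      simp [Atom.Holds, subst]
    · funext j
      simp [initRule]
  | @tail c d hc hs ih =>
    obtain ⟨n, hn⟩ := ih
    obtain ⟨e, he, hd, hl⟩ := hs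
    -- The parameter `v` is the new position of the moved head. It is fixed only after the label is
    -- inspected, and is `0` for silent transitions, where it plays no role.
    let θ (v : ℕ) (x : Var) : List α := if h : x < A.k then w.take (c.2 ⟨x, h⟩) else
      if x = A.k then w else if x = A.k + 1 then w.take v else w.drop v
    have hfac : ∀ v x, θ v x <:+: w := by
      intro v x
      simp only [θ]
      split_ifs
      exacts [hinf _, List.infix_rfl, hinf _, (List.drop_suffix _ _).isInfix]
    have hold : ∀ v (j : Fin A.k), θ v j = w.take (c.2 j) := fun v j => by simp [θ]
    have hu : ∀ v, θ v A.k = w := fun v => by simp [θ]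
    have key : ∃ v, (∀ φ ∈ A.labelEqns (A.lab e), φ.Holds (A.program.stage w n) w (θ v)) ∧
        (fun j => θ v (A.newVar (A.lab e) j)) = fun j => w.take (d.2 j) := by
      match A.lab e, hl with
      | none, hl =>
        refine ⟨0, by simp [labelEqns], ?_⟩
        rw [show d.2 = c.2 from hl]
        exact funext fun j => hold 0 j
      | some (i, o), ⟨v, hv, hd⟩ =>
        have hy : θ v (A.k + 1 : ℕ) = w.take v := by simp [θ]
        refine ⟨v, Op.Rel.eqns (hu v) (hold v i) hy (by simp [θ]) hv, ?_⟩
        funext j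
        rw [hd]
        by_cases hj : j = i
        · subst hj; simpa [newVar] using hy
        · simpa [newVar, hj] using hold v j
    obtain ⟨v, hv, hθ⟩ := key
    refine ⟨n + 1, .inr ⟨A.transRule e, .inl (.inr ⟨e, rfl⟩), θ v, ⟨hu v, fun _ _ x _ => hfac v x⟩,
      ?_, congrArg some hd, hθ.symm⟩⟩
    intro φ hφ
    rcases List.mem_cons.1 hφ with rfl | hφ
    · refine ⟨?_, fun j => hfac _ _⟩
      rw [he]
      exact (congrArg (· ∈ A.program.stage w n (some c.1)) (funext (hold v))).mpr hn
    · exact hv φ hφ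

theorem language_program : A.program.language = A.language := by
  ext w
  constructor
  · rintro ⟨t, ht⟩
    obtain ⟨n, hn⟩ := Set.mem_iUnion.1 ht
    exact (A.stage_sound w n).2 t hn
  · rintro ⟨c, hc, hfin⟩
    obtain ⟨n, hn⟩ := A.stage_complete hc
    let θ (x : Var) : List α := if h : x < A.k then w.take (c.2 ⟨x, h⟩) else w
    have hfac : ∀ x, θ x <:+: w := by
      intro x
      simp only [θ]
      split_ifs
      exacts [(List.take_prefix _ w).isInfix, List.infix_rfl]
    have hθ : (fun j : Fin A.k => θ j) = fun j => w.take (c.2 j) := funext fun j => by simp [θ]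
    refine ⟨fun j => Fin.elim0 j, Set.mem_iUnion.2 ⟨n + 1, .inr ⟨A.ansRule c.1,
      .inr ⟨_, hfin, rfl⟩, θ, ⟨by simp [program, θ], fun _ _ x _ => hfac x⟩, ?_,
      rfl, funext fun j => Fin.elim0 j⟩⟩⟩
    intro φ hφ
    rw [List.mem_singleton.1 hφ]
    exact ⟨(congrArg (· ∈ A.program.stage w n (some c.1)) hθ).mpr hn, fun j => hfac _⟩

end HeadNFA
end HeadProg

/-! ## From automata to Turing machines -/

namespace HeadProg

universe u

open NSpace

variable {α : Type u}

/-! ### Binary counters on a work tape -/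

/-- Tape symbols: the blank, the marker in the first cell, and binary digits. -/
inductive Cell
  | blank
  | mark
  | bit (b : Bool)

instance : Finite Cell :=
  Finite.of_surjective (fun x : Option (Option Bool) => match x with
    | none => Cell.blank
    | some none => .mark
    | some (some b) => .bit b)
    fun c => match c with
    | .blank => ⟨none, rfl⟩
    | .mark => ⟨some none, rfl⟩
    | .bit b => ⟨some (some b), rfl⟩

/-- The value of a list of binary digits, the least significant digit first. -/
def binVal : List Bool → ℕ
  | [] => 0
  | b :: l => b.toNat + 2 * binVal l

/-- The tape that carries a list of digits. -/
def counterTape (l : List Bool) : ℕ → Cell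
  | 0 => .mark
  | j + 1 => (l[j]?).elim .blank .bit

/-- The additive form covers setting and clearing a digit at once and avoids truncated subtraction.
-/
theorem binVal_set {l : List Bool} {j : ℕ} {b : Bool} (h : l[j]? = some b) (b' : Bool) :
    binVal (l.set j b') + b.toNat * 2 ^ j = binVal l + b'.toNat * 2 ^ j := by
  induction l generalizing j with
  | nil => simp at h
  | cons c l ih =>
    cases j with
    | zero =>
      simp only [List.getElem?_cons_zero, Option.some.injEq] at h
      subst h
      simp [binVal]; ring
    | succ j =>
      have := ih (by simpa using h)
      simp only [List.set_cons_succ, binVal, pow_succ]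
      linarith

theorem binVal_append_true (l : List Bool) : binVal (l ++ [true]) = binVal l + 2 ^ l.length := by
  induction l with
  | nil => simp [binVal]
  | cons c l ih => simp [binVal, ih, pow_succ]; ring

theorem binVal_eq_zero {l : List Bool} (h : ∀ m < l.length, l[m]? = some false) :
    binVal l = 0 := by
  induction l with
  | nil => rfl
  | cons c l ih =>
    have h0 : c = false := by simpa using h 0 (by simp)
    have := ih fun m hm => by simpa using h (m + 1) (by simpa using hm)
    simp [binVal, this, h0]

theorem counterTape_set {l : List Bool} {j : ℕ} (hj : j < l.length) (b : Bool) :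
    Function.update (counterTape l) (j + 1) (.bit b) = counterTape (l.set j b) := by
  funext m
  cases m with
  | zero => rfl
  | succ m =>
    by_cases h : m = j
    · subst h; simp [counterTape, hj]
    · simp [counterTape, h, Ne.symm h]

theorem counterTape_append (l : List Bool) (b : Bool) :
    Function.update (counterTape l) (l.length + 1) (.bit b) = counterTape (l ++ [b]) := by
  funext m
  cases m with
  | zero => rfl
  | succ m =>
    rcases lt_trichotomy m l.length with h | h | h
    · simp [counterTape, h.ne, List.getElem?_append, h]
    · subst h; simp [counterTape]
    · simp only [counterTape, ne_eq, Nat.add_right_cancel_iff, h.ne', not_false_eq_true,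
        Function.update_of_ne]
      rw [List.getElem?_eq_none h.le, List.getElem?_eq_none (by simp; omega)]

/-- Every tape of a counter has the marker in its first cell, then digits, then blanks. -/
theorem counterTape_cases (l : List Bool) {j : ℕ} (hj : j ≤ l.length + 1) :
    (j = 0 ∧ counterTape l j = .mark) ∨
    (∃ m b, j = m + 1 ∧ m < l.length ∧ l[m]? = some b ∧ counterTape l j = .bit b) ∨
    (j = l.length + 1 ∧ counterTape l j = .blank) := by
  cases j with
  | zero => exact .inl ⟨rfl, rfl⟩
  | succ m =>
    rcases (show m ≤ l.length by omega).lt_or_eq with h | h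
    · exact .inr (.inl ⟨m, l[m], rfl, h, by simp, by simp [counterTape, h]⟩)
    · subst h; exact .inr (.inr ⟨rfl, by simp [counterTape]⟩)

theorem counterTape_eq_mark {l : List Bool} {j : ℕ} (h : counterTape l j = .mark) : j = 0 := by
  cases j with
  | zero => rfl
  | succ m => cases hm : l[m]? <;> simp [counterTape, hm] at h

theorem counterTape_eq_bit {l : List Bool} {j : ℕ} {b : Bool} (h : counterTape l j = .bit b) :
    ∃ m, j = m + 1 ∧ m < l.length ∧ l[m]? = some b := by
  cases j with
  | zero => simp [counterTape] at h
  | succ m =>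
    cases hm : l[m]? with
    | none => simp [counterTape, hm] at h
    | some c =>
      simp only [counterTape, hm, Option.elim_some, Cell.bit.injEq] at h
      exact ⟨m, rfl, (List.getElem?_eq_some_iff.1 hm).1, by rw [← h, hm]⟩

theorem counterTape_eq_blank {l : List Bool} {j : ℕ} (h : counterTape l j = .blank) :
    l.length + 1 ≤ j := by
  cases j with
  | zero => simp [counterTape] at h
  | succ m =>
    cases hm : l[m]? with
    | none => simpa using hm
    | some c => simp [counterTape, hm] at h

/-! ### The simulation of an operation of a head -/

/-- The phases of the simulation of an operation: the counter is decremented to zero while the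
input head moves right from the left endmarker, then the input symbol is tested, and then the
counter is incremented while the input head moves back. -/
inductive Phase
  | decScan
  | decBack
  | decReturn
  | test
  | check
  | incScan
  | incReturn

instance : Finite Phase :=
  Finite.of_surjective (fun x : Fin 7 => match x with
    | 0 => Phase.decScan
    | 1 => .decBack
    | 2 => .decReturn
    | 3 => .test
    | 4 => .check
    | 5 => .incScan
    | 6 => .incReturn)
    fun c => match c with
    | .decScan => ⟨0, rfl⟩
    | .decBack => ⟨1, rfl⟩
    | .decReturn => ⟨2, rfl⟩
    | .test => ⟨3, rfl⟩
    | .check => ⟨4, rfl⟩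
    | .incScan => ⟨5, rfl⟩
    | .incReturn => ⟨6, rfl⟩

/-- Whether the operation looks at the letter to the right of the head. -/
def Op.look : Op α → Bool
  | zero => false
  | last => true
  | fwd _ => true
  | bwd _ => false

def Op.symbol : Op α → InputSymbol α
  | zero => .leftEnd
  | last => .rightEnd
  | fwd a => .letter a
  | bwd a => .letter a

def Op.move : Op α → Move
  | zero => .stay
  | last => .left
  | fwd _ => .stay
  | bwd _ => .left

/-- A head at position `v` has the symbol of cell `v` on its left and that of cell `v + 1` on its
right. Hence one symbol test decides the operation, and `o.move` leads from the tested cell to the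
cell whose number is the new position. -/
theorem Op.symbol_eq_iff {w : List α} {o : Op α} {v : ℕ} (hv : v ≤ w.length) :
    o.symbol = inputAt w (v + o.look.toNat) ↔
      o.Rel w v (min (o.move.apply (v + o.look.toNat)) (w.length + 1)) := by
  cases o with
  | zero =>
    cases v with
    | zero => simp [symbol, look, inputAt, Op.Rel, move, Move.apply]
    | succ v => cases h : w[v]? <;> simp [symbol, look, inputAt, Op.Rel, h]
  | last =>
    rcases hv.lt_or_eq with h | h
    · simp [symbol, look, inputAt, Op.Rel, h, h.ne]
    · subst h; simp [symbol, look, inputAt, Op.Rel, move, Move.apply]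
  | fwd a =>
    rcases hv.lt_or_eq with h | h
    · simp [symbol, look, inputAt, Op.Rel, h, move, Move.apply, eq_comm, hv]
    · subst h; simp [symbol, look, inputAt, Op.Rel]
  | bwd a =>
    cases v with
    | zero => simp [symbol, look, inputAt, Op.Rel]
    | succ v =>
      have h : v < w.length := hv
      have h' : min v (w.length + 1) = v := by omega
      simp [symbol, look, inputAt, Op.Rel, h, move, Move.apply, h', eq_comm]

theorem Op.Rel.unique {w : List α} {o : Op α} {v v₁ v₂ : ℕ} (h₁ : o.Rel w v v₁)
    (h₂ : o.Rel w v v₂) : v₁ = v₂ := by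
  cases o <;> simp only [Op.Rel] at h₁ h₂ <;> omega

/-- Single steps of the simulation of an operation: the next phase (`none` when the simulation is
over), the symbol to write and the movements of the input head and of the work head. -/
inductive Micro (o : Op α) : Phase → InputSymbol α → Cell → Option Phase × Cell × Move × Move → Prop
  | decStart (σ) : Micro o .decScan σ .mark (some .decScan, .mark, .stay, .right)
  | decFalse (σ) : Micro o .decScan σ (.bit false) (some .decScan, .bit false, .stay, .right)
  | decTrue (σ) : Micro o .decScan σ (.bit true) (some .decBack, .bit false, .stay, .left)
  | decEmpty (σ) : Micro o .decScan σ .blank (some .decReturn, .blank, .stay, .left)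
  | backBit (σ b) : Micro o .decBack σ (.bit b) (some .decBack, .bit true, .stay, .left)
  | backMark (σ) : Micro o .decBack σ .mark (some .decScan, .mark, .right, .stay)
  | returnBit (σ b) : Micro o .decReturn σ (.bit b) (some .decReturn, .bit b, .stay, .left)
  | returnMark (σ) : Micro o .decReturn σ .mark
      (some .test, .mark, if o.look then .right else .stay, .stay)
  | test (c) : Micro o .test o.symbol c (some .check, c, o.move, .stay)
  | finish (c) : Micro o .check .leftEnd c (none, c, .stay, .stay)
  | inc (σ c) (h : σ ≠ .leftEnd) : Micro o .check σ c (some .incScan, c, .left, .right)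
  | incTrue (σ) : Micro o .incScan σ (.bit true) (some .incScan, .bit false, .stay, .right)
  | incFalse (σ) : Micro o .incScan σ (.bit false) (some .incReturn, .bit true, .stay, .left)
  | incEmpty (σ) : Micro o .incScan σ .blank (some .incReturn, .bit true, .stay, .left)
  | incReturnBit (σ b) : Micro o .incReturn σ (.bit b) (some .incReturn, .bit b, .stay, .left)
  | incReturnMark (σ) : Micro o .incReturn σ .mark (some .check, .mark, .stay, .stay)

/-- The invariant of the simulation of an operation of a head at position `v`, for the position
`p` of the input head, the digits `l` and the position `j` of the work head. -/
def MicroInv (w : List α) (o : Op α) (v : ℕ) (p : ℕ) (l : List Bool) (j : ℕ) :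
    Option Phase → Prop
  | some .decScan => p + binVal l = v ∧ j ≤ l.length + 1 ∧ ∀ m, m + 1 < j → l[m]? = some false
  | some .decBack => p + binVal l + 2 ^ j = v ∧ j ≤ l.length ∧ ∀ m < j, l[m]? = some false
  | some .decReturn => p = v ∧ binVal l = 0 ∧ j ≤ l.length
  | some .test => p = v + o.look.toNat ∧ binVal l = 0 ∧ j = 0
  | some .check => o.Rel w v (p + binVal l) ∧ j = 0
  | some .incScan => o.Rel w v (p + binVal l + 2 ^ (j - 1)) ∧ 1 ≤ j ∧ j ≤ l.length + 1
  | some .incReturn => o.Rel w v (p + binVal l) ∧ j ≤ l.length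
  | none => o.Rel w v (binVal l) ∧ p = 0 ∧ j = 0

/-- A measure that decreases in the simulation of an operation. -/
def microMeasure (n v p L j : ℕ) : Phase → ℕ ×ₗ ℕ ×ₗ ℕ
  | .decScan => toLex (n + 2 + (v - p), toLex (2, L + 1 - j))
  | .decBack => toLex (n + 2 + (v - p), toLex (1, j))
  | .decReturn => toLex (n + 2 + (v - p), toLex (1, j))
  | .test => toLex (n + 2, toLex (0, 0))
  | .check => toLex (p, toLex (0, 0))
  | .incScan => toLex (p, toLex (2, L + 1 - j))
  | .incReturn => toLex (p, toLex (1, j))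

theorem inputAt_ne_leftEnd {w : List α} {p : ℕ} (hp : inputAt w p ≠ .leftEnd) : p ≠ 0 := by
  rintro rfl; exact hp rfl

/-- The summands `2 ^ j` in `decBack` and `2 ^ (j - 1)` in `incScan` are the borrow and the carry in
transit. With them, the sum of the input position and the counter is preserved while a unit passes
from one to the other. The measure compares the progress of the input head, then the phase of the
pass over the counter, then the work head. Its offset `n + 2` puts the whole decrementing half above
the incrementing half. -/
theorem MicroInv.step {w : List α} {o : Op α} {v p j : ℕ} {l : List Bool} {ph : Phase}
    (hv : v ≤ w.length) (hl : l.length ≤ Nat.log 2 w.length + 1)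
    (h : MicroInv w o v p l j (some ph)) {r : Option Phase × Cell × Move × Move}
    (hr : Micro o ph (inputAt w p) (counterTape l j) r) :
    ∃ l' : List Bool, l'.length ≤ Nat.log 2 w.length + 1 ∧
      Function.update (counterTape l) j r.2.1 = counterTape l' ∧
      MicroInv w o v (min (r.2.2.1.apply p) (w.length + 1)) l' (r.2.2.2.apply j) r.1 ∧
      ∀ ph', r.1 = some ph' →
        microMeasure w.length v (min (r.2.2.1.apply p) (w.length + 1)) l'.length
          (r.2.2.2.apply j) ph' < microMeasure w.length v p l.length j ph := by
  have hupd : Function.update (counterTape l) j (counterTape l j) = counterTape l :=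
    Function.update_eq_self _ _
  have hlt : ∀ {a b c a' b' c' : ℕ}, a < a' ∨ (a = a' ∧ (b < b' ∨ (b = b' ∧ c < c'))) →
      (toLex (a, toLex (b, c)) : ℕ ×ₗ ℕ ×ₗ ℕ) < toLex (a', toLex (b', c')) := by
    intro a b c a' b' c' h
    simpa [Prod.Lex.lt_iff] using h
  generalize hσ : inputAt w p = σ at hr
  generalize hc : counterTape l j = c at hr hupd
  cases hr with
  | decStart =>
    obtain ⟨h1, h2, h3⟩ := h
    obtain rfl := counterTape_eq_mark hc
    have hp : min p (w.length + 1) = p := by omega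
    refine ⟨l, hl, hupd, ?_, ?_⟩
    · simp [MicroInv, Move.apply, hp, h1]
    · rintro _ ⟨⟩
      simp only [microMeasure, Move.apply, hp]
      exact hlt (by omega)
  | decFalse =>
    obtain ⟨h1, h2, h3⟩ := h
    obtain ⟨m, rfl, hm, hb⟩ := counterTape_eq_bit hc
    have hp : min p (w.length + 1) = p := by omega
    refine ⟨l, hl, hupd, ?_, ?_⟩
    · simp only [MicroInv, Move.apply, hp, h1, true_and]
      refine ⟨by omega, fun m' hm' => ?_⟩
      rcases (show m' ≤ m by omega).lt_or_eq with h | rfl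
      · exact h3 m' (by omega)
      · exact hb
    · rintro _ ⟨⟩
      simp only [microMeasure, Move.apply, hp]
      exact hlt (by omega)
  | decTrue =>
    obtain ⟨h1, h2, h3⟩ := h
    obtain ⟨m, rfl, hm, hb⟩ := counterTape_eq_bit hc
    have hp : min p (w.length + 1) = p := by omega
    have hval := binVal_set hb false
    refine ⟨l.set m false, by simpa using hl, counterTape_set hm _, ?_, ?_⟩
    · simp only [MicroInv, Move.apply, hp, Nat.add_sub_cancel, List.length_set]
      simp only [Bool.toNat_true, Bool.toNat_false] at hval
      refine ⟨by omega, hm.le, fun m' hm' => ?_⟩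
      rw [List.getElem?_set_ne (by omega)]
      exact h3 m' (by omega)
    · rintro _ ⟨⟩
      simp only [microMeasure, Move.apply, hp]
      exact hlt (by omega)
  | decEmpty =>
    obtain ⟨h1, h2, h3⟩ := h
    have hj := counterTape_eq_blank hc
    have h0 : binVal l = 0 := binVal_eq_zero fun m hm => h3 m (by omega)
    have hp : min p (w.length + 1) = p := by omega
    refine ⟨l, hl, hupd, ?_, ?_⟩
    · simp only [MicroInv, Move.apply, hp]
      omega
    · rintro _ ⟨⟩
      simp only [microMeasure, Move.apply, hp]
      exact hlt (by omega)
  | backBit _ b =>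
    obtain ⟨h1, h2, h3⟩ := h
    obtain ⟨m, rfl, hm, hb⟩ := counterTape_eq_bit hc
    have hpos := Nat.two_pow_pos m
    have hp : min p (w.length + 1) = p := by omega
    have hval := binVal_set (h3 m (by omega)) true
    refine ⟨l.set m true, by simpa using hl, counterTape_set hm _, ?_, ?_⟩
    · simp only [MicroInv, Move.apply, hp, Nat.add_sub_cancel, List.length_set]
      simp only [Bool.toNat_true, Bool.toNat_false] at hval
      refine ⟨by rw [pow_succ] at h1; omega, hm.le, fun m' hm' => ?_⟩
      rw [List.getElem?_set_ne (by omega)]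
      exact h3 m' (by omega)
    · rintro _ ⟨⟩
      simp only [microMeasure, Move.apply, hp]
      exact hlt (by omega)
  | backMark =>
    obtain ⟨h1, h2, h3⟩ := h
    obtain rfl := counterTape_eq_mark hc
    rw [pow_zero] at h1
    have hp : min (p + 1) (w.length + 1) = p + 1 := by omega
    refine ⟨l, hl, hupd, ?_, ?_⟩
    · simp only [MicroInv, Move.apply, hp]
      exact ⟨by omega, by omega, fun m hm => by omega⟩
    · rintro _ ⟨⟩
      simp only [microMeasure, Move.apply, hp]
      exact hlt (by omega)
  | returnBit =>
    obtain ⟨h1, h2, h3⟩ := h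
    obtain ⟨m, rfl, hm, hb⟩ := counterTape_eq_bit hc
    have hp : min p (w.length + 1) = p := by omega
    refine ⟨l, hl, hupd, ?_, ?_⟩
    · simp only [MicroInv, Move.apply, hp]
      omega
    · rintro _ ⟨⟩
      simp only [microMeasure, Move.apply, hp]
      exact hlt (by omega)
  | returnMark =>
    obtain ⟨h1, h2, h3⟩ := h
    obtain rfl := counterTape_eq_mark hc
    refine ⟨l, hl, hupd, ?_, ?_⟩
    · refine ⟨?_, h2, rfl⟩
      cases o.look <;> simp [Move.apply] <;> omega
    · rintro _ ⟨⟩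
      simp only [microMeasure]
      exact hlt (by omega)
  | test =>
    obtain ⟨rfl, h2, rfl⟩ := h
    have := (Op.symbol_eq_iff hv).1 hσ.symm
    refine ⟨l, hl, hupd, ⟨by rw [h2]; exact this, rfl⟩, ?_⟩
    rintro _ ⟨⟩
    have := this.le hv
    simp only [microMeasure]
    exact hlt (by omega)
  | finish =>
    obtain ⟨h1, rfl⟩ := h
    have hp : p = 0 := by
      cases p with
      | zero => rfl
      | succ p => cases h : w[p]? <;> simp [inputAt, h] at hσ
    subst hp
    exact ⟨l, hl, hupd, ⟨by simpa using h1, rfl, rfl⟩, by rintro _ ⟨⟩⟩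
  | inc _ _ hne =>
    obtain ⟨h1, rfl⟩ := h
    have hp : p ≠ 0 := inputAt_ne_leftEnd (hσ ▸ hne)
    have hle := h1.le hv
    have hp' : min (p - 1) (w.length + 1) = p - 1 := by omega
    refine ⟨l, hl, hupd, ?_, ?_⟩
    · simp only [MicroInv, Move.apply, hp']
      refine ⟨?_, by omega, by omega⟩
      convert h1 using 1
      simp only [zero_add, Nat.sub_self, pow_zero]
      omega
    · rintro _ ⟨⟩
      simp only [microMeasure, Move.apply, hp']
      exact hlt (by omega)
  | incTrue =>
    obtain ⟨h1, h2, h3⟩ := h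
    obtain ⟨m, rfl, hm, hb⟩ := counterTape_eq_bit hc
    have hle := h1.le hv
    have hpos := Nat.two_pow_pos (m + 1 - 1)
    have hp : min p (w.length + 1) = p := by omega
    have hval := binVal_set hb false
    refine ⟨l.set m false, by simpa using hl, counterTape_set hm _, ?_, ?_⟩
    · simp only [MicroInv, Move.apply, hp, Nat.add_sub_cancel, List.length_set]
      simp only [Bool.toNat_true, Bool.toNat_false] at hval
      refine ⟨?_, by omega, by omega⟩
      convert h1 using 1
      rw [pow_succ, Nat.add_sub_cancel]
      omega
    · rintro _ ⟨⟩
      simp only [microMeasure, Move.apply, hp, List.length_set]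
      exact hlt (by omega)
  | incFalse =>
    obtain ⟨h1, h2, h3⟩ := h
    obtain ⟨m, rfl, hm, hb⟩ := counterTape_eq_bit hc
    have hle := h1.le hv
    have hpos := Nat.two_pow_pos (m + 1 - 1)
    have hp : min p (w.length + 1) = p := by omega
    have hval := binVal_set hb true
    refine ⟨l.set m true, by simpa using hl, counterTape_set hm _, ?_, ?_⟩
    · simp only [MicroInv, Move.apply, hp, Nat.add_sub_cancel, List.length_set]
      simp only [Bool.toNat_true, Bool.toNat_false] at hval
      refine ⟨?_, by omega⟩
      convert h1 using 1
      rw [Nat.add_sub_cancel]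
      omega
    · rintro _ ⟨⟩
      simp only [microMeasure, Move.apply, hp]
      exact hlt (by omega)
  | incEmpty =>
    obtain ⟨h1, h2, h3⟩ := h
    have hj := counterTape_eq_blank hc
    obtain rfl : j = l.length + 1 := by omega
    have hle := h1.le hv
    have hpos := Nat.two_pow_pos (l.length + 1 - 1)
    have hp : min p (w.length + 1) = p := by omega
    rw [Nat.add_sub_cancel] at h1 hle
    -- The counter grows only when a carry of weight `2 ^ l.length` leaves its last digit. That
    -- weight is part of the new head position, which is at most the length of the input.
    have hlog : l.length ≤ Nat.log 2 w.length := by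
      have : 2 ^ l.length ≤ w.length := by omega
      have h0 : w.length ≠ 0 := by
        have := Nat.one_le_two_pow (n := l.length)
        omega
      exact (Nat.le_log_iff_pow_le (by norm_num) h0).2 this
    refine ⟨l ++ [true], by simpa using hlog, counterTape_append _ _, ?_, ?_⟩
    · simp only [MicroInv, Move.apply, hp, Nat.add_sub_cancel, List.length_append, binVal_append_true]
      refine ⟨?_, by omega⟩
      convert h1 using 1
      omega
    · rintro _ ⟨⟩
      simp only [microMeasure, Move.apply, hp]
      exact hlt (by omega)
  | incReturnBit =>
    obtain ⟨h1, h2⟩ := h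
    obtain ⟨m, rfl, hm, hb⟩ := counterTape_eq_bit hc
    have hle := h1.le hv
    have hp : min p (w.length + 1) = p := by omega
    refine ⟨l, hl, hupd, ?_, ?_⟩
    · simp only [MicroInv, Move.apply, hp]
      exact ⟨h1, by omega⟩
    · rintro _ ⟨⟩
      simp only [microMeasure, Move.apply, hp]
      exact hlt (by omega)
  | incReturnMark =>
    obtain ⟨h1, h2⟩ := h
    obtain rfl := counterTape_eq_mark hc
    have hle := h1.le hv
    have hp : min p (w.length + 1) = p := by omega
    refine ⟨l, hl, hupd, ?_, ?_⟩
    · simp only [MicroInv, Move.apply, hp]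
      exact ⟨h1, trivial⟩
    · rintro _ ⟨⟩
      simp only [microMeasure, Move.apply, hp]
      exact hlt (by omega)

/-- Only the phase `test` can block. There the assumption that the operation is possible supplies
the scanned symbol; in the other phases the bounds on `j` exclude the tape symbols without a rule.
-/
theorem MicroInv.progress {w : List α} {o : Op α} {v v' p j : ℕ} {l : List Bool} {ph : Phase}
    (hv : v ≤ w.length) (hv' : o.Rel w v v')
    (h : MicroInv w o v p l j (some ph)) :
    ∃ r, Micro o ph (inputAt w p) (counterTape l j) r := by
  have hlook : o.symbol = inputAt w (v + o.look.toNat) := by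
    rw [Op.symbol_eq_iff hv]
    cases o with
    | zero =>
      obtain ⟨rfl, rfl⟩ := hv'
      exact ⟨rfl, by simp [Op.look, Op.move, Move.apply]⟩
    | last =>
      obtain ⟨rfl, rfl⟩ := hv'
      exact ⟨rfl, by simp [Op.look, Op.move, Move.apply]⟩
    | fwd a =>
      obtain ⟨h, rfl⟩ := hv'
      exact ⟨h, by simp [Op.look, Op.move, Move.apply, hv]⟩
    | bwd a =>
      obtain ⟨rfl, ha⟩ := hv'
      have : min v' (w.length + 1) = v' := by omega
      simp [Op.look, Op.move, Move.apply, this, Op.Rel, ha]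
  cases ph with
  | decScan =>
    obtain ⟨-, h, -⟩ := h
    rcases counterTape_cases l h with ⟨-, h⟩ | ⟨m, b, -, -, -, h⟩ | ⟨-, h⟩ <;> rw [h]
    · exact ⟨_, .decStart _⟩
    · cases b
      · exact ⟨_, .decFalse _⟩
      · exact ⟨_, .decTrue _⟩
    · exact ⟨_, .decEmpty _⟩
  | decBack =>
    obtain ⟨-, h, -⟩ := h
    rcases counterTape_cases l (h.trans (Nat.le_succ _)) with ⟨-, h⟩ | ⟨m, b, -, -, -, h⟩ | ⟨h', -⟩
    · rw [h]; exact ⟨_, .backMark _⟩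
    · rw [h]; exact ⟨_, .backBit _ _⟩
    · omega
  | decReturn =>
    obtain ⟨-, -, h⟩ := h
    rcases counterTape_cases l (h.trans (Nat.le_succ _)) with ⟨-, h⟩ | ⟨m, b, -, -, -, h⟩ | ⟨h', -⟩
    · rw [h]; exact ⟨_, .returnMark _⟩
    · rw [h]; exact ⟨_, .returnBit _ _⟩
    · omega
  | test =>
    obtain ⟨rfl, -, -⟩ := h
    rw [← hlook]
    exact ⟨_, .test _⟩
  | check =>
    by_cases hp : inputAt w p = .leftEnd
    · rw [hp]; exact ⟨_, .finish _⟩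
    · exact ⟨_, .inc _ _ hp⟩
  | incScan =>
    obtain ⟨-, h1, h⟩ := h
    rcases counterTape_cases l h with ⟨h, -⟩ | ⟨m, b, -, -, -, h⟩ | ⟨-, h⟩
    · omega
    · rw [h]
      cases b
      · exact ⟨_, .incFalse _⟩
      · exact ⟨_, .incTrue _⟩
    · rw [h]; exact ⟨_, .incEmpty _⟩
  | incReturn =>
    obtain ⟨-, h⟩ := h
    rcases counterTape_cases l (h.trans (Nat.le_succ _)) with ⟨-, h⟩ | ⟨m, b, -, -, -, h⟩ | ⟨h', -⟩
    · rw [h]; exact ⟨_, .incReturnMark _⟩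
    · rw [h]; exact ⟨_, .incReturnBit _ _⟩
    · omega

/-! ### The machine -/

namespace HeadNFA

variable (A : HeadNFA α)

/-- The states of the simulating machine: the initial state, the states of the automaton, and the
phases of the simulation of a transition. -/
abbrev MState := Option (Fin A.N ⊕ Fin A.M × Phase)

/-- The state after a step of the simulation of the transition `e`. -/
def nextState (e : Fin A.M) : Option Phase → A.MState
  | none => some (.inl (A.dst e))
  | some ph => some (.inr (e, ph))

/-- The input head is back on the left endmarker whenever an operation is finished, so a single
input head can serve all counters in turn. -/
def mtrans : A.MState → InputSymbol α → (Fin A.k → Cell) →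
    Set (A.MState × (Fin A.k → Cell) × Move × (Fin A.k → Move))
  | none, _, _ => {(some (.inl A.start), fun _ => .mark, .stay, fun _ => .stay)}
  | some (.inl q), _, γ => {x | ∃ e, A.src e = q ∧
      x = (A.nextState e ((A.lab e).map fun _ => .decScan), γ, .stay, fun _ => .stay)}
  | some (.inr (e, ph)), σ, γ => {x | ∃ i o r, A.lab e = some (i, o) ∧ Micro o ph σ (γ i) r ∧
      x = (A.nextState e r.1, Function.update γ i r.2.1, r.2.2.1,
        Function.update (fun _ => .stay) i r.2.2.2)}

/-- A Turing machine that stores the positions of the heads in binary. -/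
abbrev machine : NTM α where
  k := A.k
  State := A.MState
  finite_state := inferInstance
  Γ := Cell
  finite_Γ := inferInstance
  blank := .blank
  start := none
  accepting := {q | ∃ f ∈ A.final, q = some (.inl f)}
  trans := A.mtrans

/-- The configurations of the machine, for the digits `D` on the tapes. -/
def conf (q : A.MState) (p : ℕ) (D : Fin A.k → List Bool) (P : Fin A.k → ℕ) : A.machine.Cfg where
  state := q
  inPos := p
  tape t := counterTape (D t)
  pos := P

/-- The configurations that can occur. -/
inductive Good (w : List α) : A.machine.Cfg → Prop
  | init : Good w A.machine.init
  | rest (q h D) (hr : A.Reachable w (q, h)) (hl : ∀ t, (D t).length ≤ Nat.log 2 w.length + 1)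
      (hD : ∀ t, binVal (D t) = h t) : Good w (A.conf (some (.inl q)) 0 D fun _ => 0)
  | run (e i o ph h p D j) (he : A.lab e = some (i, o)) (hr : A.Reachable w (A.src e, h))
      (hl : ∀ t, (D t).length ≤ Nat.log 2 w.length + 1) (hD : ∀ t, t ≠ i → binVal (D t) = h t)
      (hI : MicroInv w o (h i) p (D i) j (some ph)) :
      Good w (A.conf (some (.inr (e, ph))) p D (Function.update (fun _ => 0) i j))

theorem step_conf_run {w : List α} {e : Fin A.M} {i : Fin A.k} {o : Op α} {ph : Phase} {p j : ℕ}
    {D : Fin A.k → List Bool} (he : A.lab e = some (i, o)) {d : A.machine.Cfg} :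
    A.machine.Step w
      (A.conf (some (.inr (e, ph))) p D (Function.update (fun _ => 0) i j)) d ↔
    ∃ r, Micro o ph (inputAt w p) (counterTape (D i) j) r ∧
      d = { state := A.nextState e r.1
            inPos := min (r.2.2.1.apply p) (w.length + 1)
            tape := Function.update (fun t => counterTape (D t)) i
              (Function.update (counterTape (D i)) j r.2.1)
            pos := Function.update (fun _ => 0) i (r.2.2.2.apply j) } := by
  have key : ∀ r : Option Phase × Cell × Move × Move,
      ({ state := A.nextState e r.1
         inPos := min (r.2.2.1.apply p) (w.length + 1)
         tape := fun t => Function.update (counterTape (D t))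
           (Function.update (fun _ => 0) i j t) (Function.update (fun t =>
             counterTape (D t) (Function.update (fun _ => 0) i j t)) i r.2.1 t)
         pos := fun t => (Function.update (fun _ => Move.stay) i r.2.2.2 t).apply
           (Function.update (fun _ => 0) i j t) } : A.machine.Cfg) =
      { state := A.nextState e r.1
        inPos := min (r.2.2.1.apply p) (w.length + 1)
        tape := Function.update (fun t => counterTape (D t)) i
          (Function.update (counterTape (D i)) j r.2.1)
        pos := Function.update (fun _ => 0) i (r.2.2.2.apply j) } := by
    intro r
    congr 1
    · funext t
      by_cases ht : t = i
      · subst ht; simp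
      · simp [ht]
    · funext t
      by_cases ht : t = i
      · subst ht; simp
      · simp [ht, Move.apply]
  constructor
  · rintro ⟨q, s, m, v, ⟨i', o', r, he', hr, hx⟩, rfl⟩
    rw [he] at he'
    cases he'
    cases hx
    refine ⟨r, ?_, key r⟩
    simpa [conf] using hr
  · rintro ⟨r, hr, rfl⟩
    exact ⟨_, _, _, _, ⟨i, o, r, he, by simpa [conf] using hr, rfl⟩, (key r).symm⟩

theorem step_conf_rest {w : List α} {q : Fin A.N} {D : Fin A.k → List Bool} {d : A.machine.Cfg} :
    A.machine.Step w (A.conf (some (.inl q)) 0 D fun _ => 0) d ↔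
    ∃ e, A.src e = q ∧
      d = A.conf (A.nextState e ((A.lab e).map fun _ => .decScan)) 0 D fun _ => 0 := by
  constructor
  · rintro ⟨q', s, m, v, ⟨e, he, hx⟩, rfl⟩
    cases hx
    exact ⟨e, he, by simp [conf, Move.apply]⟩
  · rintro ⟨e, he, rfl⟩
    exact ⟨_, _, _, _, ⟨e, he, rfl⟩, by simp [conf, Move.apply]⟩

theorem step_init {w : List α} {d : A.machine.Cfg} :
    A.machine.Step w A.machine.init d ↔
      d = A.conf (some (.inl A.start)) 0 (fun _ => []) fun _ => 0 := by
  have key : Function.update (fun _ : ℕ => Cell.blank) 0 Cell.mark = counterTape [] := by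
    funext m
    cases m <;> simp [counterTape]
  constructor
  · rintro ⟨q', s, m, v, hx, rfl⟩
    cases hx
    simp [NTM.init, conf, Move.apply, machine, key]
  · rintro rfl
    exact ⟨_, _, _, _, rfl, by simp [NTM.init, conf, Move.apply, machine, key]⟩

theorem update_conf {e : Fin A.M} {i : Fin A.k} {r : Option Phase} {p j : ℕ} {c : Cell} {m : ℕ}
    {D : Fin A.k → List Bool} {l : List Bool}
    (h : Function.update (counterTape (D i)) m c = counterTape l) :
    ({ state := A.nextState e r
       inPos := p
       tape := Function.update (fun t => counterTape (D t)) i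
         (Function.update (counterTape (D i)) m c)
       pos := Function.update (fun _ => 0) i j } : A.machine.Cfg) =
    A.conf (A.nextState e r) p (Function.update D i l) (Function.update (fun _ => 0) i j) := by
  rw [h, conf]
  congr 1
  funext t
  by_cases ht : t = i
  · subst ht; simp
  · simp [ht]

/-- While an operation runs, the automaton is still in its old configuration and only the counter
`i` deviates from it. The automaton makes its step when the last phase ends, where `MicroInv` gives
the operation together with the new value. -/
theorem Good.step {w : List α} {c d : A.machine.Cfg} (hc : A.Good w c)
    (h : A.machine.Step w c d) : A.Good w d := by
  cases hc with
  | init =>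
    rw [step_init] at h
    subst h
    exact .rest _ (fun _ => 0) _ .refl (by simp) (by simp [binVal])
  | rest q h' D hr hl hD =>
    rw [step_conf_rest] at h
    obtain ⟨e, rfl, rfl⟩ := h
    match hlab : A.lab e with
    | none => exact .rest _ h' _ (hr.tail ⟨e, rfl, rfl, by rw [hlab]; rfl⟩) hl hD
    | some (i, o) =>
      have : (fun _ => 0 : Fin A.k → ℕ) = Function.update (fun _ => 0) i 0 := by
        funext t; by_cases ht : t = i <;> simp [Function.update_apply]
      rw [this]
      exact .run e i o .decScan h' 0 D 0 hlab hr hl (fun t _ => hD t)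
        ⟨by rw [hD, zero_add], by omega, fun m hm => by omega⟩
  | run e i o ph h' p D j he hr hl hD hI =>
    rw [step_conf_run A he] at h
    obtain ⟨r, hm, rfl⟩ := h
    obtain ⟨l', hl', htape, hI', -⟩ := hI.step (hr.le i) (hl i) hm
    rw [update_conf A htape]
    have hl'' : ∀ t, (Function.update D i l' t).length ≤ Nat.log 2 w.length + 1 := by
      intro t
      by_cases ht : t = i
      · subst ht; simpa using hl'
      · simpa [ht] using hl t
    match hr1 : r.1 with
    | some ph' =>
      rw [hr1] at hI'
      exact .run e i o ph' h' _ _ _ he hr hl'' (fun t ht => by simpa [ht] using hD t ht)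
        (by simpa using hI')
    | none =>
      rw [hr1] at hI'
      obtain ⟨h1, h2, h3⟩ := hI'
      rw [h2, h3]
      have : Function.update (fun _ => 0) i 0 = (fun _ => 0 : Fin A.k → ℕ) := by
        funext t; by_cases ht : t = i <;> simp [Function.update_apply]
      rw [this]
      refine .rest _ (Function.update h' i (binVal l')) _
        (hr.tail ⟨e, rfl, rfl, by rw [he]; exact ⟨_, h1, rfl⟩⟩) hl'' fun t => ?_
      by_cases ht : t = i
      · subst ht; simp
      · simpa [ht] using hD t ht

theorem good_of_reachable {w : List α} {c : A.machine.Cfg} (h : A.machine.Reachable w c) :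
    A.Good w c := by
  induction h with
  | refl => exact .init
  | tail _ hs ih => exact ih.step _ hs

/-- Besides at most log n + 1 digits, the work head visits the mark in cell `0` and the first blank.
The last cell visited has number at most log n + 2, which is below 3 (log n + 1). -/
theorem isSpaceBounded_machine : A.machine.IsSpaceBounded fun n => 3 * (Nat.log 2 n + 1) := by
  intro w c hc i
  cases A.good_of_reachable hc with
  | init => simp [NTM.init]
  | rest => simp [conf]
  | run e i' o ph h p D j he hr hl hD hI =>
    by_cases hi : i = i'
    · subst hi
      have h1 := hl i
      have h2 : j ≤ (D i).length + 1 := by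
        cases ph <;> simp only [MicroInv] at hI <;> omega
      simp only [conf, Function.update_self]
      omega
    · simp only [conf]
      rw [Function.update_of_ne hi]
      omega

/-- The simulation of an operation can be completed. -/
theorem exists_run {w : List α} {e : Fin A.M} {i : Fin A.k} {o : Op α} {v v' : ℕ}
    (he : A.lab e = some (i, o)) (hv : v ≤ w.length) (hv' : o.Rel w v v') (D : Fin A.k → List Bool)
    (m : ℕ ×ₗ ℕ ×ₗ ℕ) : ∀ (l : List Bool) (ph : Phase) (p j : ℕ),
    microMeasure w.length v p l.length j ph = m → l.length ≤ Nat.log 2 w.length + 1 →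
    MicroInv w o v p l j (some ph) →
    ∃ l' : List Bool, l'.length ≤ Nat.log 2 w.length + 1 ∧ binVal l' = v' ∧
      Relation.ReflTransGen (A.machine.Step w)
        (A.conf (some (.inr (e, ph))) p (Function.update D i l) (Function.update (fun _ => 0) i j))
        (A.conf (some (.inl (A.dst e))) 0 (Function.update D i l') fun _ => 0) := by
  induction m using WellFoundedLT.induction with
  | ind m ih =>
    intro l ph p j hm hl hI
    obtain ⟨r, hr⟩ := hI.progress hv hv'
    obtain ⟨l', hl', htape, hI', hdec⟩ := hI.step hv hl hr
    have hstep : A.machine.Step w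
        (A.conf (some (.inr (e, ph))) p (Function.update D i l) (Function.update (fun _ => 0) i j))
        (A.conf (A.nextState e r.1) (min (r.2.2.1.apply p) (w.length + 1))
          (Function.update D i l') (Function.update (fun _ => 0) i (r.2.2.2.apply j))) := by
      rw [step_conf_run A he]
      refine ⟨r, by simpa using hr, ?_⟩
      rw [update_conf A (l := l') (by simpa using htape), Function.update_idem]
    match hr1 : r.1 with
    | some ph' =>
      rw [hr1] at hI' hstep
      obtain ⟨l'', h1, h2, h3⟩ := ih _ (hm ▸ hdec ph' hr1) l' ph' _ _ rfl hl' hI'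
      exact ⟨l'', h1, h2, .head hstep h3⟩
    | none =>
      rw [hr1] at hI' hstep
      obtain ⟨h1, h2, h3⟩ := hI'
      refine ⟨l', hl', h1.unique hv', ?_⟩
      rw [h2, h3] at hstep
      have : Function.update (fun _ => 0) i 0 = (fun _ => 0 : Fin A.k → ℕ) := by
        funext t; by_cases ht : t = i <;> simp [Function.update_apply]
      rw [this] at hstep
      exact .single hstep

theorem exists_reachable {w : List α} {c : Fin A.N × (Fin A.k → ℕ)} (hc : A.Reachable w c) :
    ∃ D, (∀ t, (D t).length ≤ Nat.log 2 w.length + 1) ∧ (∀ t, binVal (D t) = c.2 t) ∧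
      A.machine.Reachable w (A.conf (some (.inl c.1)) 0 D fun _ => 0) := by
  induction hc with
  | refl =>
    exact ⟨fun _ => [], by simp, by simp [binVal], .single ((A.step_init).2 rfl)⟩
  | @tail c d hc hs ih =>
    obtain ⟨D, hl, hD, hr⟩ := ih
    obtain ⟨e, he, hd, hlab⟩ := hs
    have h1 := hr.tail ((A.step_conf_rest).2 ⟨e, he, rfl⟩)
    match hle : A.lab e with
    | none =>
      rw [hle] at h1 hlab
      refine ⟨D, hl, ?_, ?_⟩
      · rw [show d.2 = c.2 from hlab]; exact hD
      · rw [← hd]; exact h1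
    | some (i, o) =>
      rw [hle] at h1 hlab
      obtain ⟨v, hv, hdv⟩ := hlab
      have : (fun _ => 0 : Fin A.k → ℕ) = Function.update (fun _ => 0) i 0 := by
        funext t; by_cases ht : t = i <;> simp [Function.update_apply]
      obtain ⟨l', h2, h3, h4⟩ := A.exists_run hle (Reachable.le hc i) hv D _ (D i) .decScan 0 0 rfl (hl i)
        ⟨by rw [hD, zero_add], by omega, fun m hm => by omega⟩
      rw [Function.update_eq_self, ← this] at h4
      refine ⟨Function.update D i l', fun t => ?_, fun t => ?_, ?_⟩
      · by_cases ht : t = i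
        · subst ht; simpa using h2
        · simpa [ht] using hl t
      · rw [hdv]
        by_cases ht : t = i
        · subst ht; simpa using h3
        · simpa [ht] using hD t
      · rw [← hd]; exact Relation.ReflTransGen.trans h1 h4

theorem language_machine : A.machine.language = A.language := by
  ext w
  constructor
  · rintro ⟨c, hc, f, hf, hcf⟩
    cases A.good_of_reachable hc with
    | init => cases hcf
    | rest q h D hr hl hD => cases hcf; exact ⟨_, hr, hf⟩
    | run => cases hcf
  · rintro ⟨c, hc, hf⟩
    obtain ⟨D, -, -, h⟩ := A.exists_reachable hc
    exact ⟨_, h, _, hf, rfl⟩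

theorem language_mem_NLOGSPACE : A.language ∈ NLOGSPACE α :=
  ⟨A.machine, ⟨3, A.isSpaceBounded_machine⟩, A.language_machine⟩

end HeadNFA

end HeadProg

/-! ## A library of programs -/

namespace HeadProg

universe u

namespace Prog

variable {α : Type u} {ι F : Type}

/-- The program that does nothing. -/
def skip : Prog α ι F := star fail

/-- Nondeterministic choice from a list of programs. -/
def altList (l : List (Prog α ι F)) : Prog α ι F := l.foldr alt fail

/-- Sequential composition of a list of programs. -/
def seqList (l : List (Prog α ι F)) : Prog α ι F := l.foldr seq skip

variable [DecidableEq ι] {w : List α} {s t : Store ι F}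

theorem sem_skip : (skip : Prog α ι F).Sem w s t ↔ t = s := by
  constructor
  · intro h
    rcases Relation.ReflTransGen.cases_head h with h | ⟨_, h, -⟩
    · exact h.symm
    · exact h.elim
  · rintro rfl; exact .refl

theorem sem_altList {l : List (Prog α ι F)} : (altList l).Sem w s t ↔ ∃ p ∈ l, p.Sem w s t := by
  induction l with
  | nil => simp [altList, Sem]
  | cons p l ih => simpa [altList, Sem] using or_congr_right ih

theorem sem_seqList_nil : (seqList [] : Prog α ι F).Sem w s t ↔ t = s := sem_skip

theorem sem_seqList_cons {p : Prog α ι F} {l : List (Prog α ι F)} :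
    (seqList (p :: l)).Sem w s t ↔ ∃ m, p.Sem w s m ∧ (seqList l).Sem w m t := Iff.rfl

theorem Sem.le {p : Prog α ι F} (h : p.Sem w s t) (hs : ∀ i, s.2 i ≤ w.length) (i : ι) :
    t.2 i ≤ w.length := by
  induction p generalizing s t i with
  | act a =>
    match a, h with
    | .test f, h => obtain ⟨-, rfl⟩ := h; exact hs i
    | .set f, h => cases h; exact hs i
    | .head j o, h =>
      obtain ⟨v, hv, rfl⟩ := h
      by_cases hij : i = j
      · subst hij; simpa using hv.le (hs i)
      · simpa [hij] using hs i
  | fail => cases h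
  | seq p q hp hq => obtain ⟨m, h1, h2⟩ := h; exact hq h2 (hp h1 hs) i
  | alt p q hp hq => rcases h with h | h; exacts [hp h hs i, hq h hs i]
  | star p hp =>
    replace h : Relation.ReflTransGen (p.Sem w) s t := h
    induction h generalizing i with
    | refl => exact hs i
    | tail _ h ih => exact hp h ih i

/-- A test whether the head is at the left end. -/
def isZero (i : ι) : Prog α ι F := act (.head i .zero)

theorem sem_isZero {i : ι} : (isZero i : Prog α ι F).Sem w s t ↔ s.2 i = 0 ∧ t = s := by
  constructor
  · rintro ⟨v, ⟨h, rfl⟩, rfl⟩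
    exact ⟨h, by simp⟩
  · rintro ⟨h, rfl⟩
    exact ⟨_, ⟨h, rfl⟩, by simp⟩

theorem sem_isLast {i : ι} :
    (act (.head i .last) : Prog α ι F).Sem w s t ↔ s.2 i = w.length ∧ t = s := by
  constructor
  · rintro ⟨v, ⟨h, rfl⟩, rfl⟩
    exact ⟨h, by simp⟩
  · rintro ⟨h, rfl⟩
    exact ⟨_, ⟨h, rfl⟩, by simp⟩

theorem sem_fwd {i : ι} {a : α} : (act (.head i (.fwd a)) : Prog α ι F).Sem w s t ↔
    w[s.2 i]? = some a ∧ t = (s.1, Function.update s.2 i (s.2 i + 1)) := by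
  constructor
  · rintro ⟨v, ⟨h, rfl⟩, rfl⟩
    exact ⟨h, rfl⟩
  · rintro ⟨h, rfl⟩
    exact ⟨_, ⟨h, rfl⟩, rfl⟩

theorem sem_test {f : F} : (act (.test f) : Prog α ι F).Sem w s t ↔ s.1 = f ∧ t = s := Iff.rfl

theorem sem_set {f : F} : (act (.set f) : Prog α ι F).Sem w s t ↔ t = (f, s.2) := Iff.rfl

-- Unary arithmetic on head positions.

section Fintype

variable [Fintype α]

/-- Move a head to the right. -/
noncomputable def inc (i : ι) : Prog α ι F :=
  altList ((Finset.univ : Finset α).toList.map fun a => act (.head i (.fwd a)))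

/-- Move a head to the left. -/
noncomputable def dec (i : ι) : Prog α ι F :=
  altList ((Finset.univ : Finset α).toList.map fun a => act (.head i (.bwd a)))

theorem sem_inc {i : ι} : (inc i : Prog α ι F).Sem w s t ↔
    s.2 i < w.length ∧ t = (s.1, Function.update s.2 i (s.2 i + 1)) := by
  simp only [inc, sem_altList, List.mem_map, Finset.mem_toList, Finset.mem_univ, true_and,
    exists_exists_eq_and, sem_fwd, exists_and_right, and_congr_left_iff]
  rintro -
  simp [List.getElem?_eq_some_iff]

theorem sem_dec {i : ι} : (dec i : Prog α ι F).Sem w s t ↔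
    s.2 i ≠ 0 ∧ s.2 i ≤ w.length ∧ t = (s.1, Function.update s.2 i (s.2 i - 1)) := by
  simp only [dec, sem_altList, List.mem_map, Finset.mem_toList, Finset.mem_univ, true_and,
    exists_exists_eq_and]
  constructor
  · rintro ⟨a, v, ⟨h, ha⟩, rfl⟩
    have := (List.getElem?_eq_some_iff.1 ha).1
    exact ⟨by omega, by omega, by rw [h, Nat.add_sub_cancel]⟩
  · rintro ⟨h0, h, rfl⟩
    have hlt : s.2 i - 1 < w.length := by omega
    exact ⟨w[s.2 i - 1], s.2 i - 1, ⟨by omega, by simp [hlt]⟩, rfl⟩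

/-- Move several heads to the right. -/
noncomputable def incs (l : List ι) : Prog α ι F := seqList (l.map inc)

/-- Move a head several steps to the left. -/
noncomputable def decs (a : ℕ) (i : ι) : Prog α ι F := seqList (List.replicate a (dec i))

theorem Sem.of_incs {l : List ι} (h : (incs l : Prog α ι F).Sem w s t) :
    t.1 = s.1 ∧ ∀ i, t.2 i = s.2 i + l.count i := by
  induction l generalizing s with
  | nil => rw [sem_seqList_nil.1 h]; simp
  | cons j l ih =>
    obtain ⟨m, h1, h2⟩ := h
    obtain ⟨-, rfl⟩ := sem_inc.1 h1
    obtain ⟨h3, h4⟩ := ih h2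
    refine ⟨h3, fun i => ?_⟩
    rw [h4]
    by_cases hij : i = j
    · subst hij; simp; omega
    · simp [hij, Ne.symm hij]

theorem sem_incs {l : List ι} (h : ∀ i ∈ l, s.2 i + l.count i ≤ w.length) :
    (incs l : Prog α ι F).Sem w s (s.1, fun i => s.2 i + l.count i) := by
  induction l generalizing s with
  | nil => exact sem_seqList_nil.2 (by simp)
  | cons j l ih =>
    refine ⟨(s.1, Function.update s.2 j (s.2 j + 1)), sem_inc.2 ⟨?_, rfl⟩, ?_⟩
    · have := h j (by simp)
      simp at this
      omega
    · show (incs l : Prog α ι F).Sem w _ _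
      convert ih (s := (s.1, Function.update s.2 j (s.2 j + 1))) ?_ using 1
      · refine Prod.ext rfl (funext fun i => ?_)
        by_cases hij : i = j
        · subst hij; simp; omega
        · simp [hij, Ne.symm hij]
      · intro i hi
        have := h i (by simp [hi])
        by_cases hij : i = j
        · subst hij; simp at this ⊢; omega
        · simpa [hij, List.count_cons, Ne.symm hij] using this

theorem sem_decs {a : ℕ} {i : ι} (hi : s.2 i ≤ w.length) : (decs a i : Prog α ι F).Sem w s t ↔
    a ≤ s.2 i ∧ t = (s.1, Function.update s.2 i (s.2 i - a)) := by
  induction a generalizing s with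
  | zero => simp [decs, sem_seqList_nil]
  | succ a ih =>
    simp only [decs, List.replicate_succ, sem_seqList_cons, sem_dec]
    constructor
    · rintro ⟨m, ⟨h0, -, rfl⟩, h⟩
      rw [← decs, ih (by simp; omega)] at h
      simp only [Function.update_self, Function.update_idem] at h
      exact ⟨by omega, by rw [h.2]; congr 2; omega⟩
    · rintro ⟨h, rfl⟩
      refine ⟨_, ⟨by omega, hi, rfl⟩, ?_⟩
      rw [← decs, ih (by simp; omega)]
      simp only [Function.update_self, Function.update_idem]
      exact ⟨by omega, by congr 2; omega⟩

theorem Sem.of_decs {a : ℕ} {i : ι} (h : (decs a i : Prog α ι F).Sem w s t) :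
    a ≤ s.2 i ∧ t = (s.1, Function.update s.2 i (s.2 i - a)) := by
  cases a with
  | zero => simpa [decs, sem_seqList_nil] using h
  | succ a =>
    have : s.2 i ≤ w.length := by
      obtain ⟨m, h1, -⟩ := h
      exact (sem_dec.1 h1).2.1
    exact (sem_decs this).1 h

/-- Take `a` away from the head `i` and move every head in `l` once to the right, and repeat this
until the head `i` is at the left end. -/
noncomputable def drain (a : ℕ) (i : ι) (l : List ι) : Prog α ι F :=
  seq (star (seq (decs a i) (incs l))) (isZero i)

/-- Here `m` counts the rounds. The final test for zero makes the division by `a` exact. -/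
theorem Sem.of_drain {a : ℕ} {i : ι} {l : List ι} (hil : i ∉ l)
    (h : (drain a i l : Prog α ι F).Sem w s t) : ∃ m, s.2 i = a * m ∧
      t = (s.1, fun j => if j = i then 0 else s.2 j + m * l.count j) := by
  obtain ⟨t', h, h0⟩ := h
  rw [sem_isZero] at h0
  obtain ⟨h0, rfl⟩ := h0
  have key : ∃ m, s.2 i = t.2 i + a * m ∧ t.1 = s.1 ∧
      ∀ j, j ≠ i → t.2 j = s.2 j + m * l.count j := by
    clear h0
    replace h : Relation.ReflTransGen _ s t := h
    induction h with
    | refl => exact ⟨0, by simp⟩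
    | tail _ h ih =>
      obtain ⟨m, h1, h2, h3⟩ := ih
      obtain ⟨r, hr, hr'⟩ := h
      obtain ⟨h4, rfl⟩ := hr.of_decs
      obtain ⟨h5, h6⟩ := hr'.of_incs
      refine ⟨m + 1, ?_, h5.trans h2, fun j hj => ?_⟩
      · rw [h6, h1, List.count_eq_zero_of_not_mem hil]
        simp only [Function.update_self, mul_add]
        omega
      · rw [h6]
        simp only [Function.update_of_ne hj, h3 j hj]
        ring
  obtain ⟨m, h1, h2, h3⟩ := key
  refine ⟨m, by omega, Prod.ext h2 (funext fun j => ?_)⟩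
  by_cases hj : j = i
  · subst hj; simpa using h0
  · simpa [hj] using h3 j hj

theorem sem_drain {a : ℕ} {i : ι} {l : List ι} (hil : i ∉ l) {m : ℕ} (hi : s.2 i = a * m)
    (hn : s.2 i ≤ w.length) (hl : ∀ j ∈ l, s.2 j + m * l.count j ≤ w.length) :
    (drain a i l : Prog α ι F).Sem w s
      (s.1, fun j => if j = i then 0 else s.2 j + m * l.count j) := by
  refine ⟨_, ?_, sem_isZero.2 ⟨by simp, rfl⟩⟩
  show Relation.ReflTransGen _ _ _
  induction m generalizing s with
  | zero =>
    convert Relation.ReflTransGen.refl using 1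
    refine Prod.ext rfl (funext fun j => ?_)
    by_cases hj : j = i
    · subst hj; simpa using hi.symm
    · simp [hj]
  | succ m ih =>
    rw [mul_add, mul_one] at hi
    have hcount : l.count i = 0 := List.count_eq_zero_of_not_mem hil
    have hstep : (seq (decs a i) (incs l) : Prog α ι F).Sem w s
        (s.1, fun j => if j = i then a * m else s.2 j + l.count j) := by
      refine ⟨_, (sem_decs hn).2 ⟨by omega, rfl⟩, ?_⟩
      convert sem_incs (s := (s.1, Function.update s.2 i (s.2 i - a))) ?_ using 2
      · funext j
        by_cases hj : j = i
        · subst hj; simp [hcount]; omega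
        · simp [hj]
      · intro j hj
        have := hl j hj
        have hj' : j ≠ i := fun e => hil (e ▸ hj)
        simp only [Function.update_of_ne hj']
        nlinarith
    refine .head hstep ?_
    convert ih (s := (s.1, fun j => if j = i then a * m else s.2 j + l.count j)) ?_ ?_ ?_ using 2
    · funext j
      by_cases hj : j = i
      · simp [hj]
      · simp [hj]; ring
    · simp
    · simp; omega
    · intro j hj
      have := hl j hj
      have hj' : j ≠ i := fun e => hil (e ▸ hj)
      simp only [hj', if_false]
      nlinarith

/-- Copy the position of the head `i` to the head `j`, with the help of the head `k`. -/
noncomputable def copy (i j k : ι) : Prog α ι F :=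
  seqList [drain 1 j [], drain 1 k [], drain 1 i [j, k], drain 1 k [i]]

/-- A position is read by draining it, so `i` is emptied into both `j` and `k` and then restored
from `k`. This is why `k` ends at zero. -/
theorem sem_copy {i j k : ι} (hij : i ≠ j) (hik : i ≠ k) (hjk : j ≠ k)
    (hs : ∀ i, s.2 i ≤ w.length) : (copy i j k : Prog α ι F).Sem w s t ↔
      t = (s.1, Function.update (Function.update s.2 j (s.2 i)) k 0) := by
  constructor
  · rintro ⟨s₁, h1, s₂, h2, s₃, h3, s₄, h4, h5⟩
    obtain rfl := sem_skip.1 h5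
    obtain ⟨m₁, -, rfl⟩ := h1.of_drain (by simp)
    obtain ⟨m₂, -, rfl⟩ := h2.of_drain (by simp)
    obtain ⟨m₃, h6, rfl⟩ := h3.of_drain (by simp [hij, hik])
    obtain ⟨m₄, h7, rfl⟩ := h4.of_drain (by simp [hik.symm])
    simp [hij, hik, hjk, hik.symm, hjk.symm] at h6 h7
    subst h7
    clear h1 h2 h3 h4 h5
    refine Prod.ext rfl (funext fun x => ?_)
    by_cases hx : x = k
    · simp [hx]
    · by_cases hx' : x = j
      · subst hx'
        simp [hij, hij.symm, hjk, h6]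
      · by_cases hx'' : x = i
        · subst hx''
          simp [hx, hx', h6]
        · simp [hx, hx', hx'', Ne.symm hx, Ne.symm hx', Ne.symm hx'']
  · rintro rfl
    refine ⟨_, sem_drain (m := s.2 j) (by simp) (by simp) (hs j) (by simp), _,
      sem_drain (m := s.2 k) (by simp) (by simp [hjk.symm]) (by simpa [hjk.symm] using hs k)
        (by simp), _,
      sem_drain (m := s.2 i) (by simp [hij, hik]) (by simp [hij, hik]) (by simpa [hij, hik] using hs i)
        (by simpa [hij, hik, hjk, hjk.symm, List.count_cons] using hs i), _,
      sem_drain (m := s.2 i) (by simp [hik.symm])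
        (by simp [hik.symm, hjk])
        (by simpa [hik.symm, hjk, List.count_cons] using hs i)
        (by simpa [List.count_cons] using hs i), ?_⟩
    refine sem_skip.2 (Prod.ext rfl (funext fun x => ?_))
    by_cases hx : x = k
    · simp [hx]
    · by_cases hx' : x = j
      · subst hx'
        simp [hij, hjk, hij.symm]
      · by_cases hx'' : x = i
        · subst hx''
          simp [hx, hx']
        · simp [hx, hx', hx'', Ne.symm hx, Ne.symm hx', Ne.symm hx'']

/-- Move a head to an arbitrary position. -/
noncomputable def guess (i : ι) : Prog α ι F := star (alt (inc i) (dec i))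

theorem Sem.of_guess {i : ι} (h : (guess i : Prog α ι F).Sem w s t) :
    t.1 = s.1 ∧ ∀ j, j ≠ i → t.2 j = s.2 j := by
  replace h : Relation.ReflTransGen _ s t := h
  induction h with
  | refl => simp
  | tail _ h ih =>
    rcases h with h | h
    · obtain ⟨-, rfl⟩ := sem_inc.1 h
      exact ⟨ih.1, fun j hj => by simp [hj, ih.2]⟩
    · obtain ⟨-, -, rfl⟩ := sem_dec.1 h
      exact ⟨ih.1, fun j hj => by simp [hj, ih.2]⟩

theorem sem_guess {i : ι} (hs : s.2 i ≤ w.length) {v : ℕ} (hv : v ≤ w.length) :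
    (guess i : Prog α ι F).Sem w s (s.1, Function.update s.2 i v) := by
  have h0 : ∀ m, m ≤ w.length → ∀ s : Store ι F, s.2 i = m →
      (guess i : Prog α ι F).Sem w s (s.1, Function.update s.2 i 0) := by
    intro m
    induction m with
    | zero =>
      intro _ s hs
      rw [← hs, Function.update_eq_self]
      exact .refl
    | succ m ih =>
      intro hm s hs
      have := ih (by omega) (s.1, Function.update s.2 i (s.2 i - 1)) (by simp [hs])
      refine .head (.inr (sem_dec.2 ⟨by omega, by omega, rfl⟩)) ?_
      show (guess i : Prog α ι F).Sem w _ _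
      simpa using this
  have h1 : ∀ s : Store ι F, (guess i : Prog α ι F).Sem w (s.1, Function.update s.2 i 0)
      (s.1, Function.update s.2 i v) := by
    intro s
    induction v with
    | zero => exact .refl
    | succ v ih =>
      refine Relation.ReflTransGen.tail (ih (by omega)) (.inl (sem_inc.2 ⟨by simpa using hv, ?_⟩))
      simp
  exact Relation.ReflTransGen.trans (h0 _ hs s rfl) (h1 s)

end Fintype

end Prog

end HeadProg

/-! ## From linear FC-Datalog to programs -/

namespace HeadProg

universe u

open FCDatalog

/-! ### Factors of the input word -/

/-- The factor of length `l` at position `s`. -/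
def seg {α : Type u} (w : List α) (s l : ℕ) : List α := (w.drop s).take l

section seg

variable {α : Type u} {w : List α} {s l : ℕ}

theorem seg_infix : seg w s l <:+: w :=
  (List.take_prefix _ _).isInfix.trans (List.drop_suffix _ _).isInfix

theorem seg_zero : seg w s 0 = [] := by simp [seg]

theorem length_seg (h : s + l ≤ w.length) : (seg w s l).length = l := by
  simp [seg]; omega

theorem seg_eq_cons {a : α} (h : w[s]? = some a) (hl : l ≠ 0) :
    seg w s l = a :: seg w (s + 1) (l - 1) := by
  obtain ⟨hs, rfl⟩ := List.getElem?_eq_some_iff.1 h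
  obtain ⟨l, rfl⟩ := Nat.exists_eq_succ_of_ne_zero hl
  rw [seg, List.drop_eq_getElem_cons hs]
  rfl

theorem of_seg_eq_cons {a : α} {r : List α} (h : seg w s l = a :: r) :
    w[s]? = some a ∧ l ≠ 0 ∧ seg w (s + 1) (l - 1) = r := by
  have hl : l ≠ 0 := by
    rintro rfl
    simp [seg] at h
  have hs : s < w.length := by
    by_contra hs
    simp [seg, List.drop_eq_nil_of_le (not_lt.1 hs)] at h
  have := seg_eq_cons (List.getElem?_eq_getElem hs) hl
  rw [h, List.cons.injEq] at this
  exact ⟨by rw [this.1]; simp [hs], hl, this.2.symm⟩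

theorem exists_seg_eq {v : List α} (h : v <:+: w) : ∃ s l, s + l ≤ w.length ∧ seg w s l = v := by
  obtain ⟨a, b, rfl⟩ := h
  exact ⟨a.length, v.length, by simp, by simp [seg]⟩

theorem seg_univ : seg w 0 w.length = w := by simp [seg]

end seg

/-! ### Heads -/

/-- The heads of the programs that evaluate FC-Datalog programs. The words that are the values of
arguments and variables are represented by the position (`false`) and the length (`true`) of a
factor of the input word. -/
inductive Hd
  | arg (r j : ℕ) (b : Bool)
  | var (r x : ℕ) (b : Bool)
  | tmp (i : ℕ) (b : Bool)
  deriving DecidableEq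

namespace Hd

/-- The level of a head. -/
def level : Hd → ℕ
  | arg r _ _ => r
  | var r _ _ => r
  | tmp _ _ => 0

end Hd

-- Words represented by pairs of heads, and the levels that a program leaves alone.

section Stores

variable {α : Type u} {F : Type}

/-- The heads do not leave the input word. -/
def Bdd (w : List α) (s : Store Hd F) : Prop := ∀ i, s.2 i ≤ w.length

/-- The heads above level `r` are the same. -/
def Keeps (r : ℕ) (s t : Store Hd F) : Prop := ∀ i : Hd, r < i.level → t.2 i = s.2 i

theorem Keeps.refl (r : ℕ) (s : Store Hd F) : Keeps r s s := fun _ _ => rfl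

theorem Keeps.trans {r : ℕ} {s t t' : Store Hd F} (h : Keeps r s t) (h' : Keeps r t t') :
    Keeps r s t' := fun i hi => (h' i hi).trans (h i hi)

theorem Keeps.mono {r r' : ℕ} {s t : Store Hd F} (h : Keeps r s t) (hr : r ≤ r') :
    Keeps r' s t := fun i hi => h i (hr.trans_lt hi)

/-- The word that is represented by a pair of heads. -/
def word (w : List α) (s : Store Hd F) (f : Bool → Hd) : List α :=
  seg w (s.2 (f false)) (s.2 (f true))

/-- The pair of heads delimits a factor of the input word. -/
def Fits (w : List α) (s : Store Hd F) (f : Bool → Hd) : Prop :=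
  s.2 (f false) + s.2 (f true) ≤ w.length

theorem word_congr {w : List α} {s t : Store Hd F} {f : Bool → Hd}
    (h : ∀ b, t.2 (f b) = s.2 (f b)) : word w t f = word w s f := by
  simp [word, h]

theorem Fits.congr {w : List α} {s t : Store Hd F} {f : Bool → Hd} (hs : Fits w s f)
    (h : ∀ b, t.2 (f b) = s.2 (f b)) : Fits w t f := by
  simpa [Fits, h] using hs

/-- The substitution that is given by the heads at level `r`. -/
def valuation (w : List α) (s : Store Hd F) (r : ℕ) (x : Var) : List α := word w s (.var r x)

theorem Keeps.valuation_eq {w : List α} {s t : Store Hd F} {r r' : ℕ} (h : Keeps r s t)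
    (hr : r < r') : valuation w t r' = valuation w s r' :=
  funext fun _ => word_congr fun _ => h _ hr

end Stores

namespace Prog

variable {α : Type u} {F : Type} {w : List α}

theorem Sem.bdd {p : Prog α Hd F} {s t : Store Hd F} (h : p.Sem w s t) (hs : Bdd w s) : Bdd w t :=
  h.le hs

/-- Sequential compositions of programs that check properties. -/
theorem Sem.of_seqList_map {β : Type*} {f : β → Prog α Hd F} {l : List β} {r : ℕ}
    {Q : β → Store Hd F → Prop}
    (h : ∀ x ∈ l, ∀ s t, Bdd w s → (f x).Sem w s t → Keeps r s t ∧ Q x s)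
    (hQ : ∀ x s t, Keeps r s t → Q x t → Q x s) {s t : Store Hd F} (hs : Bdd w s)
    (hst : (seqList (l.map f)).Sem w s t) : Keeps r s t ∧ ∀ x ∈ l, Q x s := by
  induction l generalizing s with
  | nil => rw [sem_seqList_nil.1 hst]; exact ⟨.refl _ _, by simp⟩
  | cons x l ih =>
    obtain ⟨m, h1, h2⟩ := hst
    obtain ⟨h3, h4⟩ := h x (by simp) s m hs h1
    obtain ⟨h5, h6⟩ := ih (fun y hy => h y (by simp [hy])) (h1.bdd hs) h2
    refine ⟨h3.trans h5, fun y hy => ?_⟩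
    rcases List.mem_cons.1 hy with rfl | hy
    · exact h4
    · exact hQ _ _ _ h3 (h6 y hy)

/-- The store `s₀` is a fixed reference: each program need only succeed from stores that agree with
it above level `r`, because the programs run earlier may have spoiled everything below. -/
theorem exists_sem_seqList_map {β : Type*} {f : β → Prog α Hd F} {l : List β} {r : ℕ}
    {s₀ : Store Hd F} (hk : ∀ x ∈ l, ∀ s t, Bdd w s → (f x).Sem w s t → Keeps r s t)
    (h : ∀ x ∈ l, ∀ s, Bdd w s → Keeps r s₀ s → ∃ t, (f x).Sem w s t) {s : Store Hd F}
    (hs : Bdd w s) (h₀ : Keeps r s₀ s) : ∃ t, (seqList (l.map f)).Sem w s t := by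
  induction l generalizing s with
  | nil => exact ⟨s, sem_seqList_nil.2 rfl⟩
  | cons x l ih =>
    obtain ⟨m, hm⟩ := h x (by simp) s hs h₀
    obtain ⟨t, ht⟩ := ih (fun y hy => hk y (by simp [hy])) (fun y hy => h y (by simp [hy]))
      (hm.bdd hs) (h₀.trans (hk x (by simp) s m hs hm))
    exact ⟨t, m, hm, ht⟩

variable [Fintype α]

/-! ### Pattern matching -/

/-- Compare letters of the words at the pairs of heads `tmp 0` and `tmp 1`. -/
noncomputable def compareLetter (a : α) : Prog α Hd F :=
  seqList [act (.head (.tmp 0 false) (.fwd a)), act (.head (.tmp 1 false) (.fwd a)), dec (.tmp 0 true), dec (.tmp 1 true)]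

/-- Read a terminal or the value of a variable at the heads `tmp 0`. -/
noncomputable def matchElem (r : ℕ) : α ⊕ Var → Prog α Hd F
  | .inl a => seqList [act (.head (.tmp 0 false) (.fwd a)), dec (.tmp 0 true)]
  | .inr y => seqList [copy (.var r y false) (.tmp 1 false) (.tmp 2 false), copy (.var r y true) (.tmp 1 true) (.tmp 2 false),
      star (altList ((Finset.univ : Finset α).toList.map compareLetter)), isZero (.tmp 1 true)]

/-- Check that the word at the heads `f` is the image of a pattern. -/
noncomputable def matchPattern (r : ℕ) (f : Bool → Hd) (p : Pattern α) : Prog α Hd F :=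
  seqList [copy (f false) (.tmp 0 false) (.tmp 2 false), copy (f true) (.tmp 0 true) (.tmp 2 false),
    seqList (p.map (matchElem r)), isZero (.tmp 0 true)]

theorem Sem.of_compareLetter {a : α} {s t : Store Hd F} (h : (compareLetter a).Sem w s t) :
    Keeps 0 s t ∧ word w s (.tmp 0) = a :: word w t (.tmp 0) ∧
      word w s (.tmp 1) = a :: word w t (.tmp 1) := by
  obtain ⟨s₁, h1, s₂, h2, s₃, h3, s₄, h4, h5⟩ := h
  obtain rfl := sem_skip.1 h5
  rw [sem_fwd] at h1 h2
  rw [sem_dec] at h3 h4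
  obtain ⟨h1, rfl⟩ := h1
  obtain ⟨h2, rfl⟩ := h2
  obtain ⟨h3, -, rfl⟩ := h3
  obtain ⟨h4, -, rfl⟩ := h4
  simp at h1 h2 h3 h4
  refine ⟨?_, ?_, ?_⟩
  · rintro (_ | _ | _) hi
    · simp
    · simp
    · simp [Hd.level] at hi
  · simpa [word] using seg_eq_cons h1 h3
  · simpa [word] using seg_eq_cons h2 h4

theorem exists_sem_compareLetter {a : α} {s : Store Hd F} {u v : List α} (hs : Bdd w s)
    (h0 : word w s (.tmp 0) = a :: u) (h1 : word w s (.tmp 1) = a :: v) :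
    ∃ t, (compareLetter a).Sem w s t ∧ word w t (.tmp 0) = u ∧ word w t (.tmp 1) = v ∧
      (Fits w s (.tmp 0) → Fits w t (.tmp 0)) ∧
      (Fits w s (.tmp 1) → Fits w t (.tmp 1)) := by
  obtain ⟨h2, h3, h4⟩ := of_seg_eq_cons h0
  obtain ⟨h5, h6, h7⟩ := of_seg_eq_cons h1
  have b1 := hs (.tmp 0 true)
  have b3 := hs (.tmp 1 true)
  simp at h2 h3 h4 h5 h6 h7
  refine ⟨_, ⟨_, sem_fwd.2 ⟨h2, rfl⟩, _, sem_fwd.2 ⟨by simpa using h5, rfl⟩, _,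
    sem_dec.2 ⟨by simpa using h3, by simpa using b1, rfl⟩, _,
    sem_dec.2 ⟨by simpa using h6, by simpa using b3, rfl⟩, sem_skip.2 rfl⟩, ?_, ?_, ?_, ?_⟩
  · simpa [word] using h4
  · simpa [word] using h7
  · simp [Fits]; omega
  · simp [Fits]; omega

/-- The loop may stop at any time, so only a common prefix is removed. The test for length zero that
follows in `matchElem` turns this prefix into the whole value of the variable. -/
theorem Sem.of_compare {s t : Store Hd F}
    (h : (star (altList ((Finset.univ : Finset α).toList.map compareLetter))).Sem w s t) :
    Keeps 0 s t ∧ ∃ v, word w s (.tmp 0) = v ++ word w t (.tmp 0) ∧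
      word w s (.tmp 1) = v ++ word w t (.tmp 1) := by
  replace h : Relation.ReflTransGen _ s t := h
  induction h with
  | refl => exact ⟨.refl _ _, [], rfl, rfl⟩
  | tail _ h ih =>
    obtain ⟨hk, v, h1, h2⟩ := ih
    rw [sem_altList] at h
    obtain ⟨p, hp, h⟩ := h
    obtain ⟨a, -, rfl⟩ := List.mem_map.1 hp
    obtain ⟨hk', h3, h4⟩ := h.of_compareLetter
    exact ⟨hk.trans hk', v ++ [a], by simp [h1, h3], by simp [h2, h4]⟩

/-- `Fits` matters for completeness: `seg` is cut off at the end of the input, so without it the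
word could be exhausted while the length head is still positive. Soundness does not need it. -/
theorem exists_sem_compare {v u : List α} {s : Store Hd F} (hs : Bdd w s)
    (h0 : word w s (.tmp 0) = v ++ u) (h1 : word w s (.tmp 1) = v)
    (hf0 : Fits w s (.tmp 0)) (hf1 : Fits w s (.tmp 1)) :
    ∃ t, (star (altList ((Finset.univ : Finset α).toList.map compareLetter))).Sem w s t ∧
      word w t (.tmp 0) = u ∧ t.2 (.tmp 1 true) = 0 ∧ Fits w t (.tmp 0) := by
  induction v generalizing s with
  | nil =>
    refine ⟨s, .refl, h0, ?_, hf0⟩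
    have := length_seg hf1
    rw [word] at h1
    rw [h1] at this
    exact this.symm
  | cons a v ih =>
    obtain ⟨m, hm, h2, h3, h4, h5⟩ := exists_sem_compareLetter hs h0 h1
    obtain ⟨t, ht, h6⟩ := ih (hm.bdd hs) h2 h3 (h4 hf0) (h5 hf1)
    refine ⟨t, .head (sem_altList.2 ⟨_, List.mem_map.2 ⟨a, by simp, rfl⟩, hm⟩) ht, h6⟩

theorem Sem.of_matchElem {r : ℕ} {e : α ⊕ Var} {s t : Store Hd F} (hs : Bdd w s)
    (h : (matchElem r e).Sem w s t) : Keeps 0 s t ∧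
      word w s (.tmp 0) = Sum.elim (fun a => [a]) (valuation w s r) e ++ word w t (.tmp 0) := by
  cases e with
  | inl a =>
    obtain ⟨s₁, h1, s₂, h2, h3⟩ := h
    obtain rfl := sem_skip.1 h3
    rw [sem_fwd] at h1
    rw [sem_dec] at h2
    obtain ⟨h1, rfl⟩ := h1
    obtain ⟨h2, -, rfl⟩ := h2
    simp at h1 h2
    refine ⟨?_, by simpa [word] using seg_eq_cons h1 h2⟩
    rintro (_ | _ | _) hi
    · simp
    · simp
    · simp [Hd.level] at hi
  | inr y =>
    obtain ⟨s₁, h1, s₂, h2, s₃, h3, s₄, h4, h5⟩ := h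
    obtain rfl := sem_skip.1 h5
    have hs₁ := h1.bdd hs
    rw [sem_copy (by simp) (by simp) (by simp) hs] at h1
    rw [sem_copy (by simp) (by simp) (by simp) hs₁] at h2
    obtain ⟨h4, rfl⟩ := sem_isZero.1 h4
    obtain ⟨hk, v, h6, h7⟩ := h3.of_compare
    have hk' : Keeps 0 s s₂ := by
      subst h1; subst h2
      rintro (_ | _ | _) hi
      · simp
      · simp
      · simp [Hd.level] at hi
    have e1 : word w s₂ (.tmp 0) = word w s (.tmp 0) := by
      subst h1; subst h2; simp [word]
    have e2 : word w s₂ (.tmp 1) = valuation w s r y := by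
      subst h1; subst h2; simp [word, valuation]
    refine ⟨hk'.trans hk, ?_⟩
    have e3 : word w t (.tmp 1) = [] := by
      simp [word, h4, seg_zero]
    rw [e3, List.append_nil, e2] at h7
    rw [← e1, h6, Sum.elim_inr, h7]

theorem exists_sem_matchElem {r : ℕ} {e : α ⊕ Var} {s : Store Hd F} {u : List α} (hs : Bdd w s)
    (h0 : word w s (.tmp 0) = Sum.elim (fun a => [a]) (valuation w s r) e ++ u)
    (hf : Fits w s (.tmp 0)) (he : ∀ y, e = .inr y → Fits w s (.var r y)) :
    ∃ t, (matchElem r e).Sem w s t ∧ word w t (.tmp 0) = u ∧ Fits w t (.tmp 0) := by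
  cases e with
  | inl a =>
    obtain ⟨h1, h2, h3⟩ := of_seg_eq_cons h0
    have b1 := hs (.tmp 0 true)
    simp at h1 h2 h3
    refine ⟨_, ⟨_, sem_fwd.2 ⟨h1, rfl⟩, _, sem_dec.2 ⟨by simpa using h2, by simpa using b1, rfl⟩,
      sem_skip.2 rfl⟩, by simpa [word] using h3, ?_⟩
    simp [Fits] at hf ⊢
    omega
  | inr y =>
    have hc1 := (sem_copy (α := α) (s := s) (i := .var r y false) (j := .tmp 1 false) (k := .tmp 2 false)
      (by simp) (by simp) (by simp) hs).2 rfl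
    have hs₁ := hc1.bdd hs
    have hc2 := (sem_copy (α := α) (i := .var r y true) (j := .tmp 1 true) (k := .tmp 2 false)
      (by simp) (by simp) (by simp) hs₁).2 rfl
    have hs₂ := hc2.bdd hs₁
    obtain ⟨t, h1, h2, h3, h4⟩ := exists_sem_compare (v := valuation w s r y) (u := u) hs₂
      (by simpa [word] using h0) (by simp [word, valuation])
      (by simpa [Fits] using hf) (by simpa [Fits] using he y rfl)
    exact ⟨t, ⟨_, hc1, _, hc2, _, h1, _, sem_isZero.2 ⟨h3, rfl⟩, sem_skip.2 rfl⟩, h2, h4⟩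

theorem Sem.of_matchElems {r : ℕ} (hr : 0 < r) {p : Pattern α} {s t : Store Hd F} (hs : Bdd w s)
    (h : (seqList (p.map (matchElem r))).Sem w s t) : Keeps 0 s t ∧
      word w s (.tmp 0) = subst (valuation w s r) p ++ word w t (.tmp 0) := by
  induction p generalizing s with
  | nil => rw [sem_seqList_nil.1 h]; exact ⟨.refl _ _, rfl⟩
  | cons e p ih =>
    obtain ⟨m, h1, h2⟩ := h
    obtain ⟨h3, h4⟩ := h1.of_matchElem hs
    obtain ⟨h5, h6⟩ := ih (h1.bdd hs) h2
    rw [h3.valuation_eq hr] at h6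
    exact ⟨h3.trans h5, by rw [h4, h6, subst, subst, List.flatMap_cons, List.append_assoc]⟩

theorem exists_sem_matchElems {r : ℕ} (hr : 0 < r) {p : Pattern α} {s : Store Hd F} (hs : Bdd w s)
    (h0 : word w s (.tmp 0) = subst (valuation w s r) p)
    (hf : Fits w s (.tmp 0)) (he : ∀ y, .inr y ∈ p → Fits w s (.var r y)) :
    ∃ t, (seqList (p.map (matchElem r))).Sem w s t ∧ t.2 (.tmp 0 true) = 0 := by
  induction p generalizing s with
  | nil =>
    refine ⟨s, sem_seqList_nil.2 rfl, ?_⟩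
    have := length_seg hf
    rw [word] at h0
    rw [h0] at this
    exact this.symm
  | cons e p ih =>
    obtain ⟨m, h1, h2, h3⟩ := exists_sem_matchElem hs h0 hf (by rintro y rfl; exact he y (by simp))
    have hk := (h1.of_matchElem hs).1
    obtain ⟨t, ht, ht'⟩ := ih (h1.bdd hs) (by rw [h2, hk.valuation_eq hr]; rfl) h3
      (fun y hy => (he y (by simp [hy])).congr fun b => hk _ hr)
    exact ⟨t, ⟨m, h1, ht⟩, ht'⟩

theorem Sem.of_matchPattern {r : ℕ} (hr : 0 < r) {f : Bool → Hd} (hf : ∀ b, 0 < (f b).level)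
    {p : Pattern α} {s t : Store Hd F} (hs : Bdd w s) (h : (matchPattern r f p).Sem w s t) :
    Keeps 0 s t ∧ word w s f = subst (valuation w s r) p := by
  have hft : ∀ b i b', f b ≠ .tmp i b' := fun b i b' e => by simpa [e, Hd.level] using hf b
  obtain ⟨s₁, h1, s₂, h2, s₃, h3, s₄, h4, h5⟩ := h
  obtain rfl := sem_skip.1 h5
  have hs₁ := h1.bdd hs
  have hs₂ := h2.bdd hs₁
  rw [sem_copy (hft _ _ _) (hft _ _ _) (by simp) hs] at h1
  rw [sem_copy (hft _ _ _) (hft _ _ _) (by simp) hs₁] at h2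
  obtain ⟨h4, rfl⟩ := sem_isZero.1 h4
  obtain ⟨hk, h6⟩ := h3.of_matchElems hr hs₂
  have hk' : Keeps 0 s s₂ := by
    subst h1; subst h2
    rintro (_ | _ | _) hi
    · simp
    · simp
    · simp [Hd.level] at hi
  have e1 : word w s₂ (.tmp 0) = word w s f := by
    subst h1; subst h2; simp [word, hft]
  have e3 : word w t (.tmp 0) = [] := by
    simp [word, h4, seg_zero]
  rw [e3, List.append_nil, e1, hk'.valuation_eq hr] at h6
  exact ⟨hk'.trans hk, h6⟩

theorem exists_sem_matchPattern {r : ℕ} (hr : 0 < r) {f : Bool → Hd}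
    (hf : ∀ b, 0 < (f b).level) {p : Pattern α} {s : Store Hd F} (hs : Bdd w s)
    (h : word w s f = subst (valuation w s r) p) (hfit : Fits w s f)
    (he : ∀ y, .inr y ∈ p → Fits w s (.var r y)) : ∃ t, (matchPattern r f p).Sem w s t := by
  have hft : ∀ b i b', f b ≠ .tmp i b' := fun b i b' e => by simpa [e, Hd.level] using hf b
  have hc1 := (sem_copy (α := α) (s := s) (i := f false) (j := .tmp 0 false) (k := .tmp 2 false)
    (hft _ _ _) (hft _ _ _) (by simp) hs).2 rfl
  have hs₁ := hc1.bdd hs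
  have hc2 := (sem_copy (α := α) (i := f true) (j := .tmp 0 true) (k := .tmp 2 false)
    (hft _ _ _) (hft _ _ _) (by simp) hs₁).2 rfl
  have hs₂ := hc2.bdd hs₁
  obtain ⟨t, h1, h2⟩ := exists_sem_matchElems hr (p := p) hs₂
    (by
      convert h using 1
      · simp [word, hft]
      · congr 1) (by simpa [Fits, hft] using hfit)
    (fun y hy => by simpa [Fits] using he y hy)
  exact ⟨t, _, hc1, _, hc2, _, h1, _, sem_isZero.2 ⟨h2, rfl⟩, sem_skip.2 rfl⟩

end Prog

end HeadProg

namespace HeadProg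

universe u

open FCDatalog

/-! ### Fixpoints of FC-Datalog programs -/

section Datalog

variable {α : Type u} (P : Program α)

theorem stage_mono (w : List α) : Monotone fun n => P.stage w n :=
  monotone_nat_of_le_succ fun _ _ => Set.subset_union_left

/-- The final content of the relations. -/
def final (w : List α) : P.Interp := fun R => ⋃ n, P.stage w n R

theorem holds_mono {Rel : Type} {ar : Rel → ℕ} {I J : (R : Rel) → Set (Fin (ar R) → List α)}
    (h : ∀ R, I R ⊆ J R) {w : List α} {θ : Var → List α} {φ : Atom α Rel ar}
    (hφ : φ.Holds I w θ) : φ.Holds J w θ := by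
  cases φ with
  | eqn x p => exact hφ
  | rel R y => exact ⟨h _ hφ.1, hφ.2⟩

theorem exists_stage_holds {w : List α} {θ : Var → List α} (l : List (Atom α P.Rel P.ar))
    (h : ∀ φ ∈ l, φ.Holds (final P w) w θ) : ∃ n, ∀ φ ∈ l, φ.Holds (P.stage w n) w θ := by
  induction l with
  | nil => exact ⟨0, by simp⟩
  | cons φ l ih =>
    obtain ⟨n, hn⟩ := ih fun ψ hψ => h ψ (by simp [hψ])
    obtain ⟨m, hm⟩ : ∃ m, φ.Holds (P.stage w m) w θ := by
      have := h φ (by simp)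
      match φ, this with
      | .eqn x p, this => exact ⟨0, this⟩
      | .rel R y, ⟨h1, h2⟩ =>
        obtain ⟨m, hm⟩ := Set.mem_iUnion.1 h1
        exact ⟨m, hm, h2⟩
    refine ⟨max n m, fun ψ hψ => ?_⟩
    rcases List.mem_cons.1 hψ with rfl | hψ
    · exact holds_mono (fun R => stage_mono P w (le_max_right n m) R) hm
    · exact holds_mono (fun R => stage_mono P w (le_max_left n m) R) (hn ψ hψ)

theorem mem_final_of_rule {w : List α} {θ : Var → List α} {ρ : Rule α P.Rel P.ar}
    (hρ : ρ ∈ P.rules) (hθ : P.IsWSubst w ρ θ) (h : ∀ φ ∈ ρ.body, φ.Holds (final P w) w θ) :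
    (fun j => θ (ρ.headVars j)) ∈ final P w ρ.head := by
  obtain ⟨n, hn⟩ := exists_stage_holds P ρ.body h
  exact Set.mem_iUnion.2 ⟨n + 1, .inr ⟨ρ, hρ, θ, hθ, hn, rfl, rfl⟩⟩

/-- The height of a relation symbol in the dependency order. -/
noncomputable def rank (R : P.Rel) : ℕ := {S | Relation.ReflTransGen P.DependsOn R S}.ncard

theorem rank_le {R S : P.Rel} (h : P.DependsOn R S) : rank P S ≤ rank P R := by
  have := P.finite_rel
  exact Set.ncard_le_ncard (fun T hT => Relation.ReflTransGen.head h hT) (Set.toFinite _)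

/-- If the sets of reachable symbols agreed, `R` would be reachable from `S`, and together with the
edge from `R` to `S` this is mutual recursion. A loop at `R = S` is already mutual recursion. -/
theorem rank_lt {R S : P.Rel} (h : P.DependsOn R S) (h' : ¬ P.MutuallyRecursive R S) :
    rank P S < rank P R := by
  have := P.finite_rel
  refine Set.ncard_lt_ncard ⟨fun T hT => Relation.ReflTransGen.head h hT, fun hsub => ?_⟩
    (Set.toFinite _)
  have h1 : Relation.ReflTransGen P.DependsOn S R := hsub .refl
  rcases Relation.reflTransGen_iff_eq_or_transGen.1 h1 with rfl | h1
  · exact h' ⟨.single h, .single h⟩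
  · exact h' ⟨.single h, h1⟩

theorem rank_le_card (R : P.Rel) : rank P R ≤ Nat.card P.Rel := by
  have := P.finite_rel
  rw [← Set.ncard_univ]
  exact Set.ncard_le_ncard (Set.subset_univ _) (Set.toFinite _)

/-- The atom carries a relation symbol that is mutually recursive with the head symbol. -/
def IsRecAtom (ρ : Rule α P.Rel P.ar) (φ : Atom α P.Rel P.ar) : Prop :=
  ∃ S, φ.HasSymbol S ∧ P.MutuallyRecursive ρ.head S

variable {P} in
theorem IsRecAtom.eq (hP : P.IsLinear) {ρ : Rule α P.Rel P.ar} (hρ : ρ ∈ P.rules)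
    {φ ψ : Atom α P.Rel P.ar} (h1 : φ ∈ ρ.body) (h2 : ψ ∈ ρ.body) (h3 : IsRecAtom P ρ φ)
    (h4 : IsRecAtom P ρ ψ) : φ = ψ := by
  obtain ⟨i, rfl⟩ := List.get_of_mem h1
  obtain ⟨j, rfl⟩ := List.get_of_mem h2
  rw [hP ρ hρ i j h3 h4]

/-- The list of the variables of an atom. -/
def atomVars {Rel : Type} {ar : Rel → ℕ} : Atom α Rel ar → List Var
  | .eqn x p => x :: p.filterMap Sum.getRight?
  | .rel _ y => List.ofFn y

theorem mem_atomVars {Rel : Type} {ar : Rel → ℕ} {φ : Atom α Rel ar} {x : Var}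
    (h : x ∈ φ.vars) : x ∈ atomVars φ := by
  cases φ with
  | eqn y p =>
    rcases h with rfl | h
    · simp [atomVars]
    · simp only [atomVars, List.mem_cons, List.mem_filterMap]
      exact .inr ⟨_, h, rfl⟩
  | rel R y => simpa [atomVars, Atom.vars, List.mem_ofFn] using h

/-- The list of the variables of a rule, with the universe variable. -/
def ruleVars (ρ : Rule α P.Rel P.ar) : List Var := P.univVar :: ρ.body.flatMap atomVars

theorem subst_congr {θ θ' : Var → List α} {p : Pattern α} (h : ∀ x, .inr x ∈ p → θ x = θ' x) :
    subst θ p = subst θ' p := by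
  induction p with
  | nil => rfl
  | cons e p ih =>
    have := ih fun x hx => h x (by simp [hx])
    simp only [subst, List.flatMap_cons] at this ⊢
    rw [this]
    congr 1
    cases e with
    | inl a => rfl
    | inr x => exact h x (by simp)

theorem holds_congr {Rel : Type} {ar : Rel → ℕ} {I : (R : Rel) → Set (Fin (ar R) → List α)}
    {w : List α} {θ θ' : Var → List α} {φ : Atom α Rel ar} (h : ∀ x ∈ φ.vars, θ x = θ' x)
    (hφ : φ.Holds I w θ) : φ.Holds I w θ' := by
  cases φ with
  | eqn x p =>
    have h1 := h x (.inl rfl)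
    have h2 : subst θ p = subst θ' p := subst_congr fun y hy => h y (.inr hy)
    rw [Atom.Holds, h1, h2] at hφ
    exact hφ
  | rel R y =>
    have h1 : ∀ j, θ (y j) = θ' (y j) := fun j => h _ ⟨j, rfl⟩
    simpa only [Atom.Holds, h1] using hφ

end Datalog

/-! ### The evaluation of rules -/

namespace Prog

variable {α : Type u} [Fintype α]

section

variable {F : Type} {w : List α}

/-- Copy the values of variables at level `r` to the arguments at level `r'`. -/
noncomputable def setArgs (r r' : ℕ) {n : ℕ} (y : Fin n → Var) : Prog α Hd F :=
  seqList ((List.finRange n).map fun j : Fin n =>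
    seqList [copy (.var r (y j) false) (.arg r' j false) (.tmp 0 false),
      copy (.var r (y j) true) (.arg r' j true) (.tmp 0 false)])

theorem Sem.of_copyPair {f g : Bool → Hd} (hf : ∀ b i b', f b ≠ .tmp i b')
    (hg : ∀ b i b', g b ≠ .tmp i b') (hfg : ∀ b b', f b ≠ g b') (hg' : g true ≠ g false)
    {s t : Store Hd F} (hs : Bdd w s)
    (h : (seqList [copy (f false) (g false) (.tmp 0 false), copy (f true) (g true) (.tmp 0 false)] :
      Prog α Hd F).Sem w s t) :
    (∀ b, t.2 (g b) = s.2 (f b)) ∧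
      ∀ i, (∀ b, i ≠ g b) → i ≠ .tmp 0 false → t.2 i = s.2 i := by
  obtain ⟨m, h1, t', h2, h3⟩ := h
  obtain rfl := sem_skip.1 h3
  have hm := h1.bdd hs
  rw [sem_copy (hfg _ _) (hf _ _ _) (hg _ _ _) hs] at h1
  rw [sem_copy (hfg _ _) (hf _ _ _) (hg _ _ _) hm] at h2
  subst h1
  subst h2
  constructor
  · rintro (_ | _)
    · simp [hg, hg'.symm]
    · simp [hg, hf, hfg]
  · intro i hi hi'
    simp [hi, hi']

theorem exists_sem_copyPair {f g : Bool → Hd} (hf : ∀ b i b', f b ≠ .tmp i b')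
    (hg : ∀ b i b', g b ≠ .tmp i b') (hfg : ∀ b b', f b ≠ g b') {s : Store Hd F} (hs : Bdd w s) :
    ∃ t, (seqList [copy (f false) (g false) (.tmp 0 false),
      copy (f true) (g true) (.tmp 0 false)] : Prog α Hd F).Sem w s t := by
  have h1 := (sem_copy (α := α) (hfg false false) (hf _ 0 false) (hg _ _ _) hs).2 rfl
  exact ⟨_, _, h1, _, (sem_copy (hfg _ _) (hf _ _ _) (hg _ _ _) (h1.bdd hs)).2 rfl, sem_skip.2 rfl⟩

theorem Sem.of_setArgs {r r' n : ℕ} {y : Fin n → Var} {s t : Store Hd F} (hs : Bdd w s)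
    (h : (setArgs r r' y : Prog α Hd F).Sem w s t) :
    (∀ (j : Fin n) b, t.2 (.arg r' j b) = s.2 (.var r (y j) b)) ∧
      ∀ i, (∀ (j : Fin n) b, i ≠ .arg r' j b) → i ≠ .tmp 0 false → t.2 i = s.2 i := by
  have key : ∀ l : List (Fin n), ∀ s : Store Hd F, Bdd w s → (seqList (l.map fun j : Fin n =>
      seqList [copy (.var r (y j) false) (.arg r' j false) (.tmp 0 false),
        copy (.var r (y j) true) (.arg r' j true) (.tmp 0 false)]) : Prog α Hd F).Sem w s t →
      (∀ j ∈ l, ∀ b, t.2 (.arg r' j b) = s.2 (.var r (y j) b)) ∧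
      ∀ i, (∀ j ∈ l, ∀ b, i ≠ .arg r' j b) → i ≠ .tmp 0 false → t.2 i = s.2 i := by
    intro l
    induction l with
    | nil => intro s _ h; rw [sem_seqList_nil.1 h]; simp
    | cons j l ih =>
      rintro s hs ⟨m, h1, h2⟩
      obtain ⟨h3, h4⟩ := ih m (h1.bdd hs) h2
      obtain ⟨h5, h6⟩ := h1.of_copyPair (f := .var r (y j)) (g := .arg r' j) (by simp) (by simp)
        (by simp) (by simp) hs
      constructor
      · intro j' hj' b
        by_cases hl : j' ∈ l
        · rw [h3 j' hl, h6 _ (by simp) (by simp)]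
        · obtain rfl : j' = j := by simpa [hl] using hj'
          rw [h4 _ _ (by simp), h5]
          intro k hk b' e
          have : j' = k := by simpa [Fin.ext_iff] using (Hd.arg.inj e).2.1
          exact hl (this ▸ hk)
      · intro i hi hi'
        rw [h4 i (fun k hk => hi k (by simp [hk])) hi', h6 i (hi j (by simp)) hi']
  obtain ⟨h1, h2⟩ := key _ s hs h
  exact ⟨fun j => h1 j (by simp), fun i hi => h2 i fun j _ => hi j⟩

theorem exists_sem_setArgs (r r' : ℕ) {n : ℕ} (y : Fin n → Var) {s : Store Hd F} (hs : Bdd w s) :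
    ∃ t, (setArgs r r' y : Prog α Hd F).Sem w s t := by
  rw [setArgs]
  generalize List.finRange n = l
  induction l generalizing s with
  | nil => exact ⟨s, sem_seqList_nil.2 rfl⟩
  | cons j l ih =>
    obtain ⟨m, hm⟩ := exists_sem_copyPair (α := α) (f := .var r (y j)) (g := .arg r' j) (by simp)
      (by simp) (by simp) hs
    obtain ⟨t, ht⟩ := ih (hm.bdd hs)
    exact ⟨t, m, hm, ht⟩

theorem Sem.keeps_of_setArgs {r r' n : ℕ} {y : Fin n → Var} {s t : Store Hd F} (hs : Bdd w s)
    (h : (setArgs r r' y : Prog α Hd F).Sem w s t) : Keeps r' s t := by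
  intro i hi
  refine (h.of_setArgs hs).2 i ?_ ?_
  · rintro j b rfl
    simp [Hd.level] at hi
  · rintro rfl
    simp [Hd.level] at hi

/-- Guess the values of variables at level `r`. -/
noncomputable def guessVars (r : ℕ) (l : List Var) : Prog α Hd F :=
  seqList (l.map fun x => seq (guess (.var r x false)) (guess (.var r x true)))

theorem Sem.of_guessVars {r : ℕ} {l : List Var} {s t : Store Hd F}
    (h : (guessVars r l : Prog α Hd F).Sem w s t) :
    t.1 = s.1 ∧ ∀ i, (∀ x b, i ≠ .var r x b) → t.2 i = s.2 i := by
  induction l generalizing s with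
  | nil => rw [sem_seqList_nil.1 h]; simp
  | cons x l ih =>
    obtain ⟨m, ⟨m', h1, h2⟩, h3⟩ := h
    obtain ⟨h4, h5⟩ := ih h3
    obtain ⟨h6, h7⟩ := h1.of_guess
    obtain ⟨h8, h9⟩ := h2.of_guess
    refine ⟨by rw [h4, h8, h6], fun i hi => ?_⟩
    rw [h5 i hi, h9 i (hi _ _), h7 i (hi _ _)]

theorem exists_sem_guessVars (r : ℕ) (l : List Var) {s : Store Hd F} (hs : Bdd w s)
    {g : Var → Bool → ℕ} (hg : ∀ x b, g x b ≤ w.length) :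
    ∃ t, (guessVars r l : Prog α Hd F).Sem w s t ∧ (∀ x ∈ l, ∀ b, t.2 (.var r x b) = g x b) ∧
      ∀ x ∉ l, ∀ b, t.2 (.var r x b) = s.2 (.var r x b) := by
  induction l generalizing s with
  | nil => exact ⟨s, sem_seqList_nil.2 rfl, by simp⟩
  | cons x l ih =>
    have h1 := sem_guess (α := α) (F := F) (i := .var r x false) (hs _) (hg x false)
    have h2 := sem_guess (α := α) (F := F) (i := .var r x true) (h1.bdd hs _) (hg x true)
    obtain ⟨t, h3, h4, h5⟩ := ih (h2.bdd (h1.bdd hs))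
    refine ⟨t, ⟨_, ⟨_, h1, h2⟩, h3⟩, fun y hy b => ?_, fun y hy b => ?_⟩
    · by_cases hyl : y ∈ l
      · exact h4 y hyl b
      · obtain rfl : y = x := by simpa [hyl] using hy
        rw [h5 y hyl]
        cases b <;> simp
    · simp only [List.mem_cons, not_or] at hy
      rw [h5 y hy.2]
      simp [hy.1]

end

-- Top-down evaluation of linear programs.

variable (P : Program α) {w : List α}

/-- The modes of the evaluation of a program: the relation symbol that is to be derived, or `none`
when nothing is left to be done. -/
abbrev Mode := Option P.Rel

/-- Evaluate an atom under the valuation at level `r + 1`. -/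
noncomputable def evalAtom (chk : Prog α Hd (Mode P)) (r : ℕ) :
    Atom α P.Rel P.ar → Prog α Hd (Mode P)
  | .eqn x p => matchPattern (r + 1) (.var (r + 1) x) p
  | .rel R y => seqList [setArgs (r + 1) r y, act (.set (some R)), chk]

/-- Go on with the recursive atom of a rule. -/
noncomputable def proceed (r : ℕ) : Option (Atom α P.Rel P.ar) → Prog α Hd (Mode P)
  | some (.rel R y) => seqList [setArgs (r + 1) (r + 1) y, act (.set (some R))]
  | _ => act (.set none)

open scoped Classical in
/-- The recursive atom of a rule of a linear program. -/
noncomputable def recAtom (ρ : Rule α P.Rel P.ar) : Option (Atom α P.Rel P.ar) :=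
  ρ.body.find? fun φ => decide (IsRecAtom P ρ φ)

open scoped Classical in
/-- Apply a rule backwards to the arguments at level `r + 1`. -/
noncomputable def evalRule (chk : Prog α Hd (Mode P)) (r : ℕ) (ρ : Rule α P.Rel P.ar) :
    Prog α Hd (Mode P) :=
  seqList [act (.test (some ρ.head)), guessVars (r + 1) (ruleVars P ρ),
    isZero (.var (r + 1) P.univVar false), act (.head (.var (r + 1) P.univVar true) .last),
    seqList ((List.finRange (P.ar ρ.head)).map fun j : Fin (P.ar ρ.head) =>
      matchPattern (r + 1) (.arg (r + 1) j) [.inr (ρ.headVars j)]),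
    seqList (ρ.body.map fun φ => if IsRecAtom P ρ φ then skip else evalAtom P chk r φ),
    proceed P r (recAtom P ρ)]

/-- Derive the relation symbol that is given by the mode, for the arguments at level `r`. -/
noncomputable def eval : ℕ → Prog α Hd (Mode P)
  | 0 => fail
  | r + 1 => seq (star (altList (P.finite_rules.toFinset.toList.map (evalRule P (eval r) r))))
      (act (.test none))

/-- What is left to be derived is true. -/
def Goal (w : List α) (r : ℕ) (s : Store Hd (Mode P)) : Prop :=
  match s.1 with
  | none => True
  | some R => (fun j : Fin (P.ar R) => word w s (.arg r j)) ∈ final P w R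

variable {P}

theorem Sem.of_evalAtom {chk : Prog α Hd (Mode P)} {r : ℕ}
    (hchk : ∀ s t, Bdd w s → chk.Sem w s t → Keeps r s t ∧ Goal P w r s) {φ : Atom α P.Rel P.ar}
    {s t : Store Hd (Mode P)} (hs : Bdd w s) (h : (evalAtom P chk r φ).Sem w s t) :
    Keeps r s t ∧ φ.Holds (final P w) w (valuation w s (r + 1)) := by
  match φ, h with
  | .eqn x p, h =>
    obtain ⟨h1, h2⟩ := h.of_matchPattern (f := .var (r + 1) x) (Nat.succ_pos r) (fun b => Nat.succ_pos r) hs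
    exact ⟨h1.mono (Nat.zero_le r), h2, seg_infix, h2 ▸ seg_infix⟩
  | .rel R y, ⟨s₁, h1, s₂, h2, t', h3, h4⟩ =>
    obtain rfl := sem_skip.1 h4
    have hk1 := h1.keeps_of_setArgs hs
    have hs₁ := h1.bdd hs
    rw [sem_set] at h2
    subst h2
    obtain ⟨h5, h6⟩ := hchk (some R, s₁.2) t hs₁ h3
    refine ⟨hk1.trans h5, ?_, fun j => seg_infix⟩
    have h7 : (fun j : Fin (P.ar R) => word w s₁ (.arg r j)) ∈ final P w R := h6
    convert h7 using 1
    funext j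
    simp only [valuation, word, (h1.of_setArgs hs).1]

/-- The subroutine leaves the heads at level `r + 1` alone, so the guessed valuation survives the
checks of all nonrecursive atoms. By linearity the one atom found by `recAtom` is all that remains
to be derived; it becomes the new goal, and if it is true then the rule yields the old one. -/
theorem Sem.of_evalRule (hP : P.IsLinear) {chk : Prog α Hd (Mode P)} {r : ℕ}
    (hchk : ∀ s t, Bdd w s → chk.Sem w s t → Keeps r s t ∧ Goal P w r s) {ρ : Rule α P.Rel P.ar}
    (hρ : ρ ∈ P.rules) {s t : Store Hd (Mode P)} (hs : Bdd w s)
    (h : (evalRule P chk r ρ).Sem w s t) :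
    Keeps (r + 1) s t ∧ (Goal P w (r + 1) t → Goal P w (r + 1) s) := by
  classical
  obtain ⟨s₀, h0, s₁, h1, s₂, h2, s₃, h3, s₄, h4, s₅, h5, t', h6, h7⟩ := h
  obtain rfl := sem_skip.1 h7
  rw [sem_test] at h0
  rw [sem_isZero] at h2
  rw [sem_isLast] at h3
  obtain ⟨hmode, rfl⟩ := h0
  obtain ⟨hz, rfl⟩ := h2
  obtain ⟨hl, rfl⟩ := h3
  have hs₃ := h1.bdd hs
  obtain ⟨-, hg⟩ := h1.of_guessVars
  have hk1 : Keeps (r + 1) s₀ s₃ := by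
    intro i hi
    refine hg i ?_
    rintro x b rfl
    simp [Hd.level] at hi
  set θ := valuation w s₃ (r + 1) with hθ
  obtain ⟨hk4, h4⟩ := Sem.of_seqList_map (r := 0)
    (Q := fun (j : Fin (P.ar ρ.head)) s => word w s (.arg (r + 1) j) =
      valuation w s (r + 1) (ρ.headVars j))
    (fun j _ s t hs h => by
      have := h.of_matchPattern (f := .arg (r + 1) j) (Nat.succ_pos r) (fun b => Nat.succ_pos r) hs
      simpa [subst] using this)
    (fun j s t hk hq => by
      rwa [hk.valuation_eq (Nat.succ_pos r),
        word_congr (f := .arg (r + 1) j) fun b => hk _ (Nat.succ_pos r)] at hq) hs₃ h4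
  have hs₄ : Bdd w s₄ := Sem.bdd ‹_› hs₃
  obtain ⟨hk5, h5⟩ := Sem.of_seqList_map (r := r)
    (Q := fun φ s => ¬ IsRecAtom P ρ φ → φ.Holds (final P w) w (valuation w s (r + 1)))
    (fun φ _ s t hs h => by
      by_cases hφ : IsRecAtom P ρ φ
      · rw [if_pos hφ, sem_skip] at h
        subst h
        exact ⟨.refl _ _, fun h => absurd hφ h⟩
      · rw [if_neg hφ] at h
        have := h.of_evalAtom hchk hs
        exact ⟨this.1, fun _ => this.2⟩)
    (fun φ s t hk hq h => by
      have := hq h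
      rwa [hk.valuation_eq (Nat.lt_succ_self r)] at this) hs₄ h5
  have hs₅ : Bdd w s₅ := Sem.bdd ‹_› hs₄
  rw [hk4.valuation_eq (Nat.succ_pos r), ← hθ] at h5
  have hθ₅ : valuation w s₅ (r + 1) = θ := by
    rw [hk5.valuation_eq (Nat.lt_succ_self r), hk4.valuation_eq (Nat.succ_pos r)]
  have hk5' := hk1.trans ((hk4.mono (Nat.zero_le _)).trans (hk5.mono (Nat.le_succ r)))
  have hgoal : (∀ φ ∈ ρ.body, IsRecAtom P ρ φ → φ.Holds (final P w) w θ) →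
      Goal P w (r + 1) s₀ := by
    intro hrec
    have h8 := mem_final_of_rule P (w := w) (θ := θ) hρ ⟨?_, fun _ _ _ _ => seg_infix⟩
      (fun φ hφ => if h : IsRecAtom P ρ φ then hrec φ hφ h else h5 φ hφ h)
    · rw [Goal, hmode]
      convert h8 using 1
      funext j
      rw [hθ, ← h4 j (by simp)]
      exact (word_congr fun b => hg _ (by simp)).symm
    · rw [hθ, valuation, word, hz, hl, seg_univ]
  match hr : recAtom P ρ, h6 with
  | none, h6 =>
    replace h6 : t = (none, s₅.2) := h6
    refine ⟨hk5'.trans (by subst h6; exact .refl _ _), fun _ => hgoal fun φ hφ h => ?_⟩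
    exact absurd h (by simpa using List.find?_eq_none.1 hr φ hφ)
  | some (.eqn x p), h6 =>
    have h9 := List.find?_some hr
    simp [IsRecAtom, Atom.HasSymbol] at h9
  | some (.rel R y), ⟨s₆, h6', t', h7', h8⟩ =>
    obtain rfl := sem_skip.1 h8
    rw [sem_set] at h7'
    subst h7'
    have hk6 : Keeps (r + 1) s₅ s₆ := h6'.keeps_of_setArgs hs₅
    refine ⟨(hk5'.trans hk6 : Keeps (r + 1) s₀ s₆), fun hG => hgoal fun φ hφ h => ?_⟩
    obtain rfl := h.eq hP hρ hφ (List.mem_of_find?_eq_some hr) (by simpa using List.find?_some hr)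
    refine ⟨?_, fun j => seg_infix⟩
    have hG' : (fun j : Fin (P.ar R) => word w s₆ (.arg (r + 1) j)) ∈ final P w R := hG
    convert hG' using 1
    funext j
    rw [← hθ₅]
    simp only [valuation, word, (h6'.of_setArgs hs₅).1]

/-- Within a level, truth of the goal is carried backwards along the loop, starting from the last
iteration, where the mode `none` leaves nothing to derive. -/
theorem Sem.of_eval (hP : P.IsLinear) {r : ℕ} {s t : Store Hd (Mode P)} (hs : Bdd w s)
    (h : (eval P r).Sem w s t) : Keeps r s t ∧ Goal P w r s := by
  induction r generalizing s t with
  | zero => exact h.elim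
  | succ r ih =>
    obtain ⟨t', h, ht⟩ := h
    rw [sem_test] at ht
    obtain ⟨ht, rfl⟩ := ht
    replace h : Relation.ReflTransGen _ s t := h
    induction h using Relation.ReflTransGen.head_induction_on with
    | refl => exact ⟨.refl _ _, by rw [Goal, ht]; trivial⟩
    | head h _ ih' =>
      rw [sem_altList] at h
      obtain ⟨p, hp, h⟩ := h
      obtain ⟨ρ, hρ, rfl⟩ := List.mem_map.1 hp
      obtain ⟨h1, h2⟩ := h.of_evalRule hP (fun s t hs h => ih hs h) (by simpa using hρ) hs
      obtain ⟨h3, h4⟩ := ih' (h.bdd hs)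
      exact ⟨h1.trans h3, h2 h4⟩

theorem exists_sem_evalAtom {chk : Prog α Hd (Mode P)} {r m : ℕ} {φ : Atom α P.Rel P.ar}
    (hchk : ∀ R y, φ = .rel R y → ∀ s, Bdd w s → s.1 = some R →
      (∀ j : Fin (P.ar R), Fits w s (.arg r j)) →
      (fun j : Fin (P.ar R) => word w s (.arg r j)) ∈ P.stage w m R → ∃ t, chk.Sem w s t)
    {s : Store Hd (Mode P)} (hs : Bdd w s) (hfit : ∀ x ∈ φ.vars, Fits w s (.var (r + 1) x))
    (hφ : φ.Holds (P.stage w m) w (valuation w s (r + 1))) :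
    ∃ t, (evalAtom P chk r φ).Sem w s t := by
  match φ, hφ, hchk, hfit with
  | .eqn x p, hφ, _, hfit =>
    exact exists_sem_matchPattern (Nat.succ_pos r) (f := .var (r + 1) x) (fun b => Nat.succ_pos r)
      hs hφ.1 (hfit x (.inl rfl)) fun y hy => hfit y (.inr hy)
  | .rel R y, hφ, hchk, hfit =>
    obtain ⟨s₁, h1⟩ := exists_sem_setArgs (α := α) (r + 1) r y hs
    have h2 := h1.of_setArgs hs
    have hw : ∀ j : Fin (P.ar R), word w s₁ (.arg r j) = valuation w s (r + 1) (y j) := fun j => by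
      simp only [valuation, word, h2.1]
    obtain ⟨t, ht⟩ := hchk R y rfl (some R, s₁.2) (h1.bdd hs) rfl
      (fun j => by simpa only [Fits, h2.1] using hfit (y j) ⟨j, rfl⟩)
      (by
        convert hφ.1 using 1
        exact funext hw)
    exact ⟨t, s₁, h1, _, rfl, t, ht, sem_skip.2 rfl⟩

/-- A double induction. A nonrecursive atom of the applied rule has smaller rank and is left to the
next lower level. The recursive atom may have the same rank but was derived at an earlier stage, so
the next round of the same loop handles it. -/
theorem exists_sem_eval (hP : P.IsLinear) (r : ℕ) : ∀ (m : ℕ) (R : P.Rel), rank P R < r →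
    ∀ s : Store Hd (Mode P), Bdd w s → s.1 = some R →
      (∀ j : Fin (P.ar R), Fits w s (.arg r j)) →
      (fun j : Fin (P.ar R) => word w s (.arg r j)) ∈ P.stage w m R →
      ∃ t, (eval P r).Sem w s t := by
  classical
  induction r with
  | zero => intro m R h; omega
  | succ r ih =>
    intro m
    induction m with
    | zero => intro R _ s _ _ _ h; exact h.elim
    | succ m ihm =>
      rintro R hR s hs hmode hfit (h | ⟨ρ, hρ, θ, hθ, hb, rfl, ht⟩)
      · exact ihm R hR s hs hmode hfit h
      -- A substitution is unconstrained on variables outside the rule, where its values need not be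
      -- factors; such variables get the positions `0`.
      have hg : ∀ x, ∃ g : Bool → ℕ, g false + g true ≤ w.length ∧
          (θ x <:+: w → seg w (g false) (g true) = θ x) := by
        intro x
        by_cases hx : θ x <:+: w
        · obtain ⟨p, l, h1, h2⟩ := exists_seg_eq hx
          exact ⟨fun b => if b then l else p, by simpa using h1, fun _ => by simpa using h2⟩
        · exact ⟨fun _ => 0, by simp, fun h => absurd h hx⟩
      choose g hg1 hg2 using hg
      obtain ⟨s₁, h1, h2, -⟩ := exists_sem_guessVars (α := α) (r + 1) (ruleVars P ρ) hs (g := g)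
        (fun x b => by have := hg1 x; cases b <;> omega)
      have hs₁ := h1.bdd hs
      have hkeep := h1.of_guessVars.2
      have hval : ∀ x ∈ ruleVars P ρ, θ x <:+: w → valuation w s₁ (r + 1) x = θ x := by
        intro x hx hθx
        simp only [valuation, word, h2 x hx, hg2 x hθx]
      have hmem : ∀ φ ∈ ρ.body, ∀ x ∈ φ.vars, x ∈ ruleVars P ρ := fun φ hφ x hx =>
        List.mem_cons_of_mem _ (List.mem_flatMap.2 ⟨φ, hφ, mem_atomVars hx⟩)
      have hvar : ∀ φ ∈ ρ.body, ∀ x ∈ φ.vars,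
          valuation w s₁ (r + 1) x = θ x ∧ Fits w s₁ (.var (r + 1) x) := by
        intro φ hφ x hx
        refine ⟨hval x (hmem φ hφ x hx) (hθ.2 φ hφ x hx), ?_⟩
        simp only [Fits, h2 x (hmem φ hφ x hx)]
        exact hg1 x
      -- The only pair of heads that represents the whole input consists of position `0` and length
      -- `w.length`, so the two tests on the universe variable succeed.
      have hu1 := hg2 P.univVar (by rw [hθ.1])
      have hu2 : g P.univVar true = w.length := by
        have := length_seg (hg1 P.univVar)
        rw [hu1, hθ.1] at this
        exact this.symm
      have hu3 : g P.univVar false = 0 := by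
        have := hg1 P.univVar
        omega
      have hu : P.univVar ∈ ruleVars P ρ := List.mem_cons_self
      obtain ⟨s₄, h4⟩ := exists_sem_seqList_map (α := α) (w := w) (r := 0) (s₀ := s₁) (s := s₁)
        (f := fun j : Fin (P.ar ρ.head) =>
          matchPattern (r + 1) (.arg (r + 1) j) [.inr (ρ.headVars j)])
        (l := List.finRange (P.ar ρ.head))
        (fun j _ s t hs h => (h.of_matchPattern (f := .arg (r + 1) j) (Nat.succ_pos r)
          (fun b => Nat.succ_pos r) hs).1)
        (fun j _ s' hs' hk => by
          obtain ⟨φ, hφ, hx⟩ := ρ.safe j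
          have hv := hvar φ hφ _ hx
          have hj : ∀ b, s'.2 (.arg (r + 1) j b) = s.2 (.arg (r + 1) j b) := fun b => by
            rw [hk (.arg (r + 1) j b) (Nat.succ_pos r), hkeep (.arg (r + 1) j b) (by simp)]
          refine exists_sem_matchPattern (f := .arg (r + 1) j) (Nat.succ_pos r)
            (fun b => Nat.succ_pos r) hs' ?_ ((hfit j).congr hj) ?_
          · rw [word_congr hj, hk.valuation_eq (Nat.succ_pos r), congrFun ht j]
            simp [subst, hv.1]
          · intro y hy
            obtain rfl : y = ρ.headVars j := by simpa using hy
            exact hv.2.congr fun b => hk _ (Nat.succ_pos r))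
        hs₁ (.refl _ _)
      have hs₄ := h4.bdd hs₁
      have hk4 : Keeps r s₁ s₄ := (Sem.of_seqList_map (r := 0) (Q := fun _ _ => True)
        (fun (j : Fin (P.ar ρ.head)) _ s t hs h => ⟨(h.of_matchPattern (f := .arg (r + 1) j) (Nat.succ_pos r)
          (fun b => Nat.succ_pos r) hs).1, trivial⟩) (fun _ _ _ _ _ => trivial) hs₁ h4).1.mono
          (Nat.zero_le r)
      have hkb : ∀ φ ∈ ρ.body, ∀ s t, Bdd w s →
          (if IsRecAtom P ρ φ then skip else evalAtom P (eval P r) r φ).Sem w s t →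
          Keeps r s t := by
        intro φ _ s t hs h
        by_cases hφ : IsRecAtom P ρ φ
        · rw [if_pos hφ, sem_skip] at h
          subst h
          exact .refl _ _
        · rw [if_neg hφ] at h
          exact (h.of_evalAtom (fun s t hs h => h.of_eval hP hs) hs).1
      obtain ⟨s₅, h5⟩ := exists_sem_seqList_map (α := α) (w := w) (r := r) (s₀ := s₁) (s := s₄)
        (f := fun φ => if IsRecAtom P ρ φ then skip else evalAtom P (eval P r) r φ)
        (l := ρ.body) hkb
        (fun φ hφ s' hs' hk => by
          by_cases hrec : IsRecAtom P ρ φ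
          · exact ⟨s', by rw [if_pos hrec, sem_skip]⟩
          · rw [if_neg hrec]
            refine exists_sem_evalAtom (m := m) ?_ hs'
              (fun x hx => (hvar φ hφ x hx).2.congr fun b => hk _ (Nat.lt_succ_self r)) ?_
            · rintro R y rfl
              refine ih m R ?_
              have hdep : P.DependsOn ρ.head R := ⟨ρ, hρ, rfl, _, hφ, rfl⟩
              have := rank_lt P hdep fun h => hrec ⟨R, rfl, h⟩
              omega
            · rw [hk.valuation_eq (Nat.lt_succ_self r)]
              exact holds_congr (fun x hx => (hvar φ hφ x hx).1.symm) (hb φ hφ))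
        hs₄ hk4
      have hs₅ := h5.bdd hs₄
      have hk5 : Keeps r s₁ s₅ := hk4.trans (Sem.of_seqList_map (r := r) (Q := fun _ _ => True)
        (fun φ hφ s t hs h => ⟨hkb φ hφ s t hs h, trivial⟩) (fun _ _ _ _ _ => trivial) hs₄ h5).1
      have hproc : ∃ s₆ t, (proceed P r (recAtom P ρ)).Sem w s₅ s₆ ∧
          (eval P (r + 1)).Sem w s₆ t := by
        match hrec : recAtom P ρ with
        | none => exact ⟨(none, s₅.2), (none, s₅.2), rfl, _, .refl, rfl, rfl⟩
        | some (.eqn x p) => exact ⟨(none, s₅.2), (none, s₅.2), rfl, _, .refl, rfl, rfl⟩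
        | some (.rel R y) =>
          have hbody := List.mem_of_find?_eq_some hrec
          have hdep : P.DependsOn ρ.head R := ⟨ρ, hρ, rfl, _, hbody, rfl⟩
          obtain ⟨s₆, h6⟩ := exists_sem_setArgs (α := α) (r + 1) (r + 1) y hs₅
          have h7 := (h6.of_setArgs hs₅).1
          have h8 : ∀ (j : Fin (P.ar R)) b, s₆.2 (.arg (r + 1) j b) = s₁.2 (.var (r + 1) (y j) b) :=
            fun j b => (h7 j b).trans (hk5 _ (Nat.lt_succ_self r))
          obtain ⟨t, ht⟩ := ihm R ((rank_le P hdep).trans_lt hR) (some R, s₆.2) (h6.bdd hs₅) rfl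
            (fun j => by
              simpa only [Fits, h8] using (hvar _ hbody (y j) ⟨j, rfl⟩).2)
            (by
              convert (hb _ hbody).1 using 1
              funext j
              rw [← (hvar _ hbody (y j) ⟨j, rfl⟩).1]
              simp only [valuation, word, h8])
          exact ⟨(some R, s₆.2), t, ⟨s₆, h6, _, rfl, sem_skip.2 rfl⟩, ht⟩
      obtain ⟨s₆, t, h6, t', h7, h8⟩ := hproc
      refine ⟨t, t', .head (sem_altList.2 ⟨_, List.mem_map.2 ⟨ρ, by simpa using hρ, rfl⟩, ?_⟩) h7, h8⟩
      exact ⟨s, ⟨hmode, rfl⟩, s₁, h1, s₁, sem_isZero.2 ⟨by rw [h2 _ hu, hu3], rfl⟩, s₁,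
        sem_isLast.2 ⟨by rw [h2 _ hu, hu2], rfl⟩, s₄, h4, s₅, h5, s₆, h6, sem_skip.2 rfl⟩

/-- The level `Nat.card P.Rel + 1` exceeds every rank. In the initial store all heads are at zero;
the output symbol has no arguments, so they represent nothing. -/
theorem language_eval (hP : P.IsLinear) (hB : P.IsBoolean) :
    (eval P (Nat.card P.Rel + 1)).language (some P.ans) = P.language := by
  have hB' : P.ar P.ans = 0 := hB
  have hsub : ∀ t t' : Fin (P.ar P.ans) → List α, t = t' := fun t t' =>
    funext fun j => (Fin.cast hB' j).elim0
  ext w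
  constructor
  · rintro ⟨t, ht⟩
    exact ⟨_, (ht.of_eval hP fun _ => Nat.zero_le _).2⟩
  · rintro ⟨t, ht⟩
    obtain ⟨m, hm⟩ := Set.mem_iUnion.1 ht
    refine exists_sem_eval hP _ m P.ans (Nat.lt_succ_of_le (rank_le_card P _)) _
      (fun _ => Nat.zero_le _) rfl (fun j => (Fin.cast hB' j).elim0) ?_
    convert hm using 1
    exact hsub _ _

end Prog

open Prog in
/-- The languages of linear FC-Datalog programs are recognized in nondeterministic logarithmic
space. -/
theorem language_mem_NLOGSPACE_of_isLinear {α : Type u} [Finite α] {P : Program α}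
    (hP : P.IsLinear) (hB : P.IsBoolean) : P.language ∈ NSpace.NLOGSPACE α := by
  have := Fintype.ofFinite α
  have := P.finite_rel
  obtain ⟨A, hA⟩ := exists_headNFA (eval P (Nat.card P.Rel + 1)) (some P.ans)
  rw [← language_eval hP hB, ← hA]
  exact A.language_mem_NLOGSPACE

end HeadProg

/-! ## From nondeterministic logarithmic space to programs -/

namespace HeadProg

universe u

open NSpace

namespace Prog

variable {α : Type u} {ι F : Type} [DecidableEq ι] [Fintype α] {w : List α}

theorem sem_drain_iff {a : ℕ} {i : ι} {l : List ι} (hil : i ∉ l) {s t : Store ι F}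
    (hs : ∀ j, s.2 j ≤ w.length) : (drain a i l : Prog α ι F).Sem w s t ↔
      ∃ m, s.2 i = a * m ∧ (∀ j ∈ l, s.2 j + m * l.count j ≤ w.length) ∧
        t = (s.1, fun j => if j = i then 0 else s.2 j + m * l.count j) := by
  constructor
  · intro h
    obtain ⟨m, h1, rfl⟩ := h.of_drain hil
    refine ⟨m, h1, fun j hj => ?_, rfl⟩
    have := h.le hs j
    have hji : j ≠ i := fun e => hil (e ▸ hj)
    simpa [hji] using this
  · rintro ⟨m, h1, h2, rfl⟩
    exact sem_drain hil h1 (hs i) h2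

theorem sem_incs_iff {l : List ι} {s t : Store ι F} (hs : ∀ j, s.2 j ≤ w.length) :
    (incs l : Prog α ι F).Sem w s t ↔ (∀ i ∈ l, s.2 i + l.count i ≤ w.length) ∧
      t = (s.1, fun i => s.2 i + l.count i) := by
  constructor
  · intro h
    obtain ⟨h1, h2⟩ := h.of_incs
    exact ⟨fun i _ => h2 i ▸ h.le hs i, Prod.ext h1 (funext h2)⟩
  · rintro ⟨h, rfl⟩
    exact sem_incs h

end Prog

/-! ### Stacks -/

section Stacks

variable {Γ : Type} [Finite Γ]

variable (Γ) in
/-- The base of the representation of stacks. -/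
noncomputable def base : ℕ := Nat.card Γ + 1

/-- Symbols as nonzero digits. -/
noncomputable def dig (a : Γ) : ℕ := Finite.equivFin Γ a + 1

theorem dig_inj {a b : Γ} : dig a = dig b ↔ a = b := by
  simp [dig, Fin.val_inj]

theorem dig_lt (a : Γ) : dig a < base Γ := by
  simp [dig, base]

theorem dig_pos (a : Γ) : 0 < dig a := Nat.succ_pos _

/-- The representation of a stack by the numbers in `k + 1` registers: the symbols are distributed
cyclically. -/
noncomputable def rep (k : ℕ) : List Γ → ℕ → ℕ
  | [], _ => 0
  | a :: l, 0 => base Γ * rep k l k + dig a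
  | _ :: l, r + 1 => if r < k then rep k l r else 0

/-- In particular register `k + 1` is empty between stack operations and can serve as scratch space.
-/
theorem rep_of_lt {k r : ℕ} (h : k < r) (l : List Γ) : rep k l r = 0 := by
  match l, r with
  | [], _ => rfl
  | _ :: l, r + 1 => exact if_neg (by omega)

/-- The exponent is the number of symbols dealt to register `r`: those whose distance from the top
is congruent to `r` modulo `k + 1`. -/
theorem rep_lt {k r : ℕ} (hr : r ≤ k) (l : List Γ) :
    rep k l r < base Γ ^ ((l.length + k - r) / (k + 1)) := by
  have hB : 0 < base Γ := Nat.succ_pos _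
  induction l generalizing r with
  | nil => exact Nat.pow_pos hB
  | cons a l ih =>
    match r with
    | 0 =>
      have h1 := ih le_rfl
      have h2 := dig_lt a
      rw [Nat.add_sub_cancel] at h1
      have h3 : ((a :: l).length + k - 0) / (k + 1) = l.length / (k + 1) + 1 := by
        rw [← Nat.add_div_right _ (Nat.succ_pos k)]
        congr 1
        simp
        omega
      rw [h3, pow_succ, rep, mul_comm (_ ^ _)]
      calc base Γ * rep k l k + dig a < base Γ * (rep k l k + 1) := by rw [mul_add]; omega
        _ ≤ _ := Nat.mul_le_mul_left _ h1
    | r + 1 =>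
      rw [rep, if_pos (by omega)]
      convert ih (r := r) (by omega) using 3
      simp
      omega

theorem rep_le {k S n : ℕ} (h : base Γ ^ ((S + k) / (k + 1)) ≤ n) {l : List Γ}
    (hl : l.length ≤ S) (r : ℕ) : rep k l r ≤ n := by
  rcases lt_or_ge k r with hr | hr
  · rw [rep_of_lt hr]; exact Nat.zero_le _
  · exact (rep_lt hr l).le.trans ((Nat.pow_le_pow_right (Nat.succ_pos _)
      (Nat.div_le_div_right (by omega))).trans h)

/-- The store with mode `f`, input head position `v` and numbers `R i r` in the registers. -/
def regs {I F : Type} (f : F) (v : ℕ) (R : I → ℕ → ℕ) : Store (Option (I × ℕ)) F :=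
  (f, fun | none => v | some (i, r) => R i r)

/-- The store with mode `f`, input head position `v` and stacks `X i`. -/
noncomputable def mkStore {I F : Type} (k : ℕ) (f : F) (v : ℕ) (X : I → List Γ) :
    Store (Option (I × ℕ)) F := regs f v fun i => rep k (X i)

end Stacks

-- Stack operations as arithmetic on registers.

namespace Prog

variable {α : Type u} [Fintype α] {I F : Type} [DecidableEq I] {w : List α} {f : F} {v : ℕ}

/-- Move the contents of the first `n` registers of a stack up by one. -/
noncomputable def shiftUp (i : I) : ℕ → Prog α (Option (I × ℕ)) F
  | 0 => skip
  | n + 1 => seq (drain 1 (some (i, n)) [some (i, n + 1)]) (shiftUp i n)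

/-- Move the contents of `n` registers of a stack down by one. -/
noncomputable def shiftDown (i : I) : ℕ → Prog α (Option (I × ℕ)) F
  | 0 => skip
  | n + 1 => seq (shiftDown i n) (drain 1 (some (i, n + 1)) [some (i, n)])

omit [Fintype α] [DecidableEq I] in
theorem regs_bdd {R : I → ℕ → ℕ} (hv : v ≤ w.length) (hR : ∀ j r, R j r ≤ w.length)
    (j : Option (I × ℕ)) : (regs f v R).2 j ≤ w.length := by
  match j with
  | none => exact hv
  | some (j, r) => exact hR j r

theorem sem_drain_regs {i : I} {r r' a b : ℕ} (hr : r ≠ r') {R : I → ℕ → ℕ}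
    {t : Store (Option (I × ℕ)) F} (hv : v ≤ w.length) (hR : ∀ j r, R j r ≤ w.length) :
    (drain a (some (i, r)) (List.replicate b (some (i, r'))) : Prog α _ F).Sem w (regs f v R) t ↔
      ∃ m, R i r = a * m ∧ R i r' + m * b ≤ w.length ∧ t = regs f v (Function.update R i fun x =>
        if x = r then 0 else if x = r' then R i r' + m * b else R i x) := by
  rw [sem_drain_iff (by simp [List.mem_replicate, hr]) (regs_bdd hv hR)]
  refine exists_congr fun m => and_congr_right fun _ => and_congr ?_ ?_
  · cases b with
    | zero => simp [hR]
    | succ b => simp [List.mem_replicate, regs]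
  · refine Eq.congr_right (Prod.ext rfl (funext fun j => ?_))
    match j with
    | none => simp [regs, List.count_replicate]
    | some (j, x) =>
      by_cases hj : j = i
      · subst hj
        by_cases hx : x = r
        · simp [regs, hx]
        · by_cases hx' : x = r'
          · simp [regs, hx', hr.symm]
          · simp [regs, hx, hx', Ne.symm hx', List.count_replicate]
      · simp [regs, hj, Ne.symm hj, List.count_replicate]

theorem sem_incs_regs {i : I} {r b : ℕ} {R : I → ℕ → ℕ} {t : Store (Option (I × ℕ)) F}
    (hv : v ≤ w.length) (hR : ∀ j r, R j r ≤ w.length) :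
    (incs (List.replicate b (some (i, r))) : Prog α _ F).Sem w (regs f v R) t ↔
      R i r + b ≤ w.length ∧
        t = regs f v (Function.update R i (Function.update (R i) r (R i r + b))) := by
  rw [sem_incs_iff (regs_bdd hv hR)]
  refine and_congr ?_ ?_
  · cases b with
    | zero => simp [hR]
    | succ b => simp [List.mem_replicate, regs]
  · refine Eq.congr_right (Prod.ext rfl (funext fun j => ?_))
    match j with
    | none => simp [regs, List.count_replicate]
    | some (j, x) =>
      by_cases hj : j = i
      · subst hj
        by_cases hx : x = r
        · simp [regs, hx]
        · simp [regs, hx, Ne.symm hx, List.count_replicate]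
      · simp [regs, hj, Ne.symm hj, List.count_replicate]

theorem sem_decs_regs {i : I} {r b : ℕ} {R : I → ℕ → ℕ} {t : Store (Option (I × ℕ)) F}
    (hR : ∀ j r, R j r ≤ w.length) :
    (decs b (some (i, r)) : Prog α _ F).Sem w (regs f v R) t ↔
      b ≤ R i r ∧ t = regs f v (Function.update R i (Function.update (R i) r (R i r - b))) := by
  rw [sem_decs (hR i r)]
  refine and_congr Iff.rfl ?_
  refine Eq.congr_right (Prod.ext rfl (funext fun j => ?_))
  match j with
  | none => simp [regs]
  | some (j, x) =>
    by_cases hj : j = i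
    · subst hj
      by_cases hx : x = r
      · simp [regs, hx]
      · simp [regs, hx]
    · simp [regs, hj]

theorem sem_transfer {i : I} {r r' : ℕ} (hr : r ≠ r') {R : I → ℕ → ℕ}
    {t : Store (Option (I × ℕ)) F} (hv : v ≤ w.length) (hR : ∀ j r, R j r ≤ w.length)
    (h0 : R i r' = 0) : (drain 1 (some (i, r)) [some (i, r')] : Prog α _ F).Sem w (regs f v R) t ↔
      t = regs f v (Function.update R i fun x =>
        if x = r then 0 else if x = r' then R i r else R i x) := by
  have := sem_drain_regs (α := α) (f := f) (i := i) (a := 1) (b := 1) hr (t := t) hv hR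
  simp only [List.replicate_one, one_mul, mul_one, h0, zero_add, exists_eq_left', hR,
    true_and] at this
  exact this

theorem sem_shiftUp {i : I} {n : ℕ} {R : I → ℕ → ℕ} {t : Store (Option (I × ℕ)) F}
    (hv : v ≤ w.length) (hR : ∀ j r, R j r ≤ w.length) (h0 : R i n = 0) :
    (shiftUp i n : Prog α _ F).Sem w (regs f v R) t ↔ t = regs f v (Function.update R i fun r =>
      if r = 0 then 0 else if r ≤ n then R i (r - 1) else R i r) := by
  induction n generalizing R with
  | zero =>
    rw [shiftUp, sem_skip]
    have : (fun r => if r = 0 then 0 else if r ≤ 0 then R i (r - 1) else R i r) = R i := by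
      funext r
      by_cases hr : r = 0 <;> simp [hr, h0]
    rw [this, Function.update_eq_self]
  | succ n ih =>
    simp only [shiftUp, Sem, sem_transfer (Nat.succ_ne_self n).symm hv hR h0, exists_eq_left]
    rw [ih _ (by simp)]
    · simp only [Function.update_self, Function.update_idem]
      have : (fun r => if r = 0 then 0 else if r ≤ n then
            (if r - 1 = n then 0 else if r - 1 = n + 1 then R i n else R i (r - 1)) else
            if r = n then 0 else if r = n + 1 then R i n else R i r) =
          fun r => if r = 0 then 0 else if r ≤ n + 1 then R i (r - 1) else R i r := by
        funext r
        grind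
      rw [this]
    · intro j r
      by_cases hj : j = i
      · subst hj
        simp only [Function.update_self]
        split_ifs <;> simp [hR]
      · simpa [hj] using hR j r

theorem sem_shiftDown {i : I} {n : ℕ} {R : I → ℕ → ℕ} {t : Store (Option (I × ℕ)) F}
    (hv : v ≤ w.length) (hR : ∀ j r, R j r ≤ w.length) (h0 : R i 0 = 0) :
    (shiftDown i n : Prog α _ F).Sem w (regs f v R) t ↔ t = regs f v (Function.update R i fun r =>
      if r < n then R i (r + 1) else if r = n then 0 else R i r) := by
  induction n generalizing t with
  | zero =>
    rw [shiftDown, sem_skip]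
    have : (fun r => if r < 0 then R i (r + 1) else if r = 0 then 0 else R i r) = R i := by
      funext r
      by_cases hr : r = 0 <;> simp [hr, h0]
    rw [this, Function.update_eq_self]
  | succ n ih =>
    simp only [shiftDown, Sem, ih, exists_eq_left]
    rw [sem_transfer (Nat.succ_ne_self n) hv]
    · simp only [Function.update_self, Function.update_idem]
      have : (fun r => if r = n + 1 then 0 else if r = n then
            (if n + 1 < n then R i (n + 1 + 1) else if n + 1 = n then 0 else R i (n + 1)) else
            if r < n then R i (r + 1) else if r = n then 0 else R i r) =
          fun r => if r < n + 1 then R i (r + 1) else if r = n + 1 then 0 else R i r := by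
        funext r
        grind
      rw [this]
    · intro j r
      by_cases hj : j = i
      · subst hj
        simp only [Function.update_self]
        split_ifs <;> simp [hR]
      · simpa [hj] using hR j r
    · simp

section Stacks

variable {Γ : Type} [Finite Γ] {k : ℕ} {X : I → List Γ}

/-- Push a symbol on a stack. -/
noncomputable def push (k : ℕ) (a : Γ) (i : I) : Prog α (Option (I × ℕ)) F :=
  seqList [shiftUp i (k + 1), drain 1 (some (i, k + 1)) (List.replicate (base Γ) (some (i, 0))),
    incs (List.replicate (dig a) (some (i, 0)))]

/-- Remove a symbol from the top of a stack. -/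
noncomputable def pop (k : ℕ) (a : Γ) (i : I) : Prog α (Option (I × ℕ)) F :=
  seqList [decs (dig a) (some (i, 0)), drain (base Γ) (some (i, 0)) [some (i, k + 1)],
    shiftDown i (k + 1)]

omit [Fintype α] in
theorem sem_isEmpty {i : I} {t : Store (Option (I × ℕ)) F} :
    (isZero (some (i, 0)) : Prog α _ F).Sem w (mkStore k f v X) t ↔
      X i = [] ∧ t = mkStore k f v X := by
  rw [sem_isZero]
  refine and_congr_left fun _ => ?_
  show rep k (X i) 0 = 0 ↔ _
  match X i with
  | [] => simp [rep]
  | a :: l =>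
    have := dig_pos a
    simp [rep]
    omega

theorem mkStore_update {i : I} {l : List Γ} : mkStore k f v (Function.update X i l) =
    regs f v (Function.update (fun i => rep k (X i)) i (rep k l)) := by
  rw [mkStore]
  congr 1
  funext j
  by_cases hj : j = i
  · subst hj; simp
  · simp [hj]

theorem update_bdd {i : I} {R : I → ℕ → ℕ} {n : ℕ} (hR : ∀ j r, R j r ≤ n) {g : ℕ → ℕ}
    (hg : ∀ r, g r ≤ n) (j : I) (r : ℕ) : Function.update R i g j r ≤ n := by
  by_cases hj : j = i
  · subst hj; simpa using hg r
  · simpa [hj] using hR j r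

/-- Shifting up brings the old register `k` to the scratch register. Draining it into the emptied
register `0` multiplies it by the base, and adding the digit completes the new top register. The
other registers only change places, so the program blocks exactly when the new number does not fit
into a head. -/
theorem sem_push {a : Γ} {i : I} {t : Store (Option (I × ℕ)) F} (hv : v ≤ w.length)
    (hX : ∀ i r, rep k (X i) r ≤ w.length) :
    (push k a i : Prog α _ F).Sem w (mkStore k f v X) t ↔
      (∀ r, rep k (a :: X i) r ≤ w.length) ∧
        t = mkStore k f v (Function.update X i (a :: X i)) := by
  rw [mkStore_update]
  simp only [push, sem_seqList_cons, sem_seqList_nil]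
  rw [mkStore]
  have h1 : ∀ r, (if r = 0 then 0 else if r ≤ k + 1 then rep k (X i) (r - 1) else
      rep k (X i) r) ≤ w.length := by
    intro r
    split_ifs <;> simp [hX]
  simp only [sem_shiftUp hv hX (rep_of_lt (Nat.lt_succ_self k) _), exists_eq_left]
  simp only [sem_drain_regs (Nat.succ_ne_zero k) hv (update_bdd hX h1), Function.update_self,
    Function.update_idem, one_mul, Nat.succ_ne_zero, if_false, le_refl, if_true,
    exists_eq_left', zero_add, Nat.succ_sub_one]
  set g : ℕ → ℕ := fun x => if x = k.succ then 0 else if x = 0 then rep k (X i) k * base Γ else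
      if x = 0 then 0 else if x ≤ k + 1 then rep k (X i) (x - 1) else rep k (X i) x with hg
  have hfin : Function.update g 0 (g 0 + dig a) = rep k (a :: X i) := by
    funext r
    match r with
    | 0 => simp [hg, rep, mul_comm]
    | r + 1 =>
      have := rep_of_lt (Nat.lt_succ_self k) (X i)
      rcases lt_trichotomy r k with h | h | h
      · simp [hg, rep, h, h.ne, h.le]
      · simp [hg, rep, h]
      · simp [hg, rep, h.not_gt, h.ne', h.not_ge, rep_of_lt (h.trans (Nat.lt_succ_self r))]
  have h2 : rep k (X i) k * base Γ ≤ w.length → ∀ r, g r ≤ w.length := by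
    intro h r
    simp only [hg]
    split_ifs <;> simp [hX, h]
  constructor
  · rintro ⟨m, ⟨h3, rfl⟩, m', h4, rfl⟩
    rw [sem_incs_regs hv (update_bdd hX (h2 h3))] at h4
    simp only [Function.update_self, Function.update_idem, hfin] at h4
    refine ⟨fun r => ?_, h4.2⟩
    rw [← hfin]
    by_cases hr : r = 0
    · subst hr; simpa using h4.1
    · simpa [hr] using h2 h3 r
  · rintro ⟨h, rfl⟩
    have h3 : rep k (X i) k * base Γ + dig a ≤ w.length := by simpa [rep, mul_comm] using h 0
    have h4 : rep k (X i) k * base Γ ≤ w.length := by omega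
    refine ⟨_, ⟨h4, rfl⟩, _, (sem_incs_regs hv (update_bdd hX (h2 h4))).2 ⟨?_, rfl⟩, ?_⟩
    · simpa [hg] using h3
    · simp only [Function.update_self, Function.update_idem, hfin]

/-- A wrongly guessed symbol cannot be popped: the exact division after subtracting its digit
forces, modulo `B`, the guessed digit to be the stored one. -/
theorem digit_unique {B x y d e : ℕ} (hd : 0 < d) (hdB : d < B) (heB : e < B) (hde : d ≤ B * x + e)
    (h : B * x + e - d = B * y) : x = y ∧ e = d := by
  have h' : e + B * x = d + B * y := by omega
  have h1 : e = d := by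
    have := congrArg (· % B) h'
    simpa [Nat.mod_eq_of_lt hdB, Nat.mod_eq_of_lt heB] using this
  subst h1
  exact ⟨Nat.eq_of_mul_eq_mul_left (hd.trans hdB) (by omega), rfl⟩

theorem rep_cons_shift {a : Γ} {l : List Γ} : (fun r => if r < k + 1 then
      (if r + 1 = 0 then 0 else if r + 1 = k + 1 then rep k l k else rep k (a :: l) (r + 1))
      else if r = k + 1 then 0 else if r = 0 then 0 else rep k (a :: l) r) = rep k l := by
  funext r
  rcases lt_trichotomy r k with h | h | h
  · simp [rep, h, h.ne, h.trans (Nat.lt_succ_self k)]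
  · simp [h]
  · rw [rep_of_lt h]
    simp [rep_of_lt h]
    omega

theorem sem_pop {a : Γ} {i : I} {t : Store (Option (I × ℕ)) F} (hv : v ≤ w.length)
    (hX : ∀ i r, rep k (X i) r ≤ w.length) :
    (pop k a i : Prog α _ F).Sem w (mkStore k f v X) t ↔
      ∃ l, X i = a :: l ∧ t = mkStore k f v (Function.update X i l) := by
  simp only [mkStore_update]
  simp only [pop, sem_seqList_cons, sem_seqList_nil]
  rw [mkStore]
  have h1 : ∀ r, Function.update (rep k (X i)) 0 (rep k (X i) 0 - dig a) r ≤ w.length := by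
    intro r
    match r with
    | 0 => simpa using (Nat.sub_le _ _).trans (hX i 0)
    | r + 1 => simpa using hX i _
  have h2 := rep_of_lt (Nat.lt_succ_self k) (X i)
  have h3 := dig_pos a
  set g : ℕ → ℕ → ℕ := fun m x => if x = 0 then 0 else
    if x = k + 1 then m else Function.update (rep k (X i)) 0 (rep k (X i) 0 - dig a) x with hg
  have hbdd : ∀ m, m ≤ w.length → ∀ r, g m r ≤ w.length := by
    intro m hm r
    simp only [hg]
    split_ifs
    exacts [Nat.zero_le _, hm, h1 r]
  have hdrain : ∀ t : Store (Option (I × ℕ)) F, (drain (base Γ) (some (i, 0)) [some (i, k + 1)] :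
      Prog α _ F).Sem w (regs f v (Function.update (fun i => rep k (X i)) i
        (Function.update (rep k (X i)) 0 (rep k (X i) 0 - dig a)))) t ↔
      ∃ m, rep k (X i) 0 - dig a = base Γ * m ∧ m ≤ w.length ∧
        t = regs f v (Function.update (fun i => rep k (X i)) i (g m)) := by
    intro t
    have := sem_drain_regs (α := α) (f := f) (i := i) (a := base Γ) (b := 1)
      (Nat.succ_ne_zero k).symm (t := t) hv (update_bdd (i := i) hX h1)
    simp only [List.replicate_one, Function.update_self, Function.update_idem, mul_one,
      Function.update_of_ne (Nat.succ_ne_zero k), h2, zero_add] at this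
    exact this
  have hshift : ∀ m, m ≤ w.length → ∀ t : Store (Option (I × ℕ)) F,
      (shiftDown i (k + 1) : Prog α _ F).Sem w
        (regs f v (Function.update (fun i => rep k (X i)) i (g m))) t ↔
      t = regs f v (Function.update (fun i => rep k (X i)) i fun r =>
        if r < k + 1 then g m (r + 1) else if r = k + 1 then 0 else g m r) := by
    intro m hm t
    rw [sem_shiftDown hv (update_bdd hX (hbdd m hm)) (by simp [hg])]
    simp only [Function.update_self, Function.update_idem]
  have hrep : ∀ l, X i = a :: l → (fun r => if r < k + 1 then g (rep k l k) (r + 1) else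
      if r = k + 1 then 0 else g (rep k l k) r) = rep k l := by
    intro l hl
    rw [← rep_cons_shift (a := a) (l := l) (k := k)]
    funext r
    simp only [hg, hl]
    grind
  constructor
  · rintro ⟨_, h, _, h', t', h'', rfl⟩
    rw [sem_decs_regs hX] at h
    obtain ⟨h4, rfl⟩ := h
    obtain ⟨m, h5, h6, rfl⟩ := (hdrain _).1 h'
    rw [hshift m h6] at h''
    match hl : X i with
    | [] => simp [hl, rep] at h4; omega
    | b :: l =>
      rw [hl] at h4 h5
      obtain ⟨rfl, h9⟩ := digit_unique h3 (dig_lt a) (dig_lt b) h4 h5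
      rw [dig_inj] at h9
      subst h9
      exact ⟨l, rfl, by rw [h'', hrep l hl]⟩
  · rintro ⟨l, hl, rfl⟩
    have h4 : rep k (X i) 0 = base Γ * rep k l k + dig a := by rw [hl, rep]
    -- Popping cannot overflow: the quotient by the base is at most the number that was divided.
    have h5 : rep k l k ≤ w.length := by
      have := hX i 0
      have := Nat.le_mul_of_pos_left (rep k l k) (show 0 < base Γ from Nat.succ_pos _)
      omega
    refine ⟨_, (sem_decs_regs hX).2 ⟨by omega, rfl⟩, _, (hdrain _).2 ⟨_, by omega, h5, rfl⟩, _,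
      (hshift _ h5 _).2 rfl, ?_⟩
    rw [hrep l hl]

end Stacks

end Prog

end HeadProg

namespace HeadProg

universe u

open NSpace

/-! ### Tapes as pairs of stacks -/

section Zipper

variable {Γ : Type} (blank : Γ)

/-- The tape with the symbols of `l`, in reverse order, to the left of the head, and the symbols
of `r` from the position of the head onwards. -/
def contents (l r : List Γ) (j : ℕ) : Γ := (l.reverse ++ r).getD j blank

/-- The two stacks after a symbol is written and the head is moved. -/
def writeMove (l r : List Γ) (a : Γ) : Move → List Γ × List Γ
  | .stay => (l, a :: r.tail)
  | .right => (a :: l, r.tail)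
  | .left => match l with
    | [] => ([], a :: r.tail)
    | b :: l => (l, b :: a :: r.tail)

variable {blank}

theorem contents_length (l r : List Γ) : contents blank l r l.length = r.headD blank := by
  cases r <;> simp [contents]

/-- Concatenating the stacks forgets where the head splits the tape. After writing, all three moves
give the same concatenation and differ only in the split. -/
theorem contents_writeMove (l r : List Γ) (a : Γ) (m : Move) :
    contents blank (writeMove l r a m).1 (writeMove l r a m).2 =
      Function.update (contents blank l r) l.length a := by
  have h : (writeMove l r a m).1.reverse ++ (writeMove l r a m).2 = l.reverse ++ a :: r.tail := by
    cases m with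
    | left => cases l <;> simp [writeMove]
    | stay => rfl
    | right => simp [writeMove]
  funext j
  rw [contents, h]
  by_cases hj : j = l.length
  · subst hj; simp
  · rw [Function.update_of_ne hj, contents]
    simp only [List.getD_eq_getElem?_getD, List.getElem?_append, List.length_reverse]
    split_ifs with hlt
    · rfl
    · obtain ⟨i, hi⟩ : ∃ i, j - l.length = i + 1 := ⟨j - l.length - 1, by omega⟩
      rw [hi]
      cases r <;> simp

theorem length_writeMove (l r : List Γ) (a : Γ) (m : Move) :
    (writeMove l r a m).1.length = m.apply l.length := by
  cases m with
  | left => cases l <;> simp [writeMove, Move.apply]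
  | stay => rfl
  | right => simp [writeMove, Move.apply]

/-- The total height grows only when the right stack is empty, and then it becomes the head position
plus one. Hence a bound on the head positions bounds the stacks. -/
theorem length_add_writeMove (l r : List Γ) (a : Γ) (m : Move) :
    (writeMove l r a m).1.length + (writeMove l r a m).2.length =
      l.length + 1 + (r.length - 1) := by
  cases m with
  | left => cases l <;> simp [writeMove] <;> omega
  | stay => simp [writeMove]; omega
  | right => simp [writeMove]

end Zipper

-- Tape steps as stack operations.

namespace Prog

variable {α : Type u} [Fintype α] {T Γ F : Type} [DecidableEq T] [Finite Γ] {w : List α} {f : F}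
  {v k : ℕ} (blank : Γ)

/-- The stacks after a symbol is written and the head is moved on the tape `i`. -/
def updateTape (X : T × Bool → List Γ) (i : T) (a : Γ) (m : Move) : T × Bool → List Γ := fun j =>
  if j.1 = i then
    bif j.2 then (writeMove (X (i, false)) (X (i, true)) a m).2
    else (writeMove (X (i, false)) (X (i, true)) a m).1
  else X j

/-- Remove the scanned symbol from a tape. -/
noncomputable def readTape (k : ℕ) (i : T) (c : Γ) : Prog α (Option ((T × Bool) × ℕ)) F :=
  open scoped Classical in
  alt (pop k c (i, true)) (if c = blank then isZero (some ((i, true), 0)) else fail)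

/-- Write a symbol on a tape and move the head. -/
noncomputable def writeTape (k : ℕ) (i : T) (a : Γ) :
    Move → Prog α (Option ((T × Bool) × ℕ)) F
  | .stay => push k a (i, true)
  | .right => push k a (i, false)
  | .left =>
    have := Fintype.ofFinite Γ
    alt (seq (isZero (some ((i, false), 0))) (push k a (i, true)))
      (altList ((Finset.univ : Finset Γ).toList.map fun b =>
        seqList [pop k b (i, false), push k a (i, true), push k b (i, true)]))

theorem sem_readTape {X : T × Bool → List Γ} {i : T} {c : Γ}
    {t : Store (Option ((T × Bool) × ℕ)) F} (hv : v ≤ w.length)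
    (hX : ∀ i r, rep k (X i) r ≤ w.length) :
    (readTape blank k i c : Prog α _ F).Sem w (mkStore k f v X) t ↔ (X (i, true)).headD blank = c ∧
      t = mkStore k f v (Function.update X (i, true) (X (i, true)).tail) := by
  show _ ∨ _ ↔ _
  rw [sem_pop hv hX]
  by_cases hc : c = blank
  · rw [if_pos hc, sem_isEmpty]
    match hl : X (i, true) with
    | [] =>
      have : Function.update X (i, true) [] = X := by rw [← hl, Function.update_eq_self]
      simp [hc, this]
    | b :: l => simp [and_assoc]
  · rw [if_neg hc]
    match hl : X (i, true) with
    | [] => simp [Ne.symm hc, Sem]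
    | b :: l => simp [Sem, and_assoc]

theorem bdd_update {I : Type} [DecidableEq I] {X : I → List Γ} {i : I} {l : List Γ} {n : ℕ}
    (hX : ∀ i r, rep k (X i) r ≤ n) (hl : ∀ r, rep k l r ≤ n) (j : I) (r : ℕ) :
    rep k (Function.update X i l j) r ≤ n := by
  by_cases hj : j = i
  · subst hj; simpa using hl r
  · simpa [hj] using hX j r

theorem bdd_of_cons {a : Γ} {l : List Γ} {n : ℕ} (h : ∀ r, rep k (a :: l) r ≤ n) (r : ℕ) :
    rep k l r ≤ n := by
  rcases lt_trichotomy r k with hr | hr | hr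
  · have := h (r + 1)
    rwa [rep, if_pos hr] at this
  · subst hr
    have := h 0
    rw [rep] at this
    have := Nat.le_mul_of_pos_left (rep r l r) (show 0 < base Γ from Nat.succ_pos _)
    omega
  · rw [rep_of_lt hr]; exact Nat.zero_le _

theorem bdd_tail {l : List Γ} {n : ℕ} (h : ∀ r, rep k l r ≤ n) : ∀ r, rep k l.tail r ≤ n := by
  cases l with
  | nil => exact h
  | cons a l => exact bdd_of_cons h

/-- Read and write a symbol on a tape and move the head. -/
noncomputable def stepTape (k : ℕ) (i : T) (c a : Γ) (m : Move) :
    Prog α (Option ((T × Bool) × ℕ)) F :=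
  seq (readTape blank k i c) (writeTape k i a m)

theorem sem_stepTape {X : T × Bool → List Γ} {i : T} {c a : Γ} {m : Move}
    {t : Store (Option ((T × Bool) × ℕ)) F} (hv : v ≤ w.length)
    (hX : ∀ i r, rep k (X i) r ≤ w.length) :
    (stepTape blank k i c a m : Prog α _ F).Sem w (mkStore k f v X) t ↔
      (X (i, true)).headD blank = c ∧ (∀ b r, rep k (updateTape X i a m (i, b)) r ≤ w.length) ∧
      t = mkStore k f v (updateTape X i a m) := by
  simp only [stepTape, Sem, sem_readTape blank hv hX, and_assoc, exists_and_left, exists_eq_left]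
  refine and_congr_right fun _ => ?_
  have h1 := bdd_tail (hX (i, true))
  have h2 := bdd_update (i := (i, true)) hX h1
  have h3 : ∀ {p q : List Γ}, writeMove (X (i, false)) (X (i, true)) a m = (p, q) →
      updateTape X i a m = Function.update (Function.update X (i, true) q) (i, false) p := by
    intro p q h
    funext ⟨j, b⟩
    by_cases hj : j = i
    · subst hj; cases b <;> simp [updateTape, h]
    · simp [updateTape, hj]
  have h4 : ∀ {p q : List Γ}, writeMove (X (i, false)) (X (i, true)) a m = (p, q) →
      ((∀ b r, rep k (updateTape X i a m (i, b)) r ≤ w.length) ↔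
        (∀ r, rep k p r ≤ w.length) ∧ ∀ r, rep k q r ≤ w.length) := by
    intro p q h
    rw [Bool.forall_bool]
    simp [updateTape, h]
  have h5 : ∀ q, Function.update (Function.update X (i, true) q) (i, false) (X (i, false)) =
      Function.update X (i, true) q := by
    intro q
    rw [Function.update_eq_self_iff]
    simp
  cases m with
  | stay =>
    rw [h4 rfl, h3 rfl, writeTape, sem_push hv h2, h5]
    simp [hX]
  | right =>
    rw [h4 rfl, h3 rfl, writeTape, sem_push hv h2]
    simp [h1]
  | left =>
    simp only [writeTape, Sem, sem_altList, sem_isEmpty]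
    match hl : X (i, false) with
    | [] =>
      have h6 : ∀ r, rep k ([] : List Γ) r ≤ w.length := fun r => Nat.zero_le _
      rw [hl] at h5
      rw [h4 (p := []) (q := a :: (X (i, true)).tail) (by rw [hl]; rfl),
        h3 (p := []) (q := a :: (X (i, true)).tail) (by rw [hl]; rfl), h5]
      simp [h6, hl, sem_push hv h2, sem_seqList_cons, sem_pop hv h2]
    | b :: l =>
      rw [h4 (p := l) (q := b :: a :: (X (i, true)).tail) (by rw [hl]; rfl),
        h3 (p := l) (q := b :: a :: (X (i, true)).tail) (by rw [hl]; rfl)]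
      have h7 : ∀ r, rep k l r ≤ w.length := bdd_of_cons (hl ▸ hX (i, false))
      have h8 := bdd_update (i := (i, false)) h2 h7
      have h9 : Function.update X (i, true) (X (i, true)).tail (i, false) = b :: l := by simp [hl]
      have h10 : Function.update (Function.update X (i, true) (X (i, true)).tail) (i, false) l
          (i, true) = (X (i, true)).tail := by simp
      have h11 : ∀ p q, Function.update (Function.update (Function.update (Function.update X
          (i, true) (X (i, true)).tail) (i, false) l) (i, true) p) (i, true) q =
          Function.update (Function.update X (i, true) q) (i, false) l := by
        intro p q
        rw [Function.update_idem, Function.update_comm (by simp), Function.update_idem]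
      constructor
      · rintro (⟨m, h, -⟩ | ⟨p, hp, h⟩)
        · simp [hl] at h
        · obtain ⟨b', -, rfl⟩ := List.mem_map.1 hp
          obtain ⟨s₁, hs₁, s₂, hs₂, s₃, hs₃, h⟩ := h
          obtain rfl := sem_skip.1 h
          obtain ⟨l', hl', rfl⟩ := (sem_pop hv h2).1 hs₁
          rw [h9, List.cons.injEq] at hl'
          obtain ⟨rfl, rfl⟩ := hl'
          obtain ⟨h12, rfl⟩ := (sem_push hv h8).1 hs₂
          obtain ⟨h13, rfl⟩ := (sem_push hv (bdd_update h8 h12)).1 hs₃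
          rw [Function.update_self, h10] at h13
          refine ⟨⟨h7, h13⟩, ?_⟩
          rw [Function.update_self, h10, h11]
      · rintro ⟨⟨-, h13⟩, rfl⟩
        -- The intermediate push of `a` cannot overflow, since the registers still fit after `b` is
        -- pushed on top of it.
        have h12 := bdd_of_cons h13
        refine .inr ⟨_, List.mem_map.2 ⟨b, by simp, rfl⟩, _, (sem_pop hv h2).2 ⟨l, h9, rfl⟩, _,
          (sem_push hv h8).2 ⟨by rwa [h10], rfl⟩, _, (sem_push hv (bdd_update h8 (by rwa [h10]))).2
          ⟨by rwa [Function.update_self, h10], rfl⟩, sem_skip.2 ?_⟩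
        rw [Function.update_self, h10, h11]

/-- The stacks after a step on each of the tapes in the list `l`. -/
def updateTapes (X : T × Bool → List Γ) (l : List T) (a : T → Γ) (m : T → Move) :
    T × Bool → List Γ := fun j => if j.1 ∈ l then updateTape X j.1 (a j.1) (m j.1) j else X j

/-- A step on each of the tapes in the list `l`. -/
noncomputable def stepTapes (k : ℕ) (l : List T) (c a : T → Γ) (m : T → Move) :
    Prog α (Option ((T × Bool) × ℕ)) F :=
  seqList (l.map fun i => stepTape blank k i (c i) (a i) (m i))

/-- Steps on different tapes touch disjoint registers. Since `l` has no duplicates, each tape is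
still unread when its turn comes. -/
theorem sem_stepTapes {X : T × Bool → List Γ} {l : List T} (hl : l.Nodup) {c a : T → Γ}
    {m : T → Move} {t : Store (Option ((T × Bool) × ℕ)) F} (hv : v ≤ w.length)
    (hX : ∀ i r, rep k (X i) r ≤ w.length) :
    (stepTapes blank k l c a m : Prog α _ F).Sem w (mkStore k f v X) t ↔
      (∀ i ∈ l, (X (i, true)).headD blank = c i) ∧
      (∀ i r, rep k (updateTapes X l a m i) r ≤ w.length) ∧
      t = mkStore k f v (updateTapes X l a m) := by
  induction l generalizing X with
  | nil =>
    have : updateTapes X [] a m = X := by funext j; simp [updateTapes]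
    simp [stepTapes, sem_seqList_nil, this, hX]
  | cons i l ih =>
    rw [List.nodup_cons] at hl
    have h1 : updateTapes (updateTape X i (a i) (m i)) l a m = updateTapes X (i :: l) a m := by
      funext ⟨j, b⟩
      by_cases hj : j = i
      · subst hj
        simp [updateTapes, hl.1]
      · by_cases hjl : j ∈ l
        · simp [updateTapes, hjl, updateTape, hj]
        · simp [updateTapes, hjl, updateTape, hj]
    have h2 : ∀ j ∈ l, updateTape X i (a i) (m i) (j, true) = X (j, true) := by
      intro j hj
      have : j ≠ i := fun e => hl.1 (e ▸ hj)
      simp [updateTape, this]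
    have h3 : (∀ b r, rep k (updateTape X i (a i) (m i) (i, b)) r ≤ w.length) →
        ∀ j r, rep k (updateTape X i (a i) (m i) j) r ≤ w.length := by
      rintro h ⟨j, b⟩ r
      by_cases hj : j = i
      · subst hj; exact h b r
      · simpa [updateTape, hj] using hX (j, b) r
    simp only [List.forall_mem_cons, and_assoc]
    constructor
    · rintro ⟨s, hs, hst⟩
      obtain ⟨h4, h5, rfl⟩ := (sem_stepTape blank hv hX).1 hs
      obtain ⟨h6, h7, h8⟩ := (ih hl.2 (h3 h5)).1 hst
      rw [h1] at h7 h8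
      exact ⟨h4, fun j hj => h2 j hj ▸ h6 j hj, h7, h8⟩
    · rintro ⟨h4, h6, h7, h8⟩
      have h5 : ∀ b r, rep k (updateTape X i (a i) (m i) (i, b)) r ≤ w.length := fun b r => by
        have := h7 (i, b) r
        simpa [updateTapes] using this
      exact ⟨_, (sem_stepTape blank hv hX).2 ⟨h4, h5, rfl⟩,
        (ih hl.2 (h3 h5)).2 ⟨fun j hj => by rw [h2 j hj, h6 j hj], h1 ▸ h7, h1 ▸ h8⟩⟩

end Prog

end HeadProg

namespace HeadProg

universe u

open NSpace

/-! ### The simulation of a machine -/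

namespace Prog

variable {α : Type u} [Fintype α] {I Q : Type} [DecidableEq I] {w : List α} {v : ℕ}
  {R : I → ℕ → ℕ}

section

variable {F : Type} {f : F} {t : Store (Option (I × ℕ)) F}

omit [Fintype α] in
theorem update_none {v' : ℕ} :
    ((regs f v R).1, Function.update (regs f v R).2 none v') = regs f v' R := by
  refine Prod.ext rfl (funext fun j => ?_)
  match j with
  | none => simp [regs]
  | some _ => simp [regs]

theorem sem_inc_none : (inc none : Prog α _ F).Sem w (regs f v R) t ↔
    v < w.length ∧ t = regs f (v + 1) R := by
  rw [sem_inc, update_none]; rfl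

theorem sem_dec_none : (dec none : Prog α _ F).Sem w (regs f v R) t ↔
    v ≠ 0 ∧ v ≤ w.length ∧ t = regs f (v - 1) R := by
  rw [sem_dec, update_none]; rfl

omit [Fintype α] in
theorem sem_fwd_none {a : α} : (act (.head none (.fwd a)) : Prog α _ F).Sem w (regs f v R) t ↔
    w[v]? = some a ∧ t = regs f (v + 1) R := by
  rw [sem_fwd, update_none]; rfl

end

/-- The position on the input tape with endmarkers that is represented by a flag and the position
of a head. -/
def inPos (b : Bool) (v : ℕ) : ℕ := bif b then v + 1 else 0

/-- Move the input head, when it is not on the left endmarker. -/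
noncomputable def moveInput (q : Q) : Move → Prog α (Option (I × ℕ)) (Q × Bool)
  | .left => alt (seq (isZero none) (act (.set (q, false)))) (seq (dec none) (act (.set (q, true))))
  | .stay => act (.set (q, true))
  | .right => alt (seq (inc none) (act (.set (q, true))))
      (seq (act (.head none .last)) (act (.set (q, true))))

/-- The input tape has one cell more than a head has positions, so a flag marks the left endmarker.
Requiring position `0` there makes the representation of a cell unique, which the converse direction
uses. -/
theorem sem_moveInput {q q₀ : Q} {m : Move} {t : Store (Option (I × ℕ)) (Q × Bool)}
    (hv : v ≤ w.length) : (moveInput q m : Prog α _ _).Sem w (regs (q₀, true) v R) t ↔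
      ∃ b v', v' ≤ w.length ∧ (b = false → v' = 0) ∧
        inPos b v' = min (m.apply (inPos true v)) (w.length + 1) ∧ t = regs (q, b) v' R := by
  have hr : ∀ t : Store (Option (I × ℕ)) (Q × Bool),
      (t = ((q, true), (regs (q₀, true) v R).2) ↔ t = regs (q, true) v R) := fun _ => Iff.rfl
  cases m with
  | left =>
    constructor
    · rintro (⟨s, h1, h2⟩ | ⟨s, h1, h2⟩)
      · obtain ⟨hz, rfl⟩ := sem_isZero.1 h1
        replace hz : v = 0 := hz
        subst hz
        exact ⟨false, 0, hv, fun _ => rfl, by simp [inPos, Move.apply], h2⟩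
      · obtain ⟨h1, -, rfl⟩ := sem_dec_none.1 h1
        exact ⟨true, v - 1, by omega, by simp, by simp [inPos, Move.apply]; omega, h2⟩
    · rintro ⟨b, v', h1, h2, h3, rfl⟩
      cases b with
      | false =>
        obtain rfl := h2 rfl
        obtain rfl : v = 0 := by simp [inPos, Move.apply] at h3; omega
        exact .inl ⟨_, sem_isZero.2 ⟨rfl, rfl⟩, rfl⟩
      | true =>
        simp [inPos, Move.apply] at h3
        obtain rfl : v' = v - 1 := by omega
        exact .inr ⟨_, sem_dec_none.2 ⟨by omega, hv, rfl⟩, rfl⟩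
  | stay =>
    constructor
    · intro h
      exact ⟨true, v, hv, by simp, by simpa [inPos, Move.apply] using hv, h⟩
    · rintro ⟨b, v', h1, h2, h3, rfl⟩
      cases b with
      | false => simp [inPos, Move.apply] at h3
      | true =>
        obtain rfl : v' = v := by simp [inPos, Move.apply] at h3; omega
        rfl
  | right =>
    constructor
    · rintro (⟨s, h1, h2⟩ | ⟨s, h1, h2⟩)
      · obtain ⟨hlt, rfl⟩ := sem_inc_none.1 h1
        exact ⟨true, v + 1, hlt, by simp, by simp [inPos, Move.apply]; omega, h2⟩
      · obtain ⟨he, rfl⟩ := sem_isLast.1 h1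
        replace he : v = w.length := he
        exact ⟨true, v, hv, by simp, by simp [inPos, Move.apply, he], h2⟩
    · rintro ⟨b, v', h1, h2, h3, rfl⟩
      cases b with
      | false => simp [inPos, Move.apply] at h3
      | true =>
        simp [inPos, Move.apply] at h3
        rcases hv.lt_or_eq with h | h
        · obtain rfl : v' = v + 1 := by omega
          exact .inl ⟨_, sem_inc_none.2 ⟨h, rfl⟩, rfl⟩
        · obtain rfl : v' = v := by omega
          exact .inr ⟨_, sem_isLast.2 ⟨h, rfl⟩, rfl⟩

/-- A step of a machine on the input tape. -/
noncomputable def stepInput (q : Q) (σ : InputSymbol α) (m : Move) (q' : Q) :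
    Prog α (Option (I × ℕ)) (Q × Bool) :=
  match σ with
  | .leftEnd => seq (act (.test (q, false))) (act (.set (q', match m with
    | .right => true
    | _ => false)))
  | .letter a => seqList [act (.test (q, true)), act (.head none (.fwd a)), dec none,
      moveInput q' m]
  | .rightEnd => seqList [act (.test (q, true)), act (.head none .last), moveInput q' m]

/-- A letter is recognized by moving across it and back. The flag separates position `0` before the
first letter from the left endmarker, for which the head also stands at `0`. -/
theorem sem_stepInput {q q' q₀ : Q} {σ : InputSymbol α} {b₀ : Bool} {m : Move}
    {t : Store (Option (I × ℕ)) (Q × Bool)}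
    (hv : v ≤ w.length) (hb : b₀ = false → v = 0) :
    (stepInput q σ m q' : Prog α _ _).Sem w (regs (q₀, b₀) v R) t ↔
      q₀ = q ∧ inputAt w (inPos b₀ v) = σ ∧ ∃ b v', v' ≤ w.length ∧ (b = false → v' = 0) ∧
        inPos b v' = min (m.apply (inPos b₀ v)) (w.length + 1) ∧ t = regs (q', b) v' R := by
  cases σ with
  | leftEnd =>
    constructor
    · rintro ⟨s, h1, h2⟩
      obtain ⟨he, rfl⟩ := sem_test.1 h1
      cases show (q₀, b₀) = (q, _) from he
      obtain rfl := hb rfl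
      refine ⟨rfl, rfl, _, 0, Nat.zero_le _, fun _ => rfl, ?_, h2⟩
      cases m <;> simp [inPos, Move.apply]
    · rintro ⟨rfl, h1, b, v', h2, h3, h4, rfl⟩
      obtain rfl : b₀ = false := by
        by_contra hb'
        simp only [Bool.not_eq_false] at hb'
        subst hb'
        simp only [inPos, cond_true, inputAt] at h1
        rcases h : w[v]? with _ | a <;> simp [h] at h1
      obtain rfl := hb rfl
      refine ⟨_, sem_test.2 ⟨rfl, rfl⟩, ?_⟩
      cases b with
      | false =>
        obtain rfl := h3 rfl
        cases m <;> simp [inPos, Move.apply] at h4 <;> rfl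
      | true =>
        cases m <;> simp [inPos, Move.apply] at h4
        subst h4
        rfl
  | letter a =>
    constructor
    · rintro ⟨_, h1, _, h2, _, h3, _, h4, h5⟩
      obtain rfl := sem_skip.1 h5
      obtain ⟨he, rfl⟩ := sem_test.1 h1
      cases show (q₀, b₀) = (q, _) from he
      obtain ⟨ha, rfl⟩ := sem_fwd_none.1 h2
      obtain ⟨-, -, rfl⟩ := sem_dec_none.1 h3
      rw [Nat.add_sub_cancel, sem_moveInput hv] at h4
      exact ⟨rfl, by simp [inPos, inputAt, ha], h4⟩
    · rintro ⟨rfl, h1, h2⟩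
      obtain rfl : b₀ = true := by
        by_contra hb'
        simp only [Bool.not_eq_true] at hb'
        subst hb'
        simp [inPos, inputAt] at h1
      simp only [inPos, cond_true, inputAt] at h1
      rcases h : w[v]? with _ | a'
      · simp [h] at h1
      · simp only [h, Option.elim_some, InputSymbol.letter.injEq] at h1
        subst h1
        have hlt := (List.getElem?_eq_some_iff.1 h).1
        exact ⟨_, sem_test.2 ⟨rfl, rfl⟩, _, sem_fwd_none.2 ⟨h, rfl⟩, _,
          sem_dec_none.2 ⟨Nat.succ_ne_zero v, hlt, rfl⟩, _, (sem_moveInput hv).2 h2, sem_skip.2 rfl⟩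
  | rightEnd =>
    constructor
    · rintro ⟨_, h1, _, h2, _, h4, h5⟩
      obtain rfl := sem_skip.1 h5
      obtain ⟨he, rfl⟩ := sem_test.1 h1
      cases show (q₀, b₀) = (q, _) from he
      obtain ⟨hl, rfl⟩ := sem_isLast.1 h2
      replace hl : v = w.length := hl
      rw [sem_moveInput hv] at h4
      exact ⟨rfl, by simp [inPos, inputAt, hl], h4⟩
    · rintro ⟨rfl, h1, h2⟩
      obtain rfl : b₀ = true := by
        by_contra hb'
        simp only [Bool.not_eq_true] at hb'
        subst hb'
        simp [inPos, inputAt] at h1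
      simp only [inPos, cond_true, inputAt] at h1
      rcases h : w[v]? with _ | a'
      · have hge := List.getElem?_eq_none_iff.1 h
        exact ⟨_, sem_test.2 ⟨rfl, rfl⟩, _, sem_isLast.2 ⟨le_antisymm hv hge, rfl⟩, _,
          (sem_moveInput hv).2 h2, sem_skip.2 rfl⟩
      · simp [h] at h1

end Prog

-- Configurations of a machine as stores of heads.

section Machine

variable {α : Type u} [Fintype α] (M : NTM α)

/-- Actions of a machine. -/
abbrev Trans := (M.State × InputSymbol α × (Fin M.k → M.Γ)) ×
  (M.State × (Fin M.k → M.Γ) × Move × (Fin M.k → Move))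

instance : Finite (InputSymbol α) :=
  Finite.of_surjective (fun x : Option (Option α) => match x with
    | none => .leftEnd
    | some none => .rightEnd
    | some (some a) => .letter a) (by
    rintro (_ | a | _)
    exacts [⟨none, rfl⟩, ⟨some (some a), rfl⟩, ⟨some none, rfl⟩])

instance : Finite Move :=
  Finite.of_surjective (fun x : Option Bool => match x with
    | none => .stay
    | some false => .left
    | some true => .right) (by
    rintro (_ | _ | _)
    exacts [⟨some false, rfl⟩, ⟨none, rfl⟩, ⟨some true, rfl⟩])

instance : Finite (Trans M) :=
  have := M.finite_state
  have := M.finite_Γ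
  inferInstance

/-- The actions that a machine can take. -/
def transSet : Set (Trans M) := {e | e.2 ∈ M.trans e.1.1 e.1.2.1 e.1.2.2}

/-- States of the simulation: state, flag and position of the input head, and stacks. -/
structure Sim where
  state : M.State
  flag : Bool
  head : ℕ
  tapes : Fin M.k × Bool → List M.Γ

namespace Sim

variable {M} (x : Sim M)

/-- The configuration that is represented by a state of the simulation. -/
def cfg : M.Cfg where
  state := x.state
  inPos := Prog.inPos x.flag x.head
  tape := fun i => contents M.blank (x.tapes (i, false)) (x.tapes (i, true))
  pos := fun i => (x.tapes (i, false)).length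

/-- The store that represents a state of the simulation. -/
noncomputable def store (k : ℕ) : Store (Option ((Fin M.k × Bool) × ℕ)) (M.State × Bool) :=
  have := M.finite_Γ
  mkStore k (x.state, x.flag) x.head x.tapes

/-- The state of the simulation is good for the input `w`. -/
def Valid (w : List α) : Prop := x.head ≤ w.length ∧ (x.flag = false → x.head = 0)

/-- The numbers that represent the stacks do not exceed `n`. -/
def Fits (k n : ℕ) : Prop :=
  have := M.finite_Γ
  ∀ i r, rep k (x.tapes i) r ≤ n

end Sim

/-- The simulation of an action of a machine. -/
noncomputable def simTrans (k : ℕ) (e : Trans M) :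
    Prog α (Option ((Fin M.k × Bool) × ℕ)) (M.State × Bool) :=
  have := M.finite_Γ
  Prog.seq (Prog.stepInput e.1.1 e.1.2.1 e.2.2.2.1 e.2.1)
    (Prog.stepTapes M.blank k (List.finRange M.k) e.1.2.2 e.2.2.1 e.2.2.2.2)

variable {M}

theorem sem_simTrans {k : ℕ} {e : Trans M} {x : Sim M} {w : List α} (hx : x.Valid w)
    (hk : x.Fits k w.length) {t : Store (Option ((Fin M.k × Bool) × ℕ)) (M.State × Bool)} :
    (simTrans M k e).Sem w (x.store k) t ↔ x.state = e.1.1 ∧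
      inputAt w x.cfg.inPos = e.1.2.1 ∧ (fun i => x.cfg.tape i (x.cfg.pos i)) = e.1.2.2 ∧
      ∃ y : Sim M, y.Valid w ∧ y.Fits k w.length ∧ y.state = e.2.1 ∧
        y.cfg.inPos = min (e.2.2.2.1.apply x.cfg.inPos) (w.length + 1) ∧
        y.tapes = Prog.updateTapes x.tapes (List.finRange M.k) e.2.2.1 e.2.2.2.2 ∧
        t = y.store k := by
  have := M.finite_Γ
  have hread : (∀ i ∈ List.finRange M.k, (x.tapes (i, true)).headD M.blank = e.1.2.2 i) ↔
      (fun i => x.cfg.tape i (x.cfg.pos i)) = e.1.2.2 := by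
    simp [funext_iff, Sim.cfg, contents_length]
  constructor
  · rintro ⟨s, h1, h2⟩
    obtain ⟨h3, h4, b, v, h5, h6, h7, rfl⟩ := (Prog.sem_stepInput hx.1 hx.2).1 h1
    obtain ⟨h8, h9, h10⟩ := (Prog.sem_stepTapes M.blank (List.nodup_finRange _) h5 hk).1 h2
    exact ⟨h3, h4, hread.1 h8, ⟨e.2.1, b, v, _⟩, ⟨h5, h6⟩, h9, rfl, h7, rfl, h10⟩
  · rintro ⟨h3, h4, h8, ⟨q, b, v, X⟩, ⟨h5, h6⟩, h9, rfl, h7, rfl, rfl⟩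
    exact ⟨_, (Prog.sem_stepInput hx.1 hx.2).2 ⟨h3, h4, b, v, h5, h6, h7, rfl⟩,
      (Prog.sem_stepTapes M.blank (List.nodup_finRange _) h5 hk).2 ⟨hread.2 h8, h9, rfl⟩⟩

omit [Fintype α] in
theorem cfg_updateTapes {x y : Sim M} {s : Fin M.k → M.Γ} {v : Fin M.k → Move}
    (h : y.tapes = Prog.updateTapes x.tapes (List.finRange M.k) s v) :
    y.cfg.tape = (fun i => Function.update (x.cfg.tape i) (x.cfg.pos i) (s i)) ∧
      y.cfg.pos = fun i => (v i).apply (x.cfg.pos i) := by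
  constructor
  · funext i
    simp only [Sim.cfg, h, Prog.updateTapes, List.mem_finRange, if_true, Prog.updateTape,
      cond_true, cond_false]
    exact contents_writeMove _ _ _ _
  · funext i
    simp only [Sim.cfg, h, Prog.updateTapes, List.mem_finRange, if_true, Prog.updateTape,
      cond_false]
    exact length_writeMove _ _ _ _

/-- The simulation of a machine. -/
noncomputable def sim (M : NTM α) (k : ℕ) :
    Prog α (Option ((Fin M.k × Bool) × ℕ)) (M.State × Bool) :=
  Prog.star (Prog.altList ((transSet M).toFinite.toFinset.toList.map (simTrans M k)))

variable (M) in
/-- The initial state of the simulation. -/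
def Sim.init : Sim M := ⟨M.start, false, 0, fun _ => []⟩

omit [Fintype α] in
theorem Sim.cfg_init : (Sim.init M).cfg = M.init := by
  simp [Sim.init, Sim.cfg, NTM.init, Prog.inPos]
  rfl

omit [Fintype α] in
theorem Sim.store_init (k : ℕ) : (Sim.init M).store k = ((M.start, false), fun _ => 0) := by
  refine Prod.ext rfl (funext fun j => ?_)
  match j with
  | none => rfl
  | some (i, r) => exact rfl

theorem Prog.Sem.reachable_of_sim {k : ℕ} {w : List α}
    {t : Store (Option ((Fin M.k × Bool) × ℕ)) (M.State × Bool)}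
    (h : (sim M k).Sem w ((M.start, false), fun _ => 0) t) :
    ∃ x : Sim M, x.Valid w ∧ x.Fits k w.length ∧ t = x.store k ∧ M.Reachable w x.cfg := by
  rw [← Sim.store_init k] at h
  replace h : Relation.ReflTransGen _ _ t := h
  induction h with
  | refl =>
    exact ⟨Sim.init M, ⟨Nat.zero_le _, fun _ => rfl⟩, fun _ _ => Nat.zero_le _, rfl,
      by rw [Sim.cfg_init]; exact .refl⟩
  | tail _ h ih =>
    obtain ⟨x, hx, hk, rfl, hr⟩ := ih
    obtain ⟨p, hp, h⟩ := Prog.sem_altList.1 h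
    obtain ⟨e, he, rfl⟩ := List.mem_map.1 hp
    obtain ⟨h1, h2, h3, y, hy, hyk, h4, h5, h6, rfl⟩ := (sem_simTrans hx hk).1 h
    refine ⟨y, hy, hyk, rfl, hr.tail ⟨e.2.1, e.2.2.1, e.2.2.2.1, e.2.2.2.2, ?_, ?_⟩⟩
    · rw [h2, h3]
      have : e.2 ∈ M.trans e.1.1 e.1.2.1 e.1.2.2 := by simpa [transSet] using he
      rw [← h1] at this
      exact this
    · obtain ⟨h7, h8⟩ := cfg_updateTapes h6
      rw [← h7, ← h8, ← h5, ← h4]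
      rfl

/-- The space bound keeps the total height of the two stacks of every tape at most `S`. By `hk` all
registers then fit into heads, so no step of the machine is lost to overflow. -/
theorem exists_sim {k S : ℕ} {w : List α}
    (hS : ∀ c, M.Reachable w c → ∀ i, c.pos i < S)
    (hk : (have := M.finite_Γ; base M.Γ) ^ ((S + k) / (k + 1)) ≤ w.length) {c : M.Cfg}
    (hc : M.Reachable w c) : ∃ x : Sim M, x.Valid w ∧ x.cfg = c ∧
      (∀ i, (x.tapes (i, false)).length + (x.tapes (i, true)).length ≤ S) ∧
      (sim M k).Sem w ((M.start, false), fun _ => 0) (x.store k) := by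
  have := M.finite_Γ
  have hfits : ∀ x : Sim M, (∀ i, (x.tapes (i, false)).length + (x.tapes (i, true)).length ≤ S) →
      x.Fits k w.length := by
    rintro x hx ⟨i, b⟩ r
    refine rep_le hk ?_ r
    have := hx i
    cases b <;> omega
  induction hc with
  | refl =>
    refine ⟨Sim.init M, ⟨Nat.zero_le _, fun _ => rfl⟩, Sim.cfg_init, fun _ => Nat.zero_le _, ?_⟩
    rw [← Sim.store_init k]
    exact .refl
  | tail hr h ih =>
    obtain ⟨x, hx, rfl, hl, h1⟩ := ih
    obtain ⟨q, s, m, v, hm, rfl⟩ := h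
    -- Cell `0` is encoded by the flag, cell `p + 1` by position `p`; truncation at the right
    -- endmarker becomes truncation at `w.length`.
    obtain ⟨b, p, hp, hb, hbp⟩ : ∃ b p, p ≤ w.length ∧ (b = false → p = 0) ∧
        Prog.inPos b p = min (m.apply x.cfg.inPos) (w.length + 1) := by
      generalize m.apply x.cfg.inPos = p
      match p with
      | 0 => exact ⟨false, 0, Nat.zero_le _, fun _ => rfl, by simp [Prog.inPos]⟩
      | p + 1 => exact ⟨true, min p w.length, by simp, by simp, by simp [Prog.inPos]⟩
    set y : Sim M := ⟨q, b, p, Prog.updateTapes x.tapes (List.finRange M.k) s v⟩ with hy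
    have hyl : ∀ i, (y.tapes (i, false)).length + (y.tapes (i, true)).length ≤ S := by
      intro i
      simp only [hy, Prog.updateTapes, List.mem_finRange, if_true, Prog.updateTape, cond_true,
        cond_false]
      rw [length_add_writeMove]
      have h2 : (x.tapes (i, false)).length < S := hS _ hr i
      have := hl i
      omega
    obtain ⟨h7, h8⟩ := cfg_updateTapes (x := x) (y := y) rfl
    refine ⟨y, ⟨hp, hb⟩, ?_, hyl, Relation.ReflTransGen.tail h1 (Prog.sem_altList.2
      ⟨_, List.mem_map.2 ⟨((x.state, _, _), q, s, m, v), ?_, rfl⟩,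
        (sem_simTrans hx (hfits x hl)).2 ⟨rfl, rfl, rfl, y, ⟨hp, hb⟩, hfits y hyl, rfl, hbp, rfl,
          rfl⟩⟩)⟩
    · rw [← h7, ← h8, ← hbp]
      rfl
    · rw [Finset.mem_toList, Set.Finite.mem_toFinset]
      exact hm

end Machine

end HeadProg

namespace HeadProg

universe u

open NSpace

namespace Prog

variable {α : Type u} {ι F : Type} [DecidableEq ι]

/-- The program that checks that the input is the word `u`. -/
def checkWord (i : ι) (u : List α) : Prog α ι F :=
  seq (seqList (u.map fun a => act (.head i (.fwd a)))) (act (.head i .last))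

theorem exists_sem_checkWord {i : ι} {u w : List α} {s : Store ι F} (hs : s.2 i ≤ w.length) :
    (∃ t, (checkWord i u : Prog α ι F).Sem w s t) ↔ w.drop (s.2 i) = u := by
  induction u generalizing s with
  | nil =>
    rw [List.drop_eq_nil_iff]
    constructor
    · rintro ⟨t, m, h, h'⟩
      rw [sem_seqList_nil.1 h] at h'
      exact (sem_isLast.1 h').1.ge
    · exact fun h => ⟨s, s, sem_skip.2 rfl, sem_isLast.2 ⟨le_antisymm hs h, rfl⟩⟩
  | cons a u ih =>
    constructor
    · rintro ⟨t, m', ⟨m, h, h'⟩, h''⟩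
      obtain ⟨ha, rfl⟩ := sem_fwd.1 h
      obtain ⟨hlt, rfl⟩ := List.getElem?_eq_some_iff.1 ha
      have := (ih (by simpa using hlt)).1 ⟨t, m', h', h''⟩
      rw [List.drop_eq_getElem_cons hlt, ← this]
      simp
    · intro h
      have hlt : s.2 i < w.length := by
        by_contra hge
        rw [List.drop_eq_nil_of_le (not_lt.1 hge)] at h
        cases h
      rw [List.drop_eq_getElem_cons hlt, List.cons.injEq] at h
      obtain ⟨rfl, h⟩ := h
      obtain ⟨t, m', h', h''⟩ := (ih (s := (s.1, Function.update s.2 i (s.2 i + 1)))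
        (by simpa using hlt)).2 (by simpa using h)
      exact ⟨t, m', ⟨_, sem_fwd.2 ⟨by simp, rfl⟩, h'⟩, h''⟩

end Prog

/-- With sufficiently many registers, stacks of logarithmic height are represented by numbers that
do not exceed the length of the input. -/
theorem pow_le_of_log {B b C n : ℕ} (hB : B ≤ 2 ^ b) (hb : 0 < b) (hn : 2 ^ (2 * b) ≤ n) :
    B ^ ((C * (Nat.log 2 n + 1) + 2 * b * C) / (2 * b * C + 1)) ≤ n := by
  have hn0 : n ≠ 0 := by
    have := Nat.two_pow_pos (2 * b)
    omega
  set L := Nat.log 2 n with hL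
  have hbL : 2 * b ≤ L := (Nat.le_log_iff_pow_le (by norm_num) hn0).2 hn
  set x := (C * (L + 1) + 2 * b * C) / (2 * b * C + 1) with hx
  have hx' : x * (2 * b * C + 1) ≤ C * (L + 1) + 2 * b * C := Nat.div_mul_le_self _ _
  -- If `b * x` were at least `L + 1`, multiplying `hx'` by `b` would give (L + 1)(2bC + 1) ≤ bC(L +
  -- 1) + 2b²C. The last term is at most bCL because 2b ≤ L, so the right side is at most bC(2L +
  -- 1), which is too small.
  have key : b * x ≤ L := by
    by_contra hlt
    have hlt : L + 1 ≤ b * x := by omega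
    have h1 : (L + 1) * (2 * b * C + 1) ≤ b * (C * (L + 1) + 2 * b * C) :=
      (Nat.mul_le_mul_right _ hlt).trans (by rw [mul_assoc]; exact Nat.mul_le_mul_left _ hx')
    have h2 : b * C * (2 * b) ≤ b * C * L := Nat.mul_le_mul_left _ hbL
    nlinarith
  calc B ^ x ≤ (2 ^ b) ^ x := Nat.pow_le_pow_left hB x
    _ = 2 ^ (b * x) := (pow_mul _ _ _).symm
    _ ≤ 2 ^ L := Nat.pow_le_pow_right (by norm_num) key
    _ ≤ n := Nat.pow_log_le_self 2 hn0

open Prog in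
/-- The languages in nondeterministic logarithmic space are the languages of programs. -/
theorem exists_prog_of_mem_NLOGSPACE {α : Type u} [Finite α] {L : Language α}
    (hL : L ∈ NLOGSPACE α) : ∃ A : HeadNFA α, A.language = L := by
  have := Fintype.ofFinite α
  obtain ⟨M, ⟨C, hC⟩, rfl⟩ := hL
  have := M.finite_state
  have := M.finite_Γ
  -- A symbol costs at most `b` bits, so 2bC + 1 registers per stack leave each of them less than
  -- log n bits for large n, with room for rounding.
  obtain ⟨b, hb, hB⟩ : ∃ b, 0 < b ∧ base M.Γ ≤ 2 ^ b :=
    ⟨base M.Γ, Nat.succ_pos _, Nat.lt_two_pow_self.le⟩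
  -- The estimate of `pow_le_of_log` requires inputs of length at least `2 ^ (2 * b)`. The shorter
  -- accepted words form a finite set and are recognized one by one.
  have hfin : {w : List α | w ∈ M.language ∧ w.length < 2 ^ (2 * b)}.Finite :=
    (List.finite_length_lt α _).subset fun w hw => hw.2
  set p : Prog α (Option ((Fin M.k × Bool) × ℕ)) (M.State × Bool) :=
    alt (seq (sim M (2 * b * C)) (altList ((M.accepting ×ˢ Set.univ).toFinite.toFinset.toList.map
      fun f => act (.test f)))) (altList (hfin.toFinset.toList.map (checkWord none))) with hp
  obtain ⟨A, hA⟩ := exists_headNFA p (M.start, false)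
  refine ⟨A, hA.trans ?_⟩
  ext w
  constructor
  · rintro ⟨t, ⟨s, h1, h2⟩ | h⟩
    · obtain ⟨x, -, -, rfl, hx⟩ := h1.reachable_of_sim
      obtain ⟨q, hq, h2⟩ := sem_altList.1 h2
      obtain ⟨f, hf, rfl⟩ := List.mem_map.1 hq
      obtain ⟨h2, -⟩ := sem_test.1 h2
      refine ⟨x.cfg, hx, ?_⟩
      replace h2 : (x.state, x.flag) = f := h2
      subst h2
      rw [Finset.mem_toList, Set.Finite.mem_toFinset] at hf
      exact hf.1
    · obtain ⟨q, hq, h⟩ := sem_altList.1 h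
      obtain ⟨u, hu, rfl⟩ := List.mem_map.1 hq
      obtain rfl := (exists_sem_checkWord (Nat.zero_le _)).1 ⟨t, h⟩
      rw [Finset.mem_toList, Set.Finite.mem_toFinset] at hu
      simpa using hu.1
  · intro hw
    by_cases hlen : w.length < 2 ^ (2 * b)
    · obtain ⟨t, ht⟩ := (exists_sem_checkWord (F := M.State × Bool)
        (i := (none : Option ((Fin M.k × Bool) × ℕ))) (u := w) (w := w)
        (s := ((M.start, false), fun _ => 0)) (Nat.zero_le _)).2 rfl
      refine ⟨t, .inr (sem_altList.2 ⟨_, List.mem_map.2 ⟨w, ?_, rfl⟩, ht⟩)⟩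
      rw [Finset.mem_toList, Set.Finite.mem_toFinset]
      exact ⟨hw, hlen⟩
    · obtain ⟨c, hc, hacc⟩ := hw
      obtain ⟨x, -, rfl, -, hx⟩ := exists_sim (k := 2 * b * C) (hC w)
        (pow_le_of_log hB hb (not_lt.1 hlen)) hc
      refine ⟨_, .inl ⟨_, hx, sem_altList.2 ⟨_, List.mem_map.2 ⟨(x.state, x.flag), ?_, rfl⟩,
        sem_test.2 ⟨rfl, rfl⟩⟩⟩⟩
      rw [Finset.mem_toList, Set.Finite.mem_toFinset]
      exact ⟨hacc, trivial⟩

end HeadProg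

theorem mainTheorem2 {α : Type*} [Finite α] :
    FCDatalog.Captures (FCDatalog.linearFCDatalog α) (NSpace.NLOGSPACE α) := by
  refine Set.Subset.antisymm (fun L hL => ?_) ?_
  · obtain ⟨A, rfl⟩ := HeadProg.exists_prog_of_mem_NLOGSPACE hL
    exact ⟨A.program, A.isLinear_program, rfl, A.language_program⟩
  · rintro _ ⟨P, hP, hB, rfl⟩
    exact HeadProg.language_mem_NLOGSPACE_of_isLinear hP hB
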